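/- A cube complex is built from cubes $[-1,1]^k$ by gluing faces along combinatorial isomorphisms; its dimension is the maximal dimension of its cubes. The link of a vertex $v$ is the complex with one $(k-1)$-simplex for each corner of a $k$-cube at $v$. A CAT(0) cube complex is a simply connected cube complex in which the link of every vertex is a flag simplicial complex. A group $G$ has property $FW_n$ if for every action of $G$ by combinatorial automorphisms on an $n$-dimensional CAT(0) cube complex $X$, there is a point of $X$ that is fixed by every element of $G$. Lemma. Let $n\geq 0$ be an integer, let $K$, $G$ and $N$ be groups, and let $1\to K\to G\to N\to 1$ be a short exact sequence. If $K$ and $N$ have property $FW_n$, then $G$ has property $FW_n$. -/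

import Mathlib

/-!
Cube complexes, in the generality of cubes `[-1,1]^n` glued along faces by combinatorial
isomorphisms, their geometric realizations, links, simple connectedness, cubical group actions
and the fixed-point properties `FW_n`.
-/

universe u

/-- A combinatorial isomorphism from the cube `[-1,1]^m` onto a face of the cube `[-1,1]^n`.
The coordinate `emb i` of the target is `± x i`, the sign being `sign (emb i)`, and each
coordinate `j` outside the range of `emb` is constantly equal to `sign j`. -/
@[ext]
structure FaceMap (m n : ℕ) where
  emb : Fin m ↪ Fin n
  sign : Fin n → ℤˣ

namespace FaceMap

/-- The identity of `[-1,1]^n`. -/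
def id (n : ℕ) : FaceMap n n where
  emb := Function.Embedding.refl _
  sign := 1

/-- The composition `g ∘ f` (see `toFun_comp`). -/
noncomputable def comp {l m n : ℕ} (g : FaceMap m n) (f : FaceMap l m) : FaceMap l n where
  emb := f.emb.trans g.emb
  sign := fun j => g.sign j * Function.extend g.emb f.sign 1 j

/-- The map given by a face map on coordinates. -/
noncomputable def toFun {m n : ℕ} (f : FaceMap m n) (x : Fin m → ℝ) : Fin n → ℝ :=
  fun j => ((f.sign j : ℤ) : ℝ) * Function.extend f.emb x 1 j

theorem toFun_id (n : ℕ) (x : Fin n → ℝ) : (id n).toFun x = x := by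
  funext j
  have h : Function.extend (id n).emb x 1 j = x j :=
    (id n).emb.injective.extend_apply x 1 j
  simp only [toFun, h]
  simp [id]

theorem toFun_comp {l m n : ℕ} (g : FaceMap m n) (f : FaceMap l m) (x : Fin l → ℝ) :
    (g.comp f).toFun x = g.toFun (f.toFun x) := by
  funext j
  by_cases hj : ∃ i, g.emb i = j
  · obtain ⟨i, rfl⟩ := hj
    have h1 : Function.extend (g.comp f).emb x 1 (g.emb i) = Function.extend f.emb x 1 i := by
      by_cases hi : ∃ k, f.emb k = i
      · obtain ⟨k, rfl⟩ := hi
        rw [f.emb.injective.extend_apply]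
        exact (g.comp f).emb.injective.extend_apply x 1 k
      · rw [Function.extend_apply' _ _ _ hi, Function.extend_apply']
        · rfl
        · rintro ⟨k, hk⟩
          exact hi ⟨k, g.emb.injective hk⟩
    simp only [toFun, h1, g.emb.injective.extend_apply]
    simp only [comp, g.emb.injective.extend_apply]
    push_cast
    ring
  · have h1 : ¬ ∃ k, (g.comp f).emb k = j := fun ⟨k, hk⟩ => hj ⟨f.emb k, hk⟩
    simp only [toFun, Function.extend_apply' _ _ _ h1, Function.extend_apply' _ _ _ hj]
    simp [comp, Function.extend_apply' _ _ _ hj]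

theorem toFun_mem {m n : ℕ} (f : FaceMap m n) {x : Fin m → ℝ}
    (hx : x ∈ Set.Icc (-1 : Fin m → ℝ) 1) : f.toFun x ∈ Set.Icc (-1 : Fin n → ℝ) 1 := by
  have key : ∀ j, |f.toFun x j| ≤ 1 := by
    intro j
    have h1 : |Function.extend f.emb x 1 j| ≤ 1 := by
      by_cases hj : ∃ i, f.emb i = j
      · obtain ⟨i, rfl⟩ := hj
        rw [f.emb.injective.extend_apply]
        exact abs_le.2 ⟨hx.1 i, hx.2 i⟩
      · rw [Function.extend_apply' _ _ _ hj]
        simp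
    have h2 : |((f.sign j : ℤ) : ℝ)| = 1 := by
      rcases Int.units_eq_one_or (f.sign j) with h | h <;> simp [h]
    rw [toFun, abs_mul, h2, one_mul]
    exact h1
  exact ⟨fun j => (abs_le.1 (key j)).1, fun j => (abs_le.1 (key j)).2⟩

/-- The map given by a face map on the cube `[-1,1]^m`. -/
noncomputable def onCube {m n : ℕ} (f : FaceMap m n) (x : Set.Icc (-1 : Fin m → ℝ) 1) :
    Set.Icc (-1 : Fin n → ℝ) 1 :=
  ⟨f.toFun x, f.toFun_mem x.2⟩

/-- The inclusion of the corner `ε` of the `n`-cube. -/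
def corner {n : ℕ} (ε : Fin n → ℤˣ) : FaceMap 0 n where
  emb := ⟨Fin.elim0, fun i => i.elim0⟩
  sign := ε

/-- The edge of the `n`-cube in the direction of the coordinate `i` that starts at the corner
`(-1, …, -1)`. -/
def baseEdge {n : ℕ} (i : Fin n) : FaceMap 1 n where
  emb := ⟨fun _ => i, fun _ _ _ => Subsingleton.elim _ _⟩
  sign := Function.update (-1) i 1

/-- The edge of the `n`-cube in the direction of the coordinate `i` that ends at the corner
`(1, …, 1)`. -/
def topEdge {n : ℕ} (i : Fin n) : FaceMap 1 n where
  emb := ⟨fun _ => i, fun _ _ _ => Subsingleton.elim _ _⟩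
  sign := 1

/-- The reflection of the `1`-cube. -/
def flip : FaceMap 1 1 where
  emb := Function.Embedding.refl _
  sign := -1

end FaceMap

/-- A cube complex: cubes `[-1,1]^n` glued along faces by combinatorial isomorphisms.
It is recorded by its characteristic maps: `cube n` is the set of parametrizations
`[-1,1]^n → X` of the `n`-cubes of `X`, and `map f c` is the parametrization `c ∘ f` of a face
of `c` (or of `c` itself, if `f` is an automorphism of the cube). An `n`-cube of `X` is thus an
orbit of the automorphism group of `[-1,1]^n` in `cube n`; by `free` no cube is glued to itself
by a nontrivial automorphism. Distinct faces of one cube may be glued to each other, and two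
cubes may share several faces. -/
structure CubeComplex where
  cube : ℕ → Type u
  map : ∀ {m n : ℕ}, FaceMap m n → cube n → cube m
  map_id : ∀ {n : ℕ} (c : cube n), map (FaceMap.id n) c = c
  map_comp : ∀ {l m n : ℕ} (g : FaceMap m n) (f : FaceMap l m) (c : cube n),
    map (g.comp f) c = map f (map g c)
  free : ∀ {n : ℕ} (f : FaceMap n n) (c : cube n), map f c = c → f = FaceMap.id n

namespace CubeComplex

variable (X : CubeComplex.{u})

/-- The dimension of `X`, the maximal dimension of a cube of `X`, is `n`. -/
def HasDimension (n : ℕ) : Prop :=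
  Nonempty (X.cube n) ∧ ∀ m : ℕ, Nonempty (X.cube m) → m ≤ n

/-- A point of one of the cubes, before gluing. -/
abbrev PrePoint : Type u :=
  Σ n : ℕ, X.cube n × Set.Icc (-1 : Fin n → ℝ) 1

/-- The gluing: the point `x` of the face `c ∘ f` is the point `f x` of the cube `c`. -/
inductive Glue : X.PrePoint → X.PrePoint → Prop
  | glue {m n : ℕ} (f : FaceMap m n) (c : X.cube n) (x : Set.Icc (-1 : Fin m → ℝ) 1) :
      Glue ⟨m, X.map f c, x⟩ ⟨n, c, f.onCube x⟩

/-- The set of points of the geometric realization of `X`: the quotient of the disjoint union of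
the cubes by the equivalence relation that the gluing generates. -/
def Realization : Type u := Quot X.Glue

/-- The initial vertex (`0`-cube) of an oriented edge (parametrized `1`-cube). -/
def src (e : X.cube 1) : X.cube 0 := X.map (FaceMap.corner (-1)) e

/-- The terminal vertex of an oriented edge. -/
def tgt (e : X.cube 1) : X.cube 0 := X.map (FaceMap.corner 1) e

/-- The same edge with the opposite orientation. -/
def rev (e : X.cube 1) : X.cube 1 := X.map FaceMap.flip e

/-- The vertex of a parametrized cube at its corner `(-1, …, -1)`. -/
def base {n : ℕ} (c : X.cube n) : X.cube 0 := X.map (FaceMap.corner (-1)) c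

/-- The edge of a parametrized cube that starts at the corner `(-1, …, -1)` and has the direction
of the coordinate `i`. -/
def edgeAt {n : ℕ} (c : X.cube n) (i : Fin n) : X.cube 1 := X.map (FaceMap.baseEdge i) c

/-- The link of `v`. Its `0`-simplices are the ends of `1`-cubes at `v`, that is, the oriented
edges that start at `v`. Its `(n-1)`-simplices are the corners of `n`-cubes at `v`; a
parametrized `n`-cube `c` with `base c = v` is such a corner with an ordering
`edgeAt c 0, …, edgeAt c (n-1)` of its `0`-simplices.

The link of `v` is a simplicial complex: the `0`-simplices of a simplex are distinct, and they
determine the simplex. -/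
def LinkIsSimplicial (v : X.cube 0) : Prop :=
  (∀ (n : ℕ) (c : X.cube n), X.base c = v → Function.Injective (X.edgeAt c)) ∧
    ∀ (n : ℕ) (c c' : X.cube n), X.base c = v → X.base c' = v →
      X.edgeAt c = X.edgeAt c' → c = c'

/-- Two `0`-simplices of a link are joined by a `1`-simplex: the edges span a corner of a
square. -/
def LinkAdj (e e' : X.cube 1) : Prop :=
  ∃ s : X.cube 2, X.edgeAt s 0 = e ∧ X.edgeAt s 1 = e'

/-- The link of `v` is flag: each finite set of pairwise adjacent `0`-simplices spans a
simplex. -/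
def LinkIsFlag (v : X.cube 0) : Prop :=
  ∀ (n : ℕ) (e : Fin n → X.cube 1), (∀ i, X.src (e i) = v) →
    (∀ i j, i ≠ j → X.LinkAdj (e i) (e j)) → ∃ c : X.cube n, X.base c = v ∧ X.edgeAt c = e

/-- `X` is non-positively curved: the link of each vertex is a flag simplicial complex. -/
def IsNonpositivelyCurved : Prop :=
  ∀ v : X.cube 0, X.LinkIsSimplicial v ∧ X.LinkIsFlag v

/-- `l` is an edge path from `v` to `w`. -/
def IsEdgePath : X.cube 0 → X.cube 0 → List (X.cube 1) → Prop
  | v, w, [] => v = w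
  | v, w, e :: l => X.src e = v ∧ IsEdgePath (X.tgt e) w l

/-- The elementary homotopies of edge paths: a backtrack is removed, or one half of the boundary
of a square is replaced by the complementary half. -/
inductive ElementaryHomotopy : List (X.cube 1) → List (X.cube 1) → Prop
  | backtrack (l₁ : List (X.cube 1)) (e : X.cube 1) (l₂ : List (X.cube 1)) :
      ElementaryHomotopy (l₁ ++ [e, X.rev e] ++ l₂) (l₁ ++ l₂)
  | square (l₁ : List (X.cube 1)) (s : X.cube 2) (l₂ : List (X.cube 1)) :
      ElementaryHomotopy
        (l₁ ++ [X.map (FaceMap.baseEdge 0) s, X.map (FaceMap.topEdge 1) s] ++ l₂)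
        (l₁ ++ [X.map (FaceMap.baseEdge 1) s, X.map (FaceMap.topEdge 0) s] ++ l₂)

/-- Homotopy of edge paths from `v` to `w`. -/
def Homotopic (v w : X.cube 0) : List (X.cube 1) → List (X.cube 1) → Prop :=
  Relation.EqvGen fun l l' =>
    X.IsEdgePath v w l ∧ X.IsEdgePath v w l' ∧ X.ElementaryHomotopy l l'

/-- `X` is simply connected: it is non-empty, any two vertices are joined by an edge path, and
every closed edge path is null-homotopic (the edge-path fundamental group is trivial). -/
def IsSimplyConnected : Prop :=
  Nonempty (X.cube 0) ∧ (∀ v w : X.cube 0, ∃ l, X.IsEdgePath v w l) ∧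
    ∀ (v : X.cube 0) (l : List (X.cube 1)), X.IsEdgePath v v l → X.Homotopic v v l []

/-- `X` is a `CAT(0)` cube complex: simply connected and non-positively curved. -/
def IsCAT0 : Prop :=
  X.IsSimplyConnected ∧ X.IsNonpositivelyCurved

end CubeComplex

/-- An action of `G` on the cube complex `X` by combinatorial automorphisms. -/
structure CubicalAction (G : Type u) [Group G] (X : CubeComplex.{u}) where
  smul : ∀ {n : ℕ}, G → X.cube n → X.cube n
  one_smul : ∀ {n : ℕ} (c : X.cube n), smul 1 c = c
  mul_smul : ∀ {n : ℕ} (g h : G) (c : X.cube n), smul (g * h) c = smul g (smul h c)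
  map_smul : ∀ {m n : ℕ} (f : FaceMap m n) (g : G) (c : X.cube n),
    X.map f (smul g c) = smul g (X.map f c)

namespace CubicalAction

variable {G : Type u} [Group G] {X : CubeComplex.{u}}

/-- The action on the points of the geometric realization: `g` sends the point `x` of the cube
`c` to the point `x` of the cube `g c`. -/
def onPoints (ρ : CubicalAction G X) (g : G) : X.Realization → X.Realization :=
  Quot.map (fun p => ⟨p.1, ρ.smul g p.2.1, p.2.2⟩) (by
    rintro _ _ ⟨f, c, x⟩
    have h := CubeComplex.Glue.glue f (ρ.smul g c) x
    rwa [ρ.map_smul] at h)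

/-- The set of points of `X` that all elements of `G` fix. -/
def fixedPoints (ρ : CubicalAction G X) : Set X.Realization :=
  {p | ∀ g : G, ρ.onPoints g p = p}

end CubicalAction

/-- `G` has property `FW_n`: every action of `G` on an `n`-dimensional `CAT(0)` cube complex has a
non-empty fixed-point set. Complexes in the universe of `G` suffice: the convex hull of the orbit
of an `n`-cube is an invariant `n`-dimensional subcomplex with at most `max |G| ℵ₀` cubes. -/
def HasFW (n : ℕ) (G : Type u) [Group G] : Prop :=
  ∀ X : CubeComplex.{u}, X.IsCAT0 → X.HasDimension n →
    ∀ ρ : CubicalAction G X, ρ.fixedPoints.Nonempty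

/-! A CAT(0) cube complex is governed by the halfspaces of its vertex set. A cube is recorded by the
set `σ` of halfspaces that contain it (`IsCell`); the undecided walls are those that the cube
crosses, so a larger `σ` is a smaller cube. In this language fixed points become invariant cells:
the halfspaces around the carrier of a fixed point form an invariant cell, and the centre of the
cube of an invariant cell is fixed (`CubicalAction.fixedPoints_nonempty`).

Let `G` act on `X`. Since `K` has `FW_n`, it leaves some cell invariant. The set of all
`K`-invariant cells, to be thought of as centres of cubes in the fixed set of `K`, carries the walls
induced from `X`. It is again a wall system (`IsWallSystem.fixedHalfspaces`), and induced walls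
cross only if the original ones do, so its rank is at most `n` (`HasRankLE.fixedHalfspaces`). As `K`
acts trivially on it, `N` acts. Property `FW_n` of `N`, applied to the dual cube complex, gives an
`N`-invariant set of cells that behaves like a set of corners of one cube
(`exists_invariant_isCubical`); a rank below `n` is made up for by products with edges. The union of
these cells is consistent because of `FixedCell.exists_crossing`, and is a `G`-invariant cell.

Two bridges are needed. From `X` to walls, `IsCAT0.isWallSystem` and `IsCAT0.exists_cube_of_isCell`
rest on `IsCAT0.flipEquiv`: reduced edge paths with the same ends differ by exchanging halves of
squares. From walls to cube complexes, `dualComplex.isCAT0` obtains simple connectedness by pushing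
down the peaks of closed paths. -/

namespace FaceMap

/-! ### Combinatorics of face maps: corners, edges and squares of a cube. -/

theorem comp_eq_iff {l m n : ℕ} {g : FaceMap m n} {f : FaceMap l m} {h : FaceMap l n} :
    g.comp f = h ↔ (∀ i, g.emb (f.emb i) = h.emb i) ∧
      (∀ i, g.sign (g.emb i) * f.sign i = h.sign (g.emb i)) ∧
      ∀ j, (∀ i, g.emb i ≠ j) → g.sign j = h.sign j := by
  constructor
  · rintro rfl
    refine ⟨fun i => rfl, fun i => ?_, fun j hj => ?_⟩
    · simp [comp, g.emb.injective.extend_apply]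
    · have : ¬ ∃ i, g.emb i = j := fun ⟨i, hi⟩ => hj i hi
      simp [comp, Function.extend_apply' _ _ _ this]
  · rintro ⟨h1, h2, h3⟩
    ext j
    · exact congrArg Fin.val (h1 j)
    · by_cases hj : ∃ i, g.emb i = j
      · obtain ⟨i, rfl⟩ := hj
        simp only [comp, g.emb.injective.extend_apply, h2]
      · rw [← h3 j fun i hi => hj ⟨i, hi⟩]
        simp [comp, Function.extend_apply' _ _ _ hj]

/-- The action of a face map on corners. -/
noncomputable def act {m n : ℕ} (f : FaceMap m n) (ε : Fin m → ℤˣ) : Fin n → ℤˣ :=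
  fun j => f.sign j * Function.extend f.emb ε 1 j

theorem act_emb {m n : ℕ} (f : FaceMap m n) (ε : Fin m → ℤˣ) (i : Fin m) :
    f.act ε (f.emb i) = f.sign (f.emb i) * ε i := by
  simp [act, f.emb.injective.extend_apply]

theorem act_of_notMem {m n : ℕ} (f : FaceMap m n) (ε : Fin m → ℤˣ) (j : Fin n)
    (hj : ∀ i, f.emb i ≠ j) : f.act ε j = f.sign j := by
  have : ¬ ∃ i, f.emb i = j := fun ⟨i, hi⟩ => hj i hi
  simp [act, Function.extend_apply' _ _ _ this]

theorem comp_corner {m n : ℕ} (f : FaceMap m n) (ε : Fin m → ℤˣ) :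
    f.comp (corner ε) = corner (f.act ε) := by
  ext j
  · exact j.elim0
  · rfl

theorem corner_injective {n : ℕ} : Function.Injective (corner (n := n)) := fun _ _ h =>
  congrArg FaceMap.sign h

theorem comp_assoc {k l m n : ℕ} (h : FaceMap m n) (g : FaceMap l m) (f : FaceMap k l) :
    (h.comp g).comp f = h.comp (g.comp f) := by
  refine comp_eq_iff.2 ⟨fun i => rfl, fun i => ?_, fun j hj => ?_⟩
  · have h1 := (comp_eq_iff (g := h) (f := g)).1 rfl
    have h2 := (comp_eq_iff (g := h) (f := g.comp f)).1 rfl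
    have h3 := (comp_eq_iff (g := g) (f := f)).1 rfl
    change (h.comp g).sign (h.emb (g.emb i)) * _ = (h.comp (g.comp f)).sign (h.emb (g.emb i))
    rw [← h1.2.1, ← h2.2.1, ← h3.2.1, mul_assoc]
  · have h1 := (comp_eq_iff (g := h) (f := g)).1 rfl
    have h2 := (comp_eq_iff (g := h) (f := g.comp f)).1 rfl
    have h3 := (comp_eq_iff (g := g) (f := f)).1 rfl
    by_cases hh : ∃ i, h.emb i = j
    · obtain ⟨i, rfl⟩ := hh
      rw [← h1.2.1, ← h2.2.1, h3.2.2 i fun k hk => hj k (congrArg h.emb hk)]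
    · have hh' : ∀ i, h.emb i ≠ j := fun i hi => hh ⟨i, hi⟩
      rw [← h1.2.2 j hh', ← h2.2.2 j hh']

theorem act_comp {l m n : ℕ} (g : FaceMap m n) (f : FaceMap l m) (ε : Fin l → ℤˣ) :
    (g.comp f).act ε = g.act (f.act ε) := by
  apply corner_injective
  rw [← comp_corner, comp_assoc, comp_corner, comp_corner]

theorem act_id {n : ℕ} (ε : Fin n → ℤˣ) : (id n).act ε = ε := by
  funext j
  have := act_emb (id n) ε j
  simpa [id] using this

/-- The corner `1` reveals the signs, and a corner with a single entry `-1` reveals where that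
coordinate goes. The dual complex satisfies `free` for this reason. -/
theorem eq_id_of_act {n : ℕ} {f : FaceMap n n} (h : ∀ ε, f.act ε = ε) : f = id n := by
  have hs : f.sign = 1 := by
    funext j
    have h1 := congrFun (h 1) j
    by_cases hj : ∃ i, f.emb i = j
    · obtain ⟨i, rfl⟩ := hj
      simpa [act_emb] using h1
    · rwa [act_of_notMem _ _ _ fun i hi => hj ⟨i, hi⟩] at h1
  have he : ∀ i, f.emb i = i := by
    intro i
    by_contra hi
    have h1 := congrFun (h (Function.update 1 i (-1))) (f.emb i)
    rw [act_emb, hs, Function.update_self, Function.update_of_ne hi] at h1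
    simp at h1
  ext j
  · simp [he, id]
  · rw [hs]; rfl

/-- The permutation of the two coordinates of the square. -/
def swap : FaceMap 2 2 := ⟨(Equiv.swap 0 1).toEmbedding, 1⟩

/-- The reflection of the square in the coordinate `0`. -/
def reflect : FaceMap 2 2 := ⟨Function.Embedding.refl _, ![-1, 1]⟩

/-- The edge of the `n`-cube through the corner `ε` in the direction of the coordinate `i`. -/
def edgeThrough {n : ℕ} (ε : Fin n → ℤˣ) (i : Fin n) : FaceMap 1 n where
  emb := ⟨fun _ => i, fun _ _ _ => Subsingleton.elim _ _⟩
  sign := Function.update ε i 1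

/-- The square of the `n`-cube through the corner `ε` in the directions `i` and `j`. -/
def squareThrough {n : ℕ} (ε : Fin n → ℤˣ) (i j : Fin n) (h : i ≠ j) : FaceMap 2 n where
  emb := ⟨![i, j], by
    intro a b hab
    fin_cases a <;> fin_cases b <;> simp_all [eq_comm]⟩
  sign := Function.update (Function.update ε i 1) j 1

@[simp] theorem edgeThrough_emb {n : ℕ} (ε : Fin n → ℤˣ) (i : Fin n) (a : Fin 1) :
    (edgeThrough ε i).emb a = i := rfl

@[simp] theorem squareThrough_emb_zero {n : ℕ} (ε : Fin n → ℤˣ) (i j : Fin n) (h : i ≠ j) :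
    (squareThrough ε i j h).emb 0 = i := rfl

@[simp] theorem squareThrough_emb_one {n : ℕ} (ε : Fin n → ℤˣ) (i j : Fin n) (h : i ≠ j) :
    (squareThrough ε i j h).emb 1 = j := rfl

@[simp] theorem edgeThrough_sign {n : ℕ} (ε : Fin n → ℤˣ) (i : Fin n) :
    (edgeThrough ε i).sign = Function.update ε i 1 := rfl

@[simp] theorem squareThrough_sign {n : ℕ} (ε : Fin n → ℤˣ) (i j : Fin n) (h : i ≠ j) :
    (squareThrough ε i j h).sign = Function.update (Function.update ε i 1) j 1 := rfl

theorem edgeThrough_one {n : ℕ} (i : Fin n) : edgeThrough 1 i = topEdge i := by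
  ext j
  · rfl
  · simp [edgeThrough, topEdge]

theorem edgeThrough_update {n : ℕ} (ε : Fin n → ℤˣ) (i : Fin n) (s : ℤˣ) :
    edgeThrough (Function.update ε i s) i = edgeThrough ε i := by
  simp [edgeThrough]

theorem edgeThrough_comp_corner {n : ℕ} (ε : Fin n → ℤˣ) (i : Fin n) (s : Fin 1 → ℤˣ) :
    (edgeThrough ε i).comp (corner s) = corner (Function.update ε i (s 0)) := by
  rw [comp_corner]
  congr 1
  funext j
  by_cases hj : i = j
  · subst hj
    have := act_emb (edgeThrough ε i) s 0
    simpa using this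
  · rw [act_of_notMem _ _ _ (by simpa using hj)]
    simp [edgeThrough, Function.update_of_ne (Ne.symm hj)]

theorem squareThrough_edge_zero {n : ℕ} (ε : Fin n → ℤˣ) (i j : Fin n) (h : i ≠ j)
    (s : Fin 2 → ℤˣ) :
    (squareThrough ε i j h).comp (edgeThrough s 0) =
      edgeThrough (Function.update ε j (s 1)) i := by
  refine comp_eq_iff.2 ⟨fun a => rfl, fun a => ?_, fun k hk => ?_⟩
  · fin_cases a
    · simp [h]
    · simp [h.symm]
  · have h0 : i ≠ k := hk 0
    have h1 : j ≠ k := hk 1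
    simp [h0.symm, h1.symm]

theorem squareThrough_edge_one {n : ℕ} (ε : Fin n → ℤˣ) (i j : Fin n) (h : i ≠ j)
    (s : Fin 2 → ℤˣ) :
    (squareThrough ε i j h).comp (edgeThrough s 1) =
      edgeThrough (Function.update ε i (s 0)) j := by
  refine comp_eq_iff.2 ⟨fun a => rfl, fun a => ?_, fun k hk => ?_⟩
  · fin_cases a
    · simp [h]
    · simp
  · have h0 : i ≠ k := hk 0
    have h1 : j ≠ k := hk 1
    simp [h0.symm, h1.symm]

/-- `comp` is noncomputable; `comp_eq_iff` turns these identities into finitely many equations of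
indices and signs, within reach of `decide`. -/
theorem flip_comp_flip : flip.comp flip = id 1 := comp_eq_iff.2 (by decide)
theorem flip_comp_neg : flip.comp (corner (-1)) = corner 1 := comp_eq_iff.2 (by decide)
theorem flip_comp_one : flip.comp (corner 1) = corner (-1) := comp_eq_iff.2 (by decide)
theorem swap_base (i : Fin 2) : swap.comp (baseEdge i) = baseEdge (Equiv.swap 0 1 i) :=
  comp_eq_iff.2 (by revert i; decide)
theorem swap_top (i : Fin 2) : swap.comp (topEdge i) = topEdge (Equiv.swap 0 1 i) :=
  comp_eq_iff.2 (by revert i; decide)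
theorem reflect_base_zero : reflect.comp (baseEdge 0) = (baseEdge 0).comp flip :=
  comp_eq_iff.2 (by
    obtain ⟨h1, h2, h3⟩ := (comp_eq_iff (g := baseEdge (n := 2) 0) (f := flip)).1 rfl
    refine ⟨by decide, fun i => ?_, fun j hj => absurd rfl (hj j)⟩
    fin_cases i
    · exact (by decide : _ = _).trans (h2 0)
    · exact (by decide : _ = _).trans (h3 1 (by decide)))
theorem reflect_base_one : reflect.comp (baseEdge 1) = topEdge 1 := comp_eq_iff.2 (by decide)
theorem reflect_top_one : reflect.comp (topEdge 1) = baseEdge 1 := comp_eq_iff.2 (by decide)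
theorem reflect_top_zero : reflect.comp (topEdge 0) = (topEdge 0).comp flip :=
  comp_eq_iff.2 (by
    obtain ⟨h1, h2, h3⟩ := (comp_eq_iff (g := topEdge (n := 2) 0) (f := flip)).1 rfl
    refine ⟨by decide, fun i => ?_, fun j hj => absurd rfl (hj j)⟩
    fin_cases i
    · exact (by decide : _ = _).trans (h2 0)
    · exact (by decide : _ = _).trans (h3 1 (by decide)))

end FaceMap

/-! ### Squares and their symmetries; the `3`-cube spanned by three squares. -/

namespace CubeComplex

variable {X : CubeComplex.{u}}

/-- The edge of a parametrized cube that ends at the corner `(1, …, 1)` and has the direction of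
the coordinate `i`. -/
def topAt (X : CubeComplex.{u}) {n : ℕ} (c : X.cube n) (i : Fin n) : X.cube 1 :=
  X.map (FaceMap.topEdge i) c

theorem rev_rev (e : X.cube 1) : X.rev (X.rev e) = e := by
  rw [rev, rev, ← X.map_comp, FaceMap.flip_comp_flip, X.map_id]

theorem rev_inj {e f : X.cube 1} : X.rev e = X.rev f ↔ e = f :=
  ⟨fun h => by rw [← rev_rev e, h, rev_rev], fun h => by rw [h]⟩

theorem src_rev (e : X.cube 1) : X.src (X.rev e) = X.tgt e := by
  rw [src, rev, ← X.map_comp, FaceMap.flip_comp_neg, tgt]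

theorem tgt_rev (e : X.cube 1) : X.tgt (X.rev e) = X.src e := by
  rw [tgt, rev, ← X.map_comp, FaceMap.flip_comp_one, src]

theorem src_edgeThrough {n : ℕ} (c : X.cube n) (ε : Fin n → ℤˣ) (i : Fin n) :
    X.src (X.map (FaceMap.edgeThrough ε i) c) =
      X.map (FaceMap.corner (Function.update ε i (-1))) c := by
  rw [src, ← X.map_comp, FaceMap.edgeThrough_comp_corner]; rfl

theorem tgt_edgeThrough {n : ℕ} (c : X.cube n) (ε : Fin n → ℤˣ) (i : Fin n) :
    X.tgt (X.map (FaceMap.edgeThrough ε i) c) =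
      X.map (FaceMap.corner (Function.update ε i 1)) c := by
  rw [tgt, ← X.map_comp, FaceMap.edgeThrough_comp_corner]; rfl

theorem edgeAt_eq {n : ℕ} (c : X.cube n) (i : Fin n) :
    X.edgeAt c i = X.map (FaceMap.edgeThrough (-1) i) c := rfl

theorem topAt_eq {n : ℕ} (c : X.cube n) (i : Fin n) :
    X.topAt c i = X.map (FaceMap.edgeThrough 1 i) c := by
  rw [topAt, FaceMap.edgeThrough_one]

theorem src_edgeAt {n : ℕ} (c : X.cube n) (i : Fin n) : X.src (X.edgeAt c i) = X.base c := by
  rw [edgeAt_eq, src_edgeThrough, base]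
  congr 2
  simp

theorem tgt_edgeAt_zero (s : X.cube 2) : X.tgt (X.edgeAt s 0) = X.src (X.topAt s 1) := by
  rw [edgeAt_eq, topAt_eq, src_edgeThrough, tgt_edgeThrough]
  congr 2
  decide

theorem tgt_edgeAt_one (s : X.cube 2) : X.tgt (X.edgeAt s 1) = X.src (X.topAt s 0) := by
  rw [edgeAt_eq, topAt_eq, src_edgeThrough, tgt_edgeThrough]
  congr 2
  decide

theorem tgt_topAt_zero (s : X.cube 2) : X.tgt (X.topAt s 0) = X.tgt (X.topAt s 1) := by
  rw [topAt_eq, topAt_eq, tgt_edgeThrough, tgt_edgeThrough]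
  congr 2
  decide

/-- The square with its coordinates permuted. -/
def swap (X : CubeComplex.{u}) (s : X.cube 2) : X.cube 2 := X.map FaceMap.swap s

/-- The square reflected in its coordinate `0`. -/
def reflect (X : CubeComplex.{u}) (s : X.cube 2) : X.cube 2 := X.map FaceMap.reflect s

theorem edgeAt_swap (s : X.cube 2) (i : Fin 2) :
    X.edgeAt (X.swap s) i = X.edgeAt s (Equiv.swap 0 1 i) := by
  rw [edgeAt, swap, ← X.map_comp, FaceMap.swap_base, edgeAt]

theorem topAt_swap (s : X.cube 2) (i : Fin 2) :
    X.topAt (X.swap s) i = X.topAt s (Equiv.swap 0 1 i) := by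
  rw [topAt, swap, ← X.map_comp, FaceMap.swap_top, topAt]

@[simp] theorem edgeAt_swap_zero (s : X.cube 2) : X.edgeAt (X.swap s) 0 = X.edgeAt s 1 :=
  edgeAt_swap s 0
@[simp] theorem edgeAt_swap_one (s : X.cube 2) : X.edgeAt (X.swap s) 1 = X.edgeAt s 0 :=
  edgeAt_swap s 1
@[simp] theorem topAt_swap_zero (s : X.cube 2) : X.topAt (X.swap s) 0 = X.topAt s 1 :=
  topAt_swap s 0
@[simp] theorem topAt_swap_one (s : X.cube 2) : X.topAt (X.swap s) 1 = X.topAt s 0 :=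
  topAt_swap s 1

@[simp] theorem edgeAt_reflect_zero (s : X.cube 2) :
    X.edgeAt (X.reflect s) 0 = X.rev (X.edgeAt s 0) := by
  rw [edgeAt, reflect, ← X.map_comp, FaceMap.reflect_base_zero, X.map_comp]; rfl
@[simp] theorem edgeAt_reflect_one (s : X.cube 2) :
    X.edgeAt (X.reflect s) 1 = X.topAt s 1 := by
  rw [edgeAt, reflect, ← X.map_comp, FaceMap.reflect_base_one]; rfl
@[simp] theorem topAt_reflect_one (s : X.cube 2) :
    X.topAt (X.reflect s) 1 = X.edgeAt s 1 := by
  rw [topAt, reflect, ← X.map_comp, FaceMap.reflect_top_one]; rfl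
@[simp] theorem topAt_reflect_zero (s : X.cube 2) :
    X.topAt (X.reflect s) 0 = X.rev (X.topAt s 0) := by
  rw [topAt, reflect, ← X.map_comp, FaceMap.reflect_top_zero, X.map_comp]; rfl

theorem IsNonpositivelyCurved.edgeAt_ne (hX : X.IsNonpositivelyCurved) (s : X.cube 2) :
    X.edgeAt s 0 ≠ X.edgeAt s 1 := fun h =>
  absurd ((hX (X.base s)).1.1 2 s rfl h) (by decide)

theorem base_eq_of_edgeAt {n : ℕ} {s s' : X.cube n} {i j : Fin n}
    (h : X.edgeAt s i = X.edgeAt s' j) : X.base s = X.base s' := by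
  rw [← src_edgeAt s i, h, src_edgeAt]

/-- A link has no double edges. Squares are identified below by comparing their two edges at one
corner. -/
theorem IsNonpositivelyCurved.square_unique (hX : X.IsNonpositivelyCurved) {s s' : X.cube 2}
    (h0 : X.edgeAt s 0 = X.edgeAt s' 0) (h1 : X.edgeAt s 1 = X.edgeAt s' 1) : s = s' := by
  refine (hX (X.base s)).1.2 2 s s' rfl (base_eq_of_edgeAt h0).symm ?_
  funext i
  fin_cases i
  · exact h0
  · exact h1

/-- Three squares that pairwise share an edge at a vertex are faces of a `3`-cube; `A'`, `B'`, `C'`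
are the opposite faces. -/
theorem IsNonpositivelyCurved.exists_opposite_squares (hX : X.IsNonpositivelyCurved)
    {A B C : X.cube 2} (hAB : X.edgeAt A 0 = X.edgeAt B 0) (hAC : X.edgeAt A 1 = X.edgeAt C 0)
    (hBC : X.edgeAt B 1 = X.edgeAt C 1) :
    ∃ A' B' C' : X.cube 2, X.edgeAt A' 0 = X.topAt B 0 ∧ X.edgeAt A' 1 = X.topAt C 0 ∧
      X.edgeAt B' 0 = X.topAt A 0 ∧ X.edgeAt B' 1 = X.topAt C 1 ∧
      X.edgeAt C' 0 = X.topAt A 1 ∧ X.edgeAt C' 1 = X.topAt B 1 ∧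
      X.topAt A' 0 = X.topAt B' 0 ∧ X.topAt A' 1 = X.topAt C' 0 ∧
      X.topAt B' 1 = X.topAt C' 1 := by
  have adj : ∀ s : X.cube 2, X.LinkAdj (X.edgeAt s 1) (X.edgeAt s 0) := fun s =>
    ⟨X.swap s, by simp, by simp⟩
  -- The three edges at the common corner are pairwise adjacent, so flagness yields a `3`-cube.
  obtain ⟨c, hc, hce⟩ := (hX (X.base A)).2 3 ![X.edgeAt A 0, X.edgeAt A 1, X.edgeAt B 1] (by
      intro i
      fin_cases i
      · exact src_edgeAt _ _
      · exact src_edgeAt _ _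
      · exact (src_edgeAt B 1).trans (base_eq_of_edgeAt hAB).symm) (by
      intro i j hij
      fin_cases i <;> fin_cases j
      · exact absurd rfl hij
      · exact ⟨A, rfl, rfl⟩
      · exact ⟨B, hAB.symm, rfl⟩
      · exact adj A
      · exact absurd rfl hij
      · exact ⟨C, hAC.symm, hBC.symm⟩
      · exact (show X.LinkAdj (X.edgeAt B 1) (X.edgeAt A 0) from hAB ▸ adj B)
      · exact (show X.LinkAdj (X.edgeAt B 1) (X.edgeAt A 1) from hAC ▸ hBC ▸ adj C)
      · exact absurd rfl hij)
  have h01 : (0 : Fin 3) ≠ 1 := by decide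
  have h02 : (0 : Fin 3) ≠ 2 := by decide
  have h12 : (1 : Fin 3) ≠ 2 := by decide
  have he : ∀ (i j : Fin 3) (h : i ≠ j) (ε : Fin 3 → ℤˣ),
      X.edgeAt (X.map (FaceMap.squareThrough ε i j h) c) 0 =
        X.map (FaceMap.edgeThrough (Function.update ε j (-1)) i) c ∧
      X.edgeAt (X.map (FaceMap.squareThrough ε i j h) c) 1 =
        X.map (FaceMap.edgeThrough (Function.update ε i (-1)) j) c ∧
      X.topAt (X.map (FaceMap.squareThrough ε i j h) c) 0 =
        X.map (FaceMap.edgeThrough (Function.update ε j 1) i) c ∧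
      X.topAt (X.map (FaceMap.squareThrough ε i j h) c) 1 =
        X.map (FaceMap.edgeThrough (Function.update ε i 1) j) c := by
    intro i j h ε
    simp only [edgeAt_eq, topAt_eq, ← X.map_comp, FaceMap.squareThrough_edge_zero,
      FaceMap.squareThrough_edge_one]
    exact ⟨rfl, rfl, rfl, rfl⟩
  have hneg : ∀ i : Fin 3, Function.update (-1 : Fin 3 → ℤˣ) i (-1) = -1 := by decide
  have key : ∀ (S : X.cube 2) (i j : Fin 3) (h : i ≠ j), X.edgeAt S 0 = X.edgeAt c i →
      X.edgeAt S 1 = X.edgeAt c j → S = X.map (FaceMap.squareThrough (-1) i j h) c := by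
    intro S i j h h0 h1
    refine hX.square_unique ?_ ?_
    · rw [h0, (he i j h _).1, hneg]; rfl
    · rw [h1, (he i j h _).2.1, hneg]; rfl
  have hA := key A 0 1 h01 (congrFun hce 0).symm (congrFun hce 1).symm
  have hB := key B 0 2 h02 (hAB.symm.trans (congrFun hce 0).symm) (congrFun hce 2).symm
  have hC := key C 1 2 h12 (hAC.symm.trans (congrFun hce 1).symm)
    (hBC.symm.trans (congrFun hce 2).symm)
  -- The opposite faces are those through the corner `(1, 1, 1)` in the same pairs of directions.
  refine ⟨X.map (FaceMap.squareThrough 1 0 1 h01) c, X.map (FaceMap.squareThrough 1 0 2 h02) c,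
    X.map (FaceMap.squareThrough 1 1 2 h12) c, ?_⟩
  rw [hA, hB, hC]
  simp only [he]
  refine ⟨?_, ?_, ?_, ?_, ?_, ?_, ?_, ?_, ?_⟩ <;> congr 1 <;>
    simp only [FaceMap.edgeThrough] <;> congr 1 <;> decide

end CubeComplex

/-! ### Edge paths modulo exchanging halves of squares; reduced paths. -/

namespace CubeComplex

variable {X : CubeComplex.{u}}

/-- One half of the boundary of a square is replaced by the complementary half. -/
inductive Flip (X : CubeComplex.{u}) : List (X.cube 1) → List (X.cube 1) → Prop
  | head (s : X.cube 2) (l : List (X.cube 1)) :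
      Flip X (X.edgeAt s 0 :: X.topAt s 1 :: l) (X.edgeAt s 1 :: X.topAt s 0 :: l)
  | cons (e : X.cube 1) {l l' : List (X.cube 1)} : Flip X l l' → Flip X (e :: l) (e :: l')

theorem Flip.symm {l l' : List (X.cube 1)} (h : X.Flip l l') : X.Flip l' l := by
  induction h with
  | head s l => simpa using Flip.head (X.swap s) l
  | cons e _ ih => exact ih.cons e

theorem Flip.length_eq {l l' : List (X.cube 1)} (h : X.Flip l l') : l.length = l'.length := by
  induction h with
  | head s l => rfl
  | cons e _ ih => simp [ih]

theorem Flip.isEdgePath {l l' : List (X.cube 1)} (h : X.Flip l l') {v w : X.cube 0}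
    (hl : X.IsEdgePath v w l) : X.IsEdgePath v w l' := by
  induction h generalizing v with
  | head s l =>
    obtain ⟨h1, h2, h3⟩ := hl
    exact ⟨by rw [src_edgeAt, ← h1, src_edgeAt], (tgt_edgeAt_one s).symm, by rwa [tgt_topAt_zero]⟩
  | cons e _ ih => exact ⟨hl.1, ih hl.2⟩

/-- Equivalence of edge paths under exchanging halves of boundaries of squares. -/
def FlipEquiv (X : CubeComplex.{u}) : List (X.cube 1) → List (X.cube 1) → Prop :=
  Relation.ReflTransGen X.Flip

namespace FlipEquiv

@[refl] theorem refl (l : List (X.cube 1)) : X.FlipEquiv l l := Relation.ReflTransGen.refl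

theorem symm {l l' : List (X.cube 1)} (h : X.FlipEquiv l l') : X.FlipEquiv l' l := by
  induction h with
  | refl => exact refl _
  | tail _ h ih => exact Relation.ReflTransGen.head h.symm ih

theorem trans {l l' l'' : List (X.cube 1)} (h : X.FlipEquiv l l') (h' : X.FlipEquiv l' l'') :
    X.FlipEquiv l l'' := Relation.ReflTransGen.trans h h'

theorem cons (e : X.cube 1) {l l' : List (X.cube 1)} (h : X.FlipEquiv l l') :
    X.FlipEquiv (e :: l) (e :: l') := by
  induction h with
  | refl => exact refl _
  | tail _ h ih => exact Relation.ReflTransGen.tail ih (h.cons e)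

theorem head (s : X.cube 2) (l : List (X.cube 1)) :
    X.FlipEquiv (X.edgeAt s 0 :: X.topAt s 1 :: l) (X.edgeAt s 1 :: X.topAt s 0 :: l) :=
  Relation.ReflTransGen.single (.head s l)

theorem length_eq {l l' : List (X.cube 1)} (h : X.FlipEquiv l l') : l.length = l'.length := by
  induction h with
  | refl => rfl
  | tail _ h ih => exact ih.trans h.length_eq

theorem isEdgePath {l l' : List (X.cube 1)} (h : X.FlipEquiv l l') {v w : X.cube 0}
    (hl : X.IsEdgePath v w l) : X.IsEdgePath v w l' := by
  induction h with
  | refl => exact hl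
  | tail _ h ih => exact h.isEdgePath ih

end FlipEquiv

/-- The relation between the heads and tails of equivalent edge paths. -/
def HeadRel (X : CubeComplex.{u}) (a : X.cube 1) (p : List (X.cube 1)) (b : X.cube 1)
    (q : List (X.cube 1)) : Prop :=
  (a = b ∧ X.FlipEquiv p q) ∨ ∃ (s : X.cube 2) (r : List (X.cube 1)), X.edgeAt s 0 = a ∧ X.edgeAt s 1 = b ∧
    X.FlipEquiv p (X.topAt s 1 :: r) ∧ X.FlipEquiv q (X.topAt s 0 :: r)

theorem Flip.headRel {a b : X.cube 1} {p q : List (X.cube 1)} (h : X.Flip (a :: p) (b :: q)) :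
    X.HeadRel a p b q := by
  cases h with
  | head s l => exact .inr ⟨s, l, rfl, rfl, .refl _, .refl _⟩
  | cons e h => exact .inl ⟨rfl, .single h⟩

/-- The main case is that of two squares `s` and `s'` that share the edge `b`. At the far end of `b`
the hypothesis `ih` compares the continuations. If these start with the same edge, `s` and `s'`
agree up to symmetry. Otherwise they span a third square `C`; the three squares at the far end of
`b` lie in a `3`-cube, and the face opposite `C` is the square that contains `a` and `c`. -/
theorem IsNonpositivelyCurved.headRel_trans (hX : X.IsNonpositivelyCurved) {a b c : X.cube 1}
    {p q t : List (X.cube 1)}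
    (ih : ∀ a' b' p' q', p'.length < q.length → X.FlipEquiv (a' :: p') (b' :: q') →
      X.HeadRel a' p' b' q')
    (h1 : X.HeadRel a p b q) (h2 : X.HeadRel b q c t) : X.HeadRel a p c t := by
  rcases h1 with ⟨rfl, h1⟩ | ⟨s, r, rfl, hsb, hp, hq⟩
  · rcases h2 with ⟨rfl, h2⟩ | ⟨s, r, h3, h4, h5, h6⟩
    · exact .inl ⟨rfl, h1.trans h2⟩
    · exact .inr ⟨s, r, h3, h4, h1.trans h5, h6⟩
  rcases h2 with ⟨rfl, h2⟩ | ⟨s', r', hsb', rfl, hq', ht⟩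
  · exact .inr ⟨s, r, rfl, hsb, hp, h2.symm.trans hq⟩
  have hlen := hq.length_eq
  rcases ih (X.topAt s 0) (X.topAt s' 1) r r' (by simp at hlen; omega) (hq.symm.trans hq') with
    ⟨h3, h4⟩ | ⟨C, w, hC0, hC1, hr, hr'⟩
  · have : X.reflect (X.swap s) = X.reflect s' :=
      hX.square_unique (by simp [hsb, hsb']) (by simp [h3])
    have e1 : X.topAt (X.reflect (X.swap s)) 1 = X.topAt (X.reflect s') 1 := by rw [this]
    have e2 : X.topAt (X.reflect (X.swap s)) 0 = X.topAt (X.reflect s') 0 := by rw [this]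
    simp only [topAt_reflect_one, topAt_reflect_zero, edgeAt_swap_one, topAt_swap_zero,
      rev_inj] at e1 e2
    refine .inl ⟨e1, hp.trans ?_⟩
    rw [e2]
    exact (h4.cons _).trans ht.symm
  · obtain ⟨A', B', C', hA0, hA1, hB0, hB1, hC0', hC1', hAB, hAC, hBC⟩ :=
      hX.exists_opposite_squares (A := X.reflect (X.swap s)) (B := X.reflect s') (C := C)
        (by simp [hsb, hsb']) (by simp [hC0]) (by simp [hC1])
    simp only [topAt_reflect_one, topAt_reflect_zero, edgeAt_swap_one, topAt_swap_zero]
      at hA0 hA1 hB0 hB1 hC0' hC1'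
    refine .inr ⟨C', X.rev (X.topAt B' 0) :: w, hC0', hC1', ?_, ?_⟩
    · refine (hp.trans (hr.cons _)).trans ?_
      have := FlipEquiv.head (X.reflect B') w
      simpa [hB0, hB1, rev_rev, hBC] using this
    · refine (ht.trans (hr'.cons _)).trans ?_
      have := FlipEquiv.head (X.reflect A') w
      simpa [hA0, hA1, rev_rev, hAC, hAB] using this

/-- A single flip satisfies the relation, and its transitivity for tails of a given length needs the
result for shorter tails only; hence the strong induction on the length. -/
theorem IsNonpositivelyCurved.headRel (hX : X.IsNonpositivelyCurved) :
    ∀ {a b : X.cube 1} {p q : List (X.cube 1)}, X.FlipEquiv (a :: p) (b :: q) →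
      X.HeadRel a p b q := by
  suffices H : ∀ (n : ℕ) (a b : X.cube 1) (p q : List (X.cube 1)), p.length = n →
      X.FlipEquiv (a :: p) (b :: q) → X.HeadRel a p b q from
    fun {_ _ _ _} h => H _ _ _ _ _ rfl h
  intro n
  induction n using Nat.strong_induction_on with
  | _ n ih =>
    intro a b p q hn h
    suffices H : ∀ l', X.FlipEquiv (a :: p) l' → ∀ b q, l' = b :: q → X.HeadRel a p b q from
      H _ h _ _ rfl
    intro l' h
    induction h with
    | refl =>
      intro b q hbq
      obtain ⟨rfl, rfl⟩ := List.cons.inj hbq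
      exact .inl ⟨rfl, .refl _⟩
    | @tail m l' h1 h2 ih2 =>
      rintro c t rfl
      cases m with
      | nil => exact absurd h2.length_eq (by simp)
      | cons b q =>
        have hl : p.length = q.length := by
          simpa using FlipEquiv.length_eq h1
        exact hX.headRel_trans (fun a' b' p' q' hp' h => ih p'.length (by omega) a' b' p' q' rfl h)
          (ih2 b q rfl) h2.headRel

/-- The edge path contains a backtrack. -/
def HasBacktrack (X : CubeComplex.{u}) : List (X.cube 1) → Prop
  | [] => False
  | [_] => False
  | e :: f :: l => f = X.rev e ∨ HasBacktrack X (f :: l)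

theorem HasBacktrack.cons (e : X.cube 1) {l : List (X.cube 1)} (h : X.HasBacktrack l) :
    X.HasBacktrack (e :: l) := by
  cases l with
  | nil => exact h.elim
  | cons f l => exact .inr h

/-- No backtrack can be created by exchanging halves of boundaries of squares. -/
def IsReduced (X : CubeComplex.{u}) (p : List (X.cube 1)) : Prop :=
  ∀ q, X.FlipEquiv p q → ¬ X.HasBacktrack q

theorem IsReduced.congr {p q : List (X.cube 1)} (hp : X.IsReduced p) (h : X.FlipEquiv p q) :
    X.IsReduced q := fun _ hr => hp _ (h.trans hr)

theorem IsReduced.tail {e : X.cube 1} {p : List (X.cube 1)} (hp : X.IsReduced (e :: p)) :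
    X.IsReduced p := fun q hq hb => hp (e :: q) (hq.cons e) (hb.cons e)

theorem not_isReduced_rev_right (e : X.cube 1) (p : List (X.cube 1)) :
    ¬ X.IsReduced (e :: X.rev e :: p) := fun h => h _ (.refl _) (.inl rfl)

/-- Compare `e :: p` with an equivalent path that has a backtrack. If the backtrack is in its tail,
`headRel` gives a square at `e`, and the induction applies to the edge opposite `e`. If the
backtrack is at its head, the path starts with `e`; a square at the head would produce a backtrack
in `p`. -/
theorem IsNonpositivelyCurved.exists_of_not_isReduced (hX : X.IsNonpositivelyCurved) :
    ∀ {p : List (X.cube 1)} {e : X.cube 1}, X.IsReduced p → ¬ X.IsReduced (e :: p) →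
      ∃ p', X.FlipEquiv p (X.rev e :: p') := by
  suffices H : ∀ (n : ℕ) (p : List (X.cube 1)) (e : X.cube 1), p.length = n → X.IsReduced p →
      ¬ X.IsReduced (e :: p) → ∃ p', X.FlipEquiv p (X.rev e :: p') from
    fun {_ _} h h' => H _ _ _ rfl h h'
  intro n
  induction n using Nat.strong_induction_on with
  | _ n ih =>
    intro p e hn hp he
    simp only [IsReduced, not_forall, not_not] at he
    obtain ⟨l, hl, hb⟩ := he
    match l, hl, hb with
    | f :: g :: t, hl, hb =>
    by_cases ht : X.HasBacktrack (g :: t)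
    · rcases hX.headRel hl with ⟨rfl, h⟩ | ⟨s, r, rfl, rfl, h1, h2⟩
      · exact absurd ht (hp _ h)
      · have hr : X.IsReduced r := (hp.congr h1).tail
        have hlen := h1.length_eq
        obtain ⟨r', hr'⟩ := ih r.length (by simp at hlen; omega) r (X.topAt s 0) rfl hr
          (fun h => h _ h2.symm ht)
        refine ⟨X.edgeAt s 1 :: r', (h1.trans (hr'.cons _)).trans ?_⟩
        simpa using (FlipEquiv.head (X.reflect s) r').symm
    · obtain rfl : g = X.rev f := hb.resolve_right ht
      rcases hX.headRel hl with ⟨rfl, h⟩ | ⟨s, r, rfl, rfl, h1, h2⟩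
      · exact ⟨t, h⟩
      · exfalso
        rcases hX.headRel h2 with ⟨h3, -⟩ | ⟨s', w, h3, h4, h5, h6⟩
        · exact hX.edgeAt_ne (X.reflect (X.swap s)) (by simp [h3])
        · have : s' = X.reflect (X.swap s) := hX.square_unique (by simp [h3]) (by simp [h4])
          subst this
          simp only [topAt_reflect_zero, topAt_swap_zero] at h6
          exact (hp.congr (h1.trans (h6.cons _))) _ (.refl _) (.inl rfl)

/-! ### Transport of reduced paths and its invariance under homotopy. -/

/-- The transport of (classes of) reduced edge paths along the edge `e`: `q` is the reduced form
of `e :: p`. -/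
structure Transport (X : CubeComplex.{u}) (e : X.cube 1) (p q : List (X.cube 1)) : Prop where
  left : X.IsReduced p
  right : X.IsReduced q
  rel : X.FlipEquiv p (X.rev e :: q) ∨ X.FlipEquiv q (e :: p)

theorem Transport.symm {e : X.cube 1} {p q : List (X.cube 1)} (h : X.Transport e p q) :
    X.Transport (X.rev e) q p :=
  ⟨h.right, h.left, by rw [rev_rev]; exact h.rel.symm⟩

theorem Transport.length {e : X.cube 1} {p q : List (X.cube 1)} (h : X.Transport e p q) :
    p.length = q.length + 1 ∨ q.length = p.length + 1 :=
  h.rel.imp (fun h => h.length_eq) fun h => h.length_eq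

theorem Transport.congr {e : X.cube 1} {p q p' q' : List (X.cube 1)} (h : X.Transport e p q)
    (hp : X.FlipEquiv p p') (hq : X.FlipEquiv q q') : X.Transport e p' q' :=
  ⟨h.left.congr hp, h.right.congr hq,
    h.rel.imp (fun h => (hp.symm.trans h).trans (hq.cons _))
      fun h => (hq.symm.trans h).trans (hp.cons _)⟩

theorem IsNonpositivelyCurved.exists_transport (hX : X.IsNonpositivelyCurved) (e : X.cube 1)
    {p : List (X.cube 1)} (hp : X.IsReduced p) : ∃ q, X.Transport e p q := by
  by_cases h : X.IsReduced (e :: p)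
  · exact ⟨e :: p, hp, h, .inr (.refl _)⟩
  · obtain ⟨q, hq⟩ := hX.exists_of_not_isReduced hp h
    exact ⟨q, hp, (hp.congr hq).tail, .inl hq⟩

theorem IsNonpositivelyCurved.flipEquiv_of_cons (hX : X.IsNonpositivelyCurved) {e : X.cube 1}
    {p q : List (X.cube 1)} (h : X.FlipEquiv (e :: p) (e :: q)) : X.FlipEquiv p q := by
  rcases hX.headRel h with ⟨-, h⟩ | ⟨s, _, h1, h2, -⟩
  · exact h
  · exact absurd (h1.trans h2.symm) (hX.edgeAt_ne s)

/-- Two cancellations, or two extensions, agree; one of each would exhibit a backtrack in a reduced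
path. -/
theorem IsNonpositivelyCurved.transport_unique (hX : X.IsNonpositivelyCurved) {e : X.cube 1}
    {p q q' : List (X.cube 1)} (h : X.Transport e p q) (h' : X.Transport e p q') :
    X.FlipEquiv q q' := by
  rcases h.rel with h1 | h1 <;> rcases h'.rel with h2 | h2
  · exact hX.flipEquiv_of_cons (h1.symm.trans h2)
  · exact absurd (h'.right.congr (h2.trans (h1.cons _))) (not_isReduced_rev_right _ _)
  · exact absurd (h.right.congr (h1.trans (h2.cons _))) (not_isReduced_rev_right _ _)
  · exact h1.trans h2.symm

/-- The cases record whether each of the two edges is cancelled or prepended. In equal cases the two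
edges are exchanged by a flip; in the mixed ones `headRel` and the uniqueness of squares bring in
`s` itself, up to symmetry. -/
theorem IsNonpositivelyCurved.transport_square (hX : X.IsNonpositivelyCurved) (s : X.cube 2)
    {p q w : List (X.cube 1)} (h1 : X.Transport (X.topAt s 1) p q)
    (h2 : X.Transport (X.edgeAt s 0) q w) :
    ∃ q', X.Transport (X.topAt s 0) p q' ∧ X.Transport (X.edgeAt s 1) q' w := by
  have far : ∀ l, X.FlipEquiv (X.rev (X.topAt s 1) :: X.rev (X.edgeAt s 0) :: l)
      (X.rev (X.topAt s 0) :: X.rev (X.edgeAt s 1) :: l) := by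
    intro l
    simpa using FlipEquiv.head (X.reflect (X.swap (X.reflect s))) l
  rcases h1.rel with h3 | h3 <;> rcases h2.rel with h4 | h4
  · have h5 := (h3.trans (h4.cons _)).trans (far w)
    have h6 := (h1.left.congr h5).tail
    exact ⟨_, ⟨h1.left, h6, .inl h5⟩, ⟨h6, h2.right, .inl (.refl _)⟩⟩
  · obtain ⟨q', hq'⟩ := hX.exists_transport (X.topAt s 0) h1.left
    refine ⟨q', hq', hq'.right, h2.right, ?_⟩
    rcases hq'.rel with h5 | h5
    · exfalso
      rcases hX.headRel (h3.symm.trans h5) with ⟨h6, -⟩ | ⟨s', r, h6, h7, h8, -⟩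
      · exact hX.edgeAt_ne (X.reflect (X.swap (X.reflect s))) (by simp [h6])
      · have : s' = X.reflect (X.swap (X.reflect s)) :=
          hX.square_unique (by simp [h6]) (by simp [h7])
        subst this
        simp only [topAt_reflect_one, edgeAt_swap_one, edgeAt_reflect_zero] at h8
        exact not_isReduced_rev_right _ _ (h2.right.congr (h4.trans (h8.cons _)))
    · left
      refine (h5.trans (h3.cons _)).trans (.trans ?_ (h4.symm.cons _))
      simpa using FlipEquiv.head (X.reflect (X.swap s)) q |>.symm
  · rcases hX.headRel (h3.symm.trans h4) with ⟨h6, -⟩ | ⟨s', r, h6, h7, h8, h9⟩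
    · exact absurd h6.symm (by simpa using hX.edgeAt_ne (X.reflect s))
    · have : s' = X.swap (X.reflect s) := hX.square_unique (by simp [h6]) (by simp [h7])
      subst this
      simp only [topAt_swap_one, topAt_swap_zero, topAt_reflect_one, topAt_reflect_zero] at h8 h9
      have hr := (h1.left.congr h8).tail
      exact ⟨r, ⟨h1.left, hr, .inl h8⟩, hr, h2.right, .inr h9⟩
  · have h5 := (h4.trans (h3.cons _)).trans (FlipEquiv.head s p)
    have h6 := (h2.right.congr h5).tail
    exact ⟨_, ⟨h1.left, h6, .inr (.refl _)⟩, ⟨h6, h2.right, .inr h5⟩⟩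

/-- The transport of reduced edge paths along an edge path. -/
inductive PathTransport (X : CubeComplex.{u}) :
    List (X.cube 1) → List (X.cube 1) → List (X.cube 1) → Prop
  | nil {p q : List (X.cube 1)} : X.IsReduced p → X.FlipEquiv p q → PathTransport X [] p q
  | cons {e : X.cube 1} {l p q w : List (X.cube 1)} : PathTransport X l p q →
      X.Transport e q w → PathTransport X (e :: l) p w

namespace PathTransport

theorem left {l p q : List (X.cube 1)} (h : X.PathTransport l p q) : X.IsReduced p := by
  induction h with
  | nil h _ => exact h
  | cons _ _ ih => exact ih

theorem right {l p q : List (X.cube 1)} (h : X.PathTransport l p q) : X.IsReduced q := by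
  cases h with
  | nil h h' => exact h.congr h'
  | cons _ h => exact h.right

theorem congr_right {l p q q' : List (X.cube 1)} (h : X.PathTransport l p q)
    (hq : X.FlipEquiv q q') : X.PathTransport l p q' := by
  cases h with
  | nil h h' => exact .nil h (h'.trans hq)
  | cons h h' => exact .cons h (h'.congr (.refl _) hq)

theorem unique (hX : X.IsNonpositivelyCurved) {l p q q' : List (X.cube 1)}
    (h : X.PathTransport l p q) (h' : X.PathTransport l p q') : X.FlipEquiv q q' := by
  induction h generalizing q' with
  | nil h h1 =>
    cases h' with
    | nil _ h2 => exact h1.symm.trans h2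
  | cons h h1 ih =>
    cases h' with
    | cons h' h2 => exact hX.transport_unique (h1.congr (ih h') (.refl _)) h2

theorem exists_right (hX : X.IsNonpositivelyCurved) (l : List (X.cube 1)) {p : List (X.cube 1)}
    (hp : X.IsReduced p) : ∃ q, X.PathTransport l p q := by
  induction l with
  | nil => exact ⟨p, .nil hp (.refl _)⟩
  | cons e l ih =>
    obtain ⟨q, hq⟩ := ih
    obtain ⟨w, hw⟩ := hX.exists_transport e hq.right
    exact ⟨w, .cons hq hw⟩

theorem append {l l' p q w : List (X.cube 1)} (h : X.PathTransport l p q)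
    (h' : X.PathTransport l' q w) : X.PathTransport (l' ++ l) p w := by
  induction h' with
  | nil _ h2 => exact h.congr_right h2
  | cons _ h2 ih => exact .cons (ih h) h2

theorem of_append {l l' p w : List (X.cube 1)} (h : X.PathTransport (l' ++ l) p w) :
    ∃ q, X.PathTransport l p q ∧ X.PathTransport l' q w := by
  induction l' generalizing w with
  | nil => exact ⟨w, h, .nil h.right (.refl _)⟩
  | cons e l' ih =>
    cases h with
    | cons h h' =>
      obtain ⟨q, hq, hq'⟩ := ih h
      exact ⟨q, hq, .cons hq' h'⟩

theorem symm {l p q : List (X.cube 1)} (h : X.PathTransport l p q) :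
    X.PathTransport (l.map X.rev).reverse q p := by
  induction h with
  | nil h h' => exact .nil (h.congr h') h'.symm
  | cons _ h ih =>
    rw [List.map_cons, List.reverse_cons]
    exact append (.cons (.nil h.right (.refl _)) h.symm) ih

theorem self {p : List (X.cube 1)} (hp : X.IsReduced p) : X.PathTransport p [] p := by
  induction p with
  | nil => exact .nil hp (.refl _)
  | cons e p ih => exact .cons (ih hp.tail) ⟨hp.tail, hp, .inr (.refl _)⟩

theorem mid {l₁ m m' l₂ p w : List (X.cube 1)}
    (hm : ∀ q r, X.PathTransport m q r → X.PathTransport m' q r)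
    (h : X.PathTransport (l₁ ++ m ++ l₂) p w) : X.PathTransport (l₁ ++ m' ++ l₂) p w := by
  obtain ⟨q, h1, h2⟩ := h.of_append
  obtain ⟨r, h3, h4⟩ := h2.of_append
  exact h1.append ((hm _ _ h3).append h4)

theorem pair_iff {e f : X.cube 1} {p w : List (X.cube 1)} :
    X.PathTransport [e, f] p w ↔ ∃ q, X.Transport f p q ∧ X.Transport e q w := by
  constructor
  · rintro (_ | ⟨_ | ⟨_ | ⟨h1, h2⟩, h3⟩, h4⟩)
    exact ⟨_, h3.congr (FlipEquiv.symm ‹_›) (.refl _), h4⟩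
  · rintro ⟨q, h1, h2⟩
    exact .cons (.cons (.nil h1.left (.refl _)) h1) h2

/-- Transports along an edge and its reverse are mutually inverse, which settles backtracks; squares
are settled by `transport_square`. -/
theorem congr_elementaryHomotopy (hX : X.IsNonpositivelyCurved) {l l' : List (X.cube 1)}
    (h : X.ElementaryHomotopy l l') {p w : List (X.cube 1)} :
    X.PathTransport l p w ↔ X.PathTransport l' p w := by
  have sq : ∀ (s : X.cube 2) q r, X.PathTransport [X.edgeAt s 0, X.topAt s 1] q r →
      X.PathTransport [X.edgeAt s 1, X.topAt s 0] q r := by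
    intro s q r h
    obtain ⟨_, h1, h2⟩ := pair_iff.1 h
    exact pair_iff.2 (hX.transport_square s h1 h2)
  cases h with
  | backtrack l₁ e l₂ =>
    have : l₁ ++ l₂ = l₁ ++ [] ++ l₂ := by simp
    rw [this]
    refine ⟨mid fun q r h => ?_, mid fun q r h => ?_⟩
    · obtain ⟨t, h1, h2⟩ := pair_iff.1 h
      have h3 := h1.symm
      rw [rev_rev] at h3
      exact .nil h1.left (hX.transport_unique h3 h2)
    · obtain ⟨t, ht⟩ := hX.exists_transport (X.rev e) h.left
      have h3 := ht.symm
      rw [rev_rev] at h3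
      cases h with
      | nil h h' => exact pair_iff.2 ⟨t, ht, h3.congr (.refl _) h'⟩
  | square l₁ s l₂ =>
    exact ⟨mid (sq s), mid (by
      have := sq (X.swap s)
      simp only [edgeAt_swap_zero, edgeAt_swap_one, topAt_swap_one, topAt_swap_zero] at this
      exact this)⟩

theorem congr_homotopic (hX : X.IsNonpositivelyCurved) {v w : X.cube 0} {l l' : List (X.cube 1)}
    (h : X.Homotopic v w l l') {p q : List (X.cube 1)} :
    X.PathTransport l p q ↔ X.PathTransport l' p q := by
  induction h with
  | rel _ _ h => exact congr_elementaryHomotopy hX h.2.2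
  | refl => rfl
  | symm _ _ _ ih => exact ih.symm
  | trans _ _ _ _ _ ih ih' => exact ih.trans ih'

end PathTransport

theorem IsEdgePath.append {v w z : X.cube 0} {l l' : List (X.cube 1)}
    (h : X.IsEdgePath v w l) (h' : X.IsEdgePath w z l') : X.IsEdgePath v z (l ++ l') := by
  induction l generalizing v with
  | nil => cases h; exact h'
  | cons e l ih => exact ⟨h.1, ih h.2⟩

theorem IsEdgePath.reverse {v w : X.cube 0} {l : List (X.cube 1)} (h : X.IsEdgePath v w l) :
    X.IsEdgePath w v (l.map X.rev).reverse := by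
  induction l generalizing v with
  | nil => exact Eq.symm h
  | cons e l ih =>
    rw [List.map_cons, List.reverse_cons]
    exact (ih h.2).append ⟨src_rev e, by rw [tgt_rev]; exact h.1⟩

/-- Transport reads a path from its last edge. The empty path becomes `q` along `q`, and then some
`t` along the reverse of `p`. The closed path so traversed is null-homotopic, so `t` is empty. Hence
the empty path is transported along `p` to `q`, but also to `p`. -/
theorem IsCAT0.flipEquiv (hX : X.IsCAT0) {v w : X.cube 0} {p q : List (X.cube 1)}
    (hp : X.IsEdgePath v w p) (hq : X.IsEdgePath v w q) (hpr : X.IsReduced p)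
    (hqr : X.IsReduced q) : X.FlipEquiv p q := by
  have hloop := hX.1.2.2 w _ (hp.reverse.append hq)
  obtain ⟨t, ht⟩ := PathTransport.exists_right hX.2 (p.map X.rev).reverse hqr
  have h1 := (PathTransport.congr_homotopic hX.2 hloop).1 ((PathTransport.self hqr).append ht)
  have h2 := ht.symm
  have h3 : ((p.map X.rev).reverse.map X.rev).reverse = p := by
    rw [List.map_reverse, List.reverse_reverse, List.map_map]
    simp [Function.comp_def, rev_rev]
  rw [h3] at h2
  cases h1 with
  | nil _ h1 =>
    have : t = [] := by simpa using h1.length_eq.symm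
    subst this
    exact (PathTransport.self hpr).unique hX.2 h2

end CubeComplex

/-! ### Distance, halfspaces and the wall system of a CAT(0) cube complex. -/

/-- A set of halfspaces of `V`: closed under complements, any two points are separated by a finite
non-zero number of halfspaces, and a choice of a side of each wall is given by a point if the
chosen sides intersect pairwise and almost all of them contain a given point. -/
structure IsWallSystem {V : Type u} (H : Set (Set V)) : Prop where
  compl_mem : ∀ {h}, h ∈ H → hᶜ ∈ H
  finite : ∀ x y, {h ∈ H | x ∈ h ∧ y ∉ h}.Finite
  separates : ∀ {x y}, x ≠ y → ∃ h ∈ H, x ∈ h ∧ y ∉ h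
  complete : ∀ τ ⊆ H, (∀ h ∈ H, h ∈ τ ∨ hᶜ ∈ τ) → (∀ h ∈ τ, ∀ g ∈ τ, (h ∩ g).Nonempty) →
    ∀ y, {h ∈ τ | y ∉ h}.Finite → ∃ x, ∀ h ∈ H, h ∈ τ ↔ x ∈ h

namespace CubeComplex

variable {X : CubeComplex.{u}}

/-- The combinatorial distance of two vertices. -/
noncomputable def dist (X : CubeComplex.{u}) (x z : X.cube 0) : ℕ :=
  sInf {k | ∃ l, X.IsEdgePath x z l ∧ l.length = k}

theorem IsEdgePath.dist_le {x z : X.cube 0} {l : List (X.cube 1)} (h : X.IsEdgePath x z l) :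
    X.dist x z ≤ l.length := Nat.sInf_le ⟨l, h, rfl⟩

theorem HasBacktrack.exists_shorter {l : List (X.cube 1)} (h : X.HasBacktrack l) {x z : X.cube 0}
    (hl : X.IsEdgePath x z l) : ∃ l', X.IsEdgePath x z l' ∧ l'.length < l.length := by
  induction l generalizing x with
  | nil => exact h.elim
  | cons e l ih =>
    cases l with
    | nil => exact h.elim
    | cons f l =>
      rcases h with rfl | h
      · obtain ⟨h1, h2, h3⟩ := hl
        rw [tgt_rev, h1] at h3
        exact ⟨l, h3, by simp⟩
      · obtain ⟨l', h1, h2⟩ := ih h hl.2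
        exact ⟨e :: l', ⟨hl.1, h1⟩, by simpa using h2⟩

namespace IsCAT0

variable (hX : X.IsCAT0)
include hX

theorem exists_geodesic (x z : X.cube 0) :
    ∃ l, X.IsEdgePath x z l ∧ l.length = X.dist x z := by
  obtain ⟨l, hl⟩ := hX.1.2.1 x z
  exact Nat.sInf_mem (s := {k | ∃ l, X.IsEdgePath x z l ∧ l.length = k}) ⟨_, l, hl, rfl⟩

theorem dist_comm (x z : X.cube 0) : X.dist x z = X.dist z x := by
  have : ∀ x z, X.dist x z ≤ X.dist z x := by
    intro x z
    obtain ⟨l, hl, h⟩ := hX.exists_geodesic z x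
    simpa [h] using hl.reverse.dist_le
  exact (this x z).antisymm (this z x)

omit hX in
theorem _root_.CubeComplex.IsEdgePath.isReduced {x z : X.cube 0} {l : List (X.cube 1)}
    (h : X.IsEdgePath x z l) (hl : l.length ≤ X.dist x z) : X.IsReduced l := by
  intro q hq hb
  obtain ⟨l', h1, h2⟩ := hb.exists_shorter (hq.isEdgePath h)
  have := h1.dist_le
  rw [← hq.length_eq] at h2
  omega

theorem length_eq_dist {x z : X.cube 0} {l : List (X.cube 1)} (h : X.IsEdgePath x z l)
    (hl : X.IsReduced l) : l.length = X.dist x z := by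
  obtain ⟨l', h1, h2⟩ := hX.exists_geodesic x z
  rw [← h2]
  exact (hX.flipEquiv h h1 hl (h1.isReduced h2.le)).length_eq

/-- Reduced paths are geodesics, and transport along `e` changes the length of a reduced path by
exactly one. -/
theorem dist_edge (e : X.cube 1) (z : X.cube 0) :
    X.dist (X.src e) z = X.dist (X.tgt e) z + 1 ∨
      X.dist (X.tgt e) z = X.dist (X.src e) z + 1 := by
  obtain ⟨p, hp, hlen⟩ := hX.exists_geodesic (X.tgt e) z
  obtain ⟨q, hq⟩ := hX.2.exists_transport e (hp.isReduced hlen.le)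
  have hqp : X.IsEdgePath (X.src e) z q := by
    rcases hq.rel with h | h
    · have := (h.isEdgePath hp).2
      rwa [tgt_rev] at this
    · exact h.symm.isEdgePath ⟨rfl, hp⟩
  rw [← hlen, ← hX.length_eq_dist hqp hq.right]
  exact hq.length.symm

/-- Geodesics to `z` through `e` and through `f` are flip-equivalent, so `headRel` provides the
square and a common remainder that starts at its far corner. -/
theorem exists_square {e f : X.cube 1} {z : X.cube 0} (hef : e ≠ f) (hs : X.src e = X.src f)
    (he : X.dist (X.tgt e) z < X.dist (X.src e) z) (hf : X.dist (X.tgt f) z < X.dist (X.src f) z) :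
    ∃ s : X.cube 2, X.edgeAt s 0 = e ∧ X.edgeAt s 1 = f ∧
      X.dist (X.tgt (X.topAt s 0)) z + 2 ≤ X.dist (X.src e) z := by
  obtain ⟨p, hp, hpl⟩ := hX.exists_geodesic (X.tgt e) z
  obtain ⟨q, hq, hql⟩ := hX.exists_geodesic (X.tgt f) z
  have hp' : X.IsEdgePath (X.src e) z (e :: p) := ⟨rfl, hp⟩
  have hq' : X.IsEdgePath (X.src e) z (f :: q) := ⟨hs.symm, hq⟩
  have h := hX.flipEquiv hp' hq' (hp'.isReduced (by simp; omega))
    (hq'.isReduced (by rw [hs]; simp; omega))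
  rcases hX.2.headRel h with ⟨h, -⟩ | ⟨s, r, h1, h2, h3, -⟩
  · exact absurd h hef
  · refine ⟨s, h1, h2, ?_⟩
    have h4 := (h3.isEdgePath hp).2.dist_le
    have h5 := h3.length_eq
    rw [tgt_topAt_zero]
    simp at h5
    omega

omit hX in
theorem dist_self (x : X.cube 0) : X.dist x x = 0 :=
  Nat.le_zero.1 (IsEdgePath.dist_le (l := []) rfl)

theorem exists_edge {x z : X.cube 0} (h : x ≠ z) :
    ∃ e, X.src e = x ∧ X.dist (X.tgt e) z + 1 = X.dist x z := by
  obtain ⟨l, hl, hlen⟩ := hX.exists_geodesic x z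
  cases l with
  | nil => exact absurd hl h
  | cons e l =>
    refine ⟨e, hl.1, ?_⟩
    have h1 := hl.2.dist_le
    have h2 := hX.dist_edge e z
    have h3 := hl.1
    rw [h3] at h2
    simp at hlen
    omega

theorem eq_of_dist_eq_zero {x z : X.cube 0} (h : X.dist x z = 0) : x = z := by
  by_contra hne
  obtain ⟨e, -, he⟩ := hX.exists_edge hne
  omega

/-- Both edges approach their common end, which is at distance one; a square spanned by them would
have a far corner closer by two. -/
theorem edge_ext {e f : X.cube 1} (hs : X.src e = X.src f) (ht : X.tgt e = X.tgt f) : e = f := by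
  by_contra hne
  have h1 := dist_self (X.tgt e)
  have h2 := hX.dist_edge e (X.tgt e)
  obtain ⟨s, -, -, h⟩ := hX.exists_square (z := X.tgt e) hne hs (by omega)
    (by rw [← hs, ← ht]; omega)
  omega

end IsCAT0

/-- The vertices that are closer to the initial than to the terminal vertex of an edge. -/
def side (X : CubeComplex.{u}) (e : X.cube 1) : Set (X.cube 0) :=
  {z | X.dist (X.src e) z < X.dist (X.tgt e) z}

/-- The halfspaces of a cube complex. -/
def halfspaces (X : CubeComplex.{u}) : Set (Set (X.cube 0)) := Set.range X.side

namespace IsCAT0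

variable (hX : X.IsCAT0)
include hX

theorem side_rev (e : X.cube 1) : X.side (X.rev e) = (X.side e)ᶜ := by
  ext z
  have := hX.dist_edge e z
  simp only [side, src_rev, tgt_rev, Set.mem_ofPred_eq, Set.mem_compl_iff]
  omega

theorem src_mem_side (e : X.cube 1) : X.src e ∈ X.side e := by
  have h1 := dist_self (X.src e)
  have h2 := hX.dist_edge e (X.src e)
  simp only [side, Set.mem_ofPred_eq]
  omega

theorem tgt_notMem_side (e : X.cube 1) : X.tgt e ∉ X.side e := by
  have := hX.src_mem_side (X.rev e)
  rwa [hX.side_rev, src_rev] at this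

/-- Otherwise the distances to `z` alternate around the square: some `d` at the base and at the far
corner, `d + 1` at the other two. From one of the latter both edges approach `z`, so by
`exists_square` the corner opposite to it would be at distance at most `d - 1`. -/
theorem side_edgeAt_subset (s : X.cube 2) : X.side (X.edgeAt s 0) ⊆ X.side (X.topAt s 0) := by
  intro z hz
  by_contra hz'
  simp only [side, Set.mem_ofPred_eq] at hz hz'
  have h1 := hX.dist_edge (X.edgeAt s 0) z
  have h2 := hX.dist_edge (X.edgeAt s 1) z
  have h3 := hX.dist_edge (X.topAt s 0) z
  have h4 := hX.dist_edge (X.topAt s 1) z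
  have e1 := src_edgeAt s 0
  have e2 := src_edgeAt s 1
  have e3 := tgt_edgeAt_zero s
  have e4 := tgt_edgeAt_one s
  have e5 := tgt_topAt_zero s
  rw [e5, ← e4] at h3 hz'
  rw [← e3] at h4
  rw [e2] at h2
  rw [e1] at h1 hz
  obtain ⟨s', h5, h6, h7⟩ := hX.exists_square (e := X.rev (X.edgeAt s 0)) (f := X.topAt s 1)
    (z := z) (fun h => hX.2.edgeAt_ne (X.reflect s) (by simpa using h)) (by rw [src_rev, e3])
    (by rw [src_rev, tgt_rev, e1]; omega) (by rw [← e3]; omega)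
  have : s' = X.reflect s := hX.2.square_unique (by simp [h5]) (by simp [h6])
  subst this
  rw [topAt_reflect_zero, tgt_rev, src_rev, ← e4] at h7
  omega

theorem side_topAt_zero (s : X.cube 2) : X.side (X.topAt s 0) = X.side (X.edgeAt s 0) := by
  refine Set.Subset.antisymm ?_ (hX.side_edgeAt_subset s)
  have := hX.side_edgeAt_subset (X.reflect s)
  rwa [edgeAt_reflect_zero, topAt_reflect_zero, hX.side_rev, hX.side_rev,
    Set.compl_subset_compl] at this

theorem side_topAt_one (s : X.cube 2) : X.side (X.topAt s 1) = X.side (X.edgeAt s 1) := by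
  simpa using hX.side_topAt_zero (X.swap s)

/-- Induction on the distance of the initial vertices. An edge `g` from `src e` towards `src f` also
approaches `tgt f`, as `e` does; the two span a square, whose edge opposite `e` still crosses the
wall of `f` and starts closer to `f`. -/
theorem side_eq_of_split {e f : X.cube 1} (hs : X.src e ∈ X.side f) (ht : X.tgt e ∉ X.side f) :
    X.side e = X.side f := by
  obtain ⟨k, hk⟩ : ∃ k, X.dist (X.src e) (X.src f) = k := ⟨_, rfl⟩
  induction k generalizing e with
  | zero =>
    have h1 := hX.eq_of_dist_eq_zero hk
    have h2 := hX.dist_edge e (X.tgt f)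
    have h3 := hX.dist_edge f (X.tgt f)
    have h4 := dist_self (X.tgt f)
    simp only [side, Set.mem_ofPred_eq] at hs ht
    have h5 := hX.dist_edge f (X.tgt e)
    have h6 := hX.dist_edge e (X.src f)
    rw [hX.dist_comm (X.src f), hX.dist_comm (X.tgt f)] at h5 ht
    rw [h1] at h2
    rw [hX.edge_ext h1 (hX.eq_of_dist_eq_zero (by omega))]
  | succ k ih =>
    have hne : X.src e ≠ X.src f := by
      intro h
      rw [h, dist_self] at hk
      omega
    obtain ⟨g, hg, hgd⟩ := hX.exists_edge hne
    simp only [side, Set.mem_ofPred_eq] at hs ht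
    have h1 := hX.dist_edge f (X.src e)
    have h2 := hX.dist_edge f (X.tgt e)
    have h3 := hX.dist_edge f (X.tgt g)
    have h4 := hX.dist_edge e (X.src f)
    have h5 := hX.dist_edge e (X.tgt f)
    have h6 := hX.dist_edge g (X.tgt f)
    simp only [hX.dist_comm (X.src f), hX.dist_comm (X.tgt f), hg] at hs ht h1 h2 h3 h4 h5 h6
    obtain ⟨s, rfl, rfl, hd⟩ := hX.exists_square (e := g) (f := e) (z := X.tgt f)
      (by rintro rfl; omega) hg (by rw [hg]; omega) (by omega)
    have h7 := hX.dist_edge (X.topAt s 0) (X.src f)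
    have h8 := hX.dist_edge f (X.tgt (X.topAt s 0))
    rw [← tgt_edgeAt_one] at h7
    simp only [hX.dist_comm (X.src f), hX.dist_comm (X.tgt f)] at h8
    rw [hg] at hd
    rw [← hX.side_topAt_one]
    refine ih ?_ ?_ ?_
    · simp only [side, Set.mem_ofPred_eq, ← tgt_edgeAt_zero]
      simp only [hX.dist_comm (X.src f), hX.dist_comm (X.tgt f)]
      omega
    · simp only [side, Set.mem_ofPred_eq, ← tgt_topAt_zero]
      simp only [hX.dist_comm (X.src f), hX.dist_comm (X.tgt f)]
      omega
    · rw [← tgt_edgeAt_zero]; omega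

theorem side_eq_of_split' {e : X.cube 1} {h : Set (X.cube 0)} (hh : h ∈ X.halfspaces)
    (hs : X.src e ∈ h) (ht : X.tgt e ∉ h) : h = X.side e := by
  obtain ⟨f, rfl⟩ := hh
  exact (hX.side_eq_of_split hs ht).symm

theorem compl_mem_halfspaces {h : Set (X.cube 0)} (hh : h ∈ X.halfspaces) :
    hᶜ ∈ X.halfspaces := by
  obtain ⟨f, rfl⟩ := hh
  exact ⟨X.rev f, hX.side_rev f⟩

theorem finite_separating (x y : X.cube 0) : {h ∈ X.halfspaces | x ∈ h ∧ y ∉ h}.Finite := by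
  obtain ⟨l, hl, -⟩ := hX.exists_geodesic x y
  -- A separating halfspace is left along some edge of the path, and then is the side of that edge.
  refine ((l.map X.side).finite_toSet).subset ?_
  rintro h ⟨hh, hx, hy⟩
  induction l generalizing x with
  | nil => cases hl; exact absurd hx hy
  | cons e l ih =>
    simp only [List.map_cons, List.mem_cons, Set.mem_ofPred_eq]
    by_cases ht : X.tgt e ∈ h
    · exact .inr (ih _ hl.2 ht)
    · exact .inl (hX.side_eq_of_split' hh (hl.1 ▸ hx) ht)

/-- A minimal halfspace containing `y` is bounded by a wall that crosses an edge at `y`. -/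
theorem exists_edge_of_minimal {h : Set (X.cube 0)} (hh : h ∈ X.halfspaces) {y : X.cube 0}
    (hy : y ∈ h) (hmin : ∀ g ∈ X.halfspaces, y ∈ g → g ⊆ h → g = h) :
    ∃ e, X.src e = y ∧ X.side e = h := by
  obtain ⟨e, rfl⟩ := hh
  obtain ⟨k, hk⟩ : ∃ k, X.dist (X.src e) y = k := ⟨_, rfl⟩
  induction k using Nat.strong_induction_on generalizing e with
  | _ k ih =>
    by_cases hey : X.src e = y
    · exact ⟨e, hey, rfl⟩
    obtain ⟨f, hf, hfd⟩ := hX.exists_edge hey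
    have hyf : y ∈ X.side (X.rev f) := by
      simp only [side, Set.mem_ofPred_eq, src_rev, tgt_rev, hf]
      omega
    have hnot : X.src e ∉ X.side (X.rev f) := by
      rw [← hf, ← tgt_rev]
      exact hX.tgt_notMem_side _
    have hsub : ¬ X.side (X.rev f) ⊆ X.side e := fun hsub => by
      rw [hmin _ ⟨_, rfl⟩ hyf hsub] at hnot
      exact hnot (hX.src_mem_side e)
    -- Both `f` and `e` approach `w`, so they span a square; its edge opposite `e` bounds the same
    -- halfspace and starts closer to `y`.
    obtain ⟨w, hwf, hwe⟩ := Set.not_subset.1 hsub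
    have h1 := hX.dist_edge e w
    simp only [side, Set.mem_ofPred_eq, src_rev, tgt_rev] at hwf hwe hy
    obtain ⟨s, rfl, rfl, -⟩ := hX.exists_square (e := f) (f := e) (z := w)
      (by rintro rfl; omega) hf hwf (by omega)
    obtain ⟨e', h2, h3⟩ := ih (X.dist (X.src (X.topAt s 1)) y)
      (by rw [← tgt_edgeAt_zero]; omega) (X.topAt s 1)
      (by rw [hX.side_topAt_one]; exact hy) (by rwa [hX.side_topAt_one]) rfl
    exact ⟨e', h2, h3.trans (hX.side_topAt_one s)⟩

theorem isWallSystem : IsWallSystem X.halfspaces where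
  compl_mem := hX.compl_mem_halfspaces
  finite := hX.finite_separating
  separates := by
    intro x y hxy
    obtain ⟨e, rfl, he⟩ := hX.exists_edge hxy
    refine ⟨_, ⟨e, rfl⟩, hX.src_mem_side e, ?_⟩
    simp only [side, Set.mem_ofPred_eq]
    omega
  complete := by
    intro τ hτ htot hpair y hfin
    -- Walk from `y` to the required vertex, entering one more halfspace of `τ` with each edge.
    obtain ⟨k, hk⟩ : ∃ k, {h ∈ τ | y ∉ h}.ncard = k := ⟨_, rfl⟩
    induction k generalizing y with
    | zero =>
      rw [Set.ncard_eq_zero hfin] at hk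
      have hall : ∀ h ∈ τ, y ∈ h := fun h hh => by
        by_contra hy
        exact (hk ▸ (⟨hh, hy⟩ : h ∈ {h ∈ τ | y ∉ h}) : h ∈ (∅ : Set _))
      refine ⟨y, fun h hh => ⟨hall h, fun hy => ?_⟩⟩
      exact (htot h hh).resolve_right fun hc => hall _ hc hy
    | succ k ih =>
      have hne : {h ∈ τ | y ∉ h}.Nonempty := by
        rw [← Set.ncard_pos hfin]; omega
      -- As members of `τ` meet pairwise, the complement of a maximal `g` is minimal among all
      -- halfspaces that contain `y`; so some edge at `y` crosses the wall of `g`.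
      obtain ⟨g, hg, hgmax⟩ := hfin.exists_maximal hne
      have hgH := hX.compl_mem_halfspaces (hτ hg.1)
      obtain ⟨e, rfl, he⟩ := hX.exists_edge_of_minimal hgH (y := y) hg.2 (by
        intro g' hg' hyg' hsub
        have h1 : g'ᶜ ∈ τ := (htot g' hg').resolve_left fun h => by
          obtain ⟨z, hz1, hz2⟩ := hpair _ h _ hg.1
          exact hsub hz1 hz2
        have h2 : g ⊆ g'ᶜ := Set.subset_compl_comm.1 hsub
        have h3 := hgmax ⟨h1, not_not.2 hyg'⟩ h2
        exact Set.Subset.antisymm hsub (Set.compl_subset_comm.1 h3))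
      have hset : {h ∈ τ | X.src e ∉ h} = insert g {h ∈ τ | X.tgt e ∉ h} := by
        ext h
        constructor
        · rintro ⟨h1, h2⟩
          by_cases ht : X.tgt e ∈ h
          · left
            have := hX.side_eq_of_split' (e := X.rev e) (hτ h1) (by rwa [src_rev])
              (by rwa [tgt_rev])
            rw [this, hX.side_rev, he, compl_compl]
          · exact .inr ⟨h1, ht⟩
        · rintro (rfl | ⟨h1, h2⟩)
          · exact hg
          · refine ⟨h1, fun hs => ?_⟩
            have := hX.side_eq_of_split' (hτ h1) hs h2
            rw [he] at this
            obtain ⟨z, hz1, hz2⟩ := hpair _ h1 _ hg.1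
            rw [this] at hz1
            exact hz1 hz2
      have hgt : g ∉ {h ∈ τ | X.tgt e ∉ h} := fun h => h.2 (by
        have := hX.tgt_notMem_side e
        rw [he] at this
        exact not_not.1 this)
      have hfin' : {h ∈ τ | X.tgt e ∉ h}.Finite := hfin.subset (hset ▸ Set.subset_insert _ _)
      refine ih (X.tgt e) hfin' ?_
      rw [hset, Set.ncard_insert_of_notMem hgt hfin'] at hk
      omega

end IsCAT0

end CubeComplex

/-! ### Cells, cubes and crossing families of a wall system. -/

namespace IsWallSystem

variable {V : Type u} {H : Set (Set V)}

theorem ext (hH : IsWallSystem H) {x y : V} (h : ∀ g ∈ H, x ∈ g → y ∈ g) : x = y := by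
  by_contra hne
  obtain ⟨g, hg, hx, hy⟩ := hH.separates hne
  exact hy (h g hg hx)

end IsWallSystem

/-- A cell of a wall system: a choice of a side of almost every wall all of whose completions are
given by points. -/
structure IsCell {V : Type u} (H : Set (Set V)) (σ : Set (Set V)) : Prop where
  subset : σ ⊆ H
  consistent : ∀ h ∈ σ, hᶜ ∉ σ
  disjoint : ∀ h ∈ H, ∀ g ∈ H, g ≠ hᶜ → ¬ (h ∩ g).Nonempty → hᶜ ∈ σ ∨ gᶜ ∈ σ
  finite : ∀ y, {h ∈ H | y ∈ h ∧ h ∉ σ}.Finite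

/-- A parametrized cube of a wall system, with its walls. -/
structure IsCubeMap {V : Type u} (H : Set (Set V)) {m : ℕ} (φ : (Fin m → ℤˣ) → V)
    (w : Fin m → Set V) : Prop where
  mem : ∀ i, w i ∈ H
  mem_iff : ∀ ε i, φ ε ∈ w i ↔ ε i = 1
  const : ∀ h ∈ H, (∀ i, h ≠ w i ∧ h ≠ (w i)ᶜ) → ∀ ε ε', φ ε ∈ h → φ ε' ∈ h

/-- Two halfspaces are transverse. -/
def Crosses {V : Type u} (h g : Set V) : Prop :=
  (h ∩ g).Nonempty ∧ (h ∩ gᶜ).Nonempty ∧ (hᶜ ∩ g).Nonempty ∧ (hᶜ ∩ gᶜ).Nonempty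

/-- A family of pairwise transverse non-trivial halfspaces. -/
structure IsCrossingFamily {V : Type u} (H : Set (Set V)) {m : ℕ} (w : Fin m → Set V) :
    Prop where
  mem : ∀ i, w i ∈ H
  nonempty : ∀ i, (w i).Nonempty ∧ (w i)ᶜ.Nonempty
  crosses : ∀ i j, i ≠ j → Crosses (w i) (w j)

theorem units_eq_of_iff {a b : ℤˣ} (h : a = 1 ↔ b = 1) : a = b := by
  rcases Int.units_eq_one_or a with rfl | rfl <;> rcases Int.units_eq_one_or b with rfl | rfl
  · rfl
  · simp at h
  · simp at h
  · rfl

theorem units_ne_one_iff {a : ℤˣ} : a ≠ 1 ↔ a = -1 := by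
  rcases Int.units_eq_one_or a with rfl | rfl <;> simp

namespace IsCubeMap

variable {V : Type u} {H : Set (Set V)} {m : ℕ} {φ : (Fin m → ℤˣ) → V} {w : Fin m → Set V}

theorem injective (h : IsCubeMap H φ w) : Function.Injective φ := fun ε ε' he =>
  funext fun i => units_eq_of_iff (by rw [← h.mem_iff, ← h.mem_iff, he])

theorem mem_compl_iff (h : IsCubeMap H φ w) (ε : Fin m → ℤˣ) (i : Fin m) :
    φ ε ∈ (w i)ᶜ ↔ ε i = -1 := by
  rw [Set.mem_compl_iff, h.mem_iff, ← units_ne_one_iff]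

theorem eq_wall (h : IsCubeMap H φ w) {g : Set V} (hg : g ∈ H) {i : Fin m} {ε : Fin m → ℤˣ}
    (h1 : φ (Function.update ε i (-1)) ∉ g) (h2 : φ (Function.update ε i 1) ∈ g) : g = w i := by
  by_contra hne
  have : ¬ ∀ j, g ≠ w j ∧ g ≠ (w j)ᶜ := fun hc => h1 (h.const g hg hc _ _ h2)
  push Not at this
  obtain ⟨j, hj⟩ := this
  have hij : j ≠ i := by
    rintro rfl
    rw [hj hne, h.mem_compl_iff] at h2
    simp at h2
  by_cases hgj : g = w j
  · rw [hgj, h.mem_iff, Function.update_of_ne hij] at h1 h2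
    exact h1 h2
  · rw [hj hgj, h.mem_compl_iff, Function.update_of_ne hij] at h1 h2
    exact h1 h2

theorem isCrossingFamily (h : IsCubeMap H φ w) : IsCrossingFamily H w where
  mem := h.mem
  nonempty i := ⟨⟨φ 1, (h.mem_iff _ _).2 rfl⟩, ⟨φ (-1), (h.mem_compl_iff _ _).2 rfl⟩⟩
  crosses i j hij := by
    refine ⟨⟨φ (Function.update (Function.update 1 i 1) j 1), ?_, ?_⟩,
      ⟨φ (Function.update (Function.update 1 i 1) j (-1)), ?_, ?_⟩,
      ⟨φ (Function.update (Function.update 1 i (-1)) j 1), ?_, ?_⟩,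
      ⟨φ (Function.update (Function.update 1 i (-1)) j (-1)), ?_, ?_⟩⟩ <;>
    simp only [h.mem_iff, h.mem_compl_iff] <;> simp [hij]

/-- Reparametrization by a face of the cube. -/
theorem comp (hH : IsWallSystem H) (h : IsCubeMap H φ w) {l : ℕ} (f : FaceMap l m) :
    IsCubeMap H (fun ε => φ (f.act ε))
      (fun i => if f.sign (f.emb i) = 1 then w (f.emb i) else (w (f.emb i))ᶜ) where
  mem i := by
    split_ifs
    · exact h.mem _
    · exact hH.compl_mem (h.mem _)
  mem_iff ε i := by
    split_ifs with hs
    · rw [h.mem_iff, f.act_emb, hs, one_mul]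
    · rw [h.mem_compl_iff, f.act_emb, units_ne_one_iff.1 hs]
      simp
  const g hg hc ε ε' hε := by
    by_cases hw : ∀ j, g ≠ w j ∧ g ≠ (w j)ᶜ
    · exact h.const g hg hw _ _ hε
    · push Not at hw
      obtain ⟨j, hj⟩ := hw
      have hjf : ∀ i, f.emb i ≠ j := by
        rintro i rfl
        have h1 := hc i
        split_ifs at h1
        · exact h1.2 (hj h1.1)
        · rw [compl_compl] at h1
          exact h1.1 (hj h1.2)
      by_cases hgj : g = w j
      · rw [hgj, h.mem_iff, f.act_of_notMem _ _ hjf] at hε ⊢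
        exact hε
      · rw [hj hgj, h.mem_compl_iff, f.act_of_notMem _ _ hjf] at hε ⊢
        exact hε

theorem eq_of_mem (hH : IsWallSystem H) (h : IsCubeMap H φ w) {ε : Fin m → ℤˣ} {x : V}
    (h1 : ∀ i, x ∈ w i ↔ ε i = 1)
    (h2 : ∀ g ∈ H, (∀ i, g ≠ w i ∧ g ≠ (w i)ᶜ) → φ ε ∈ g → x ∈ g) : φ ε = x := by
  refine hH.ext fun g hg hφ => ?_
  by_cases hw : ∀ j, g ≠ w j ∧ g ≠ (w j)ᶜ
  · exact h2 g hg hw hφ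
  · push Not at hw
    obtain ⟨j, hj⟩ := hw
    by_cases hgj : g = w j
    · rw [hgj, h.mem_iff] at hφ
      rwa [hgj, h1]
    · rw [hj hgj, h.mem_compl_iff, ← units_ne_one_iff] at hφ
      rwa [hj hgj, Set.mem_compl_iff, h1]

end IsCubeMap

namespace IsCell

variable {V : Type u} {H : Set (Set V)} {σ : Set (Set V)}

/-- Only finitely many halfspaces contain `x` but not `y`, so finiteness has to be checked at one
point only. -/
theorem finite_of (hH : IsWallSystem H) {y : V} (h : {h ∈ H | y ∈ h ∧ h ∉ σ}.Finite) (x : V) :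
    {h ∈ H | x ∈ h ∧ h ∉ σ}.Finite := by
  refine (h.union (hH.finite x y)).subset ?_
  rintro g ⟨h1, h2, h3⟩
  by_cases hy : y ∈ g
  · exact .inl ⟨h1, hy, h3⟩
  · exact .inr ⟨h1, h2, hy⟩

/-- The axiom `disjoint` makes the halfspaces of `τ` meet pairwise, and `finite` leaves only
finitely many that miss a given point; completeness of the wall system then applies. -/
theorem exists_point [Nonempty V] (hH : IsWallSystem H) (hσ : IsCell H σ) {τ : Set (Set V)}
    (hστ : σ ⊆ τ) (hτ : τ ⊆ H) (htot : ∀ h ∈ H, h ∈ τ ∨ hᶜ ∈ τ) (hcons : ∀ h ∈ τ, hᶜ ∉ τ) :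
    ∃ x, ∀ h ∈ H, h ∈ τ ↔ x ∈ h := by
  obtain ⟨y⟩ := ‹Nonempty V›
  refine hH.complete τ hτ htot (fun h hh g hg => ?_) y ?_
  · by_contra hne
    rcases hσ.disjoint h (hτ hh) g (hτ hg) (fun he => hcons h hh (he ▸ hg)) hne with h1 | h1
    · exact hcons h hh (hστ h1)
    · exact hcons g hg (hστ h1)
  · refine ((hσ.finite y).image compl).subset ?_
    rintro h ⟨h1, h2⟩
    exact ⟨hᶜ, ⟨hH.compl_mem (hτ h1), h2, fun h3 => hcons h h1 (hστ h3)⟩, compl_compl h⟩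

/-- The parametrized cube of a cell. -/
theorem exists_isCubeMap [Nonempty V] (hH : IsWallSystem H) (hσ : IsCell H σ) {m : ℕ}
    {w : Fin m → Set V} (hw : ∀ i, w i ∈ H) (hne : ∀ i j, i ≠ j → w i ≠ w j)
    (hne' : ∀ i j, w i ≠ (w j)ᶜ)
    (hiff : ∀ h ∈ H, (h ∉ σ ∧ hᶜ ∉ σ) ↔ ∃ i, h = w i ∨ h = (w i)ᶜ) :
    ∃ φ, IsCubeMap H φ w ∧ ∀ h ∈ σ, ∀ ε, φ ε ∈ h := by
  have hinj : ∀ {i j}, w i = w j → i = j := fun {i j} h => by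
    by_contra hij
    exact hne i j hij h
  -- The corner `ε` completes `σ` by the side of each wall `w i` that the sign `ε i` prescribes.
  have key : ∀ ε : Fin m → ℤˣ, ∃ x, ∀ h ∈ H,
      (h ∈ σ ∨ ∃ i, (ε i = 1 ∧ h = w i) ∨ (ε i = -1 ∧ h = (w i)ᶜ)) ↔ x ∈ h := by
    intro ε
    refine hσ.exists_point hH (τ := {h | h ∈ σ ∨ ∃ i, (ε i = 1 ∧ h = w i) ∨
      (ε i = -1 ∧ h = (w i)ᶜ)}) (fun h => .inl) ?_ ?_ ?_
    · rintro h (h1 | ⟨i, ⟨-, rfl⟩ | ⟨-, rfl⟩⟩)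
      · exact hσ.subset h1
      · exact hw i
      · exact hH.compl_mem (hw i)
    · intro h hh
      by_cases h1 : h ∉ σ ∧ hᶜ ∉ σ
      · obtain ⟨i, rfl | rfl⟩ := (hiff h hh).1 h1 <;>
          rcases Int.units_eq_one_or (ε i) with h2 | h2
        · exact .inl (.inr ⟨i, .inl ⟨h2, rfl⟩⟩)
        · exact .inr (.inr ⟨i, .inr ⟨h2, rfl⟩⟩)
        · exact .inr (.inr ⟨i, .inl ⟨h2, compl_compl _⟩⟩)
        · exact .inl (.inr ⟨i, .inr ⟨h2, rfl⟩⟩)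
      · by_cases h2 : h ∈ σ
        · exact .inl (.inl h2)
        · exact .inr (.inl (by tauto))
    · have hi1 : ∀ i, w i ∉ σ := fun i => ((hiff _ (hw i)).2 ⟨i, .inl rfl⟩).1
      have hi2 : ∀ i, (w i)ᶜ ∉ σ := fun i => ((hiff _ (hw i)).2 ⟨i, .inl rfl⟩).2
      rintro h (h1 | ⟨i, ⟨h1, rfl⟩ | ⟨h1, rfl⟩⟩) (h2 | ⟨j, ⟨h3, h4⟩ | ⟨h3, h4⟩⟩)
      · exact hσ.consistent h h1 h2
      · rw [compl_eq_comm] at h4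
        exact hi2 j (h4 ▸ h1)
      · exact hi1 j (compl_injective h4 ▸ h1)
      · exact hi2 i h2
      · exact hne' j i h4.symm
      · obtain rfl := hinj (compl_injective h4)
        rw [h1] at h3
        exact absurd h3 (by decide)
      · rw [compl_compl] at h2
        exact hi1 i h2
      · rw [compl_compl] at h4
        obtain rfl := hinj h4
        rw [h1] at h3
        exact absurd h3 (by decide)
      · rw [compl_compl] at h4
        exact hne' _ _ h4
  choose φ hφ using key
  refine ⟨φ, ⟨hw, fun ε i => ?_, fun h hh hc ε ε' hε => ?_⟩, fun h hh ε =>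
    (hφ ε h (hσ.subset hh)).1 (.inl hh)⟩
  · rw [← hφ ε _ (hw i)]
    constructor
    · rintro (h | ⟨j, ⟨h1, h2⟩ | ⟨-, h2⟩⟩)
      · exact absurd h ((hiff _ (hw i)).2 ⟨i, .inl rfl⟩).1
      · rwa [hinj h2]
      · exact absurd h2 (hne' _ _)
    · exact fun h => .inr ⟨i, .inl ⟨h, rfl⟩⟩
  · rw [← hφ _ h hh] at hε ⊢
    refine hε.imp id ?_
    rintro ⟨i, ⟨-, h1⟩ | ⟨-, h1⟩⟩
    · exact absurd h1 (hc i).1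
    · exact absurd h1 (hc i).2

end IsCell

theorem Crosses.compl_left {V : Type u} {h g : Set V} (hc : Crosses h g) : Crosses hᶜ g := by
  obtain ⟨h1, h2, h3, h4⟩ := hc
  exact ⟨h3, h4, by rwa [compl_compl], by rwa [compl_compl]⟩

theorem Crosses.symm {V : Type u} {h g : Set V} (hc : Crosses h g) : Crosses g h := by
  obtain ⟨h1, h2, h3, h4⟩ := hc
  simp only [Set.inter_comm h, Set.inter_comm hᶜ] at h1 h2 h3 h4
  exact ⟨h1, h3, h2, h4⟩

theorem Crosses.compl_right {V : Type u} {h g : Set V} (hc : Crosses h g) : Crosses h gᶜ :=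
  hc.symm.compl_left.symm

namespace IsCrossingFamily

variable {V : Type u} {H : Set (Set V)} {m : ℕ} {w : Fin m → Set V}

theorem ne (hw : IsCrossingFamily H w) {i j : Fin m} (hij : i ≠ j) : w i ≠ w j := fun h => by
  obtain ⟨x, h1, h2⟩ := (hw.crosses i j hij).2.1
  exact h2 (h ▸ h1)

theorem ne_compl (hw : IsCrossingFamily H w) (i j : Fin m) : w i ≠ (w j)ᶜ := fun h => by
  by_cases hij : i = j
  · subst hij
    obtain ⟨x, hx⟩ := (hw.nonempty i).1
    exact (h ▸ hx : x ∈ (w i)ᶜ) hx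
  · obtain ⟨x, h1, h2⟩ := (hw.crosses i j hij).1
    exact (h ▸ h1 : x ∈ (w j)ᶜ) h2

theorem side_inter (hw : IsCrossingFamily H w) {h g : Set V} (hh : ∃ i, h = w i ∨ h = (w i)ᶜ)
    (hg : ∃ i, g = w i ∨ g = (w i)ᶜ) (hgh : g ≠ hᶜ) : (h ∩ g).Nonempty := by
  obtain ⟨i, hi⟩ := hh
  obtain ⟨j, hj⟩ := hg
  by_cases hij : i = j
  · subst hij
    rcases hi with rfl | rfl <;> rcases hj with rfl | rfl
    · simpa using (hw.nonempty i).1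
    · exact absurd rfl hgh
    · simp at hgh
    · simpa using (hw.nonempty i).2
  · have := hw.crosses i j hij
    rcases hi with rfl | rfl <;> rcases hj with rfl | rfl
    · exact this.1
    · exact this.2.1
    · exact this.2.2.1
    · exact this.2.2.2

/-- Pairwise transverse walls cross in a common cell. -/
theorem exists_isCell [Nonempty V] (hH : IsWallSystem H) (hw : IsCrossingFamily H w) :
    ∃ σ, IsCell H σ ∧ ∀ h ∈ H, (h ∉ σ ∧ hᶜ ∉ σ) ↔ ∃ i, h = w i ∨ h = (w i)ᶜ := by
  obtain ⟨y⟩ := ‹Nonempty V›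
  let S : Set V → Prop := fun h => ∃ i, h = w i ∨ h = (w i)ᶜ
  have hS : ∀ {h}, S h → S hᶜ := by
    rintro h ⟨i, rfl | rfl⟩
    · exact ⟨i, .inr rfl⟩
    · exact ⟨i, .inl (compl_compl _)⟩
  have hS' : ∀ {h}, S hᶜ → S h := fun {h} hh => by simpa using hS hh
  have hSS : ∀ {h g}, S h → S g → g ≠ hᶜ → (h ∩ g).Nonempty := hw.side_inter
  have hSne : ∀ {h}, S h → h.Nonempty := by
    rintro h ⟨i, rfl | rfl⟩
    · exact (hw.nonempty i).1
    · exact (hw.nonempty i).2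
  -- The given walls stay undecided. A halfspace that contains a side of one of them is forced,
  -- because the cell meets both sides; the remaining walls take the side of `y`.
  let σ : Set (Set V) := {g | g ∈ H ∧ ¬ S g ∧
    ((∃ h, S h ∧ h ⊆ g) ∨ (y ∈ g ∧ ∀ h, S h → ¬ h ⊆ gᶜ))}
  have htot : ∀ g ∈ H, ¬ S g → g ∈ σ ∨ gᶜ ∈ σ := by
    intro g hg hgS
    have hgS' : ¬ S gᶜ := fun h => hgS (hS' h)
    by_cases h1 : ∃ h, S h ∧ h ⊆ g
    · exact .inl ⟨hg, hgS, .inl h1⟩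
    by_cases h2 : ∃ h, S h ∧ h ⊆ gᶜ
    · exact .inr ⟨hH.compl_mem hg, hgS', .inl h2⟩
    push Not at h1 h2
    by_cases hy : y ∈ g
    · exact .inl ⟨hg, hgS, .inr ⟨hy, h2⟩⟩
    · exact .inr ⟨hH.compl_mem hg, hgS', .inr ⟨hy, by simpa using h1⟩⟩
  refine ⟨σ, ⟨fun g hg => hg.1, ?_, ?_, ?_⟩, ?_⟩
  · rintro g ⟨-, hgS, hg⟩ ⟨-, -, hg'⟩
    rw [compl_compl] at hg'
    rcases hg with ⟨h, hh, hhg⟩ | ⟨hy, hg⟩ <;> rcases hg' with ⟨h', hh', hhg'⟩ | ⟨hy', hg'⟩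
    · by_cases he : h' = hᶜ
      · subst he
        rw [Set.compl_subset_compl] at hhg'
        exact hgS (hhg.antisymm hhg' ▸ hh)
      · obtain ⟨x, h1, h2⟩ := hSS hh hh' he
        exact hhg' h2 (hhg h1)
    · exact hg' h hh hhg
    · exact hg h' hh' hhg'
    · exact hy' hy
  · intro g1 hg1 g2 hg2 hne hdis
    have hsub : g1 ⊆ g2ᶜ := fun x h1 h2 => hdis ⟨x, h1, h2⟩
    have hsub' : g2 ⊆ g1ᶜ := fun x h1 h2 => hdis ⟨x, h2, h1⟩
    by_cases hS1 : S g1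
    · by_cases hS2 : S g2
      · exact absurd (hSS hS1 hS2 hne) hdis
      · exact .inr ⟨hH.compl_mem hg2, fun h => hS2 (hS' h), .inl ⟨g1, hS1, hsub⟩⟩
    · by_cases hS2 : S g2
      · exact .inl ⟨hH.compl_mem hg1, fun h => hS1 (hS' h), .inl ⟨g2, hS2, hsub'⟩⟩
      · by_contra hcon
        push Not at hcon
        have h1 := (htot g1 hg1 hS1).resolve_right hcon.1
        have h2 := (htot g2 hg2 hS2).resolve_right hcon.2
        have h1' := hcon.2
        rcases h1.2.2 with ⟨h, hh, hhg⟩ | ⟨hy, hg⟩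
        · exact hcon.2 ⟨hH.compl_mem hg2, fun h => hS2 (hS' h), .inl ⟨h, hh, hhg.trans hsub⟩⟩
        · rcases h2.2.2 with ⟨h, hh, hhg⟩ | ⟨hy', hg'⟩
          · exact hg h hh (hhg.trans hsub')
          · exact hdis ⟨y, hy, hy'⟩
  · refine IsCell.finite_of hH (y := y) ?_
    have hfin : {h | S h}.Finite := by
      refine ((Set.finite_range w).union (Set.finite_range fun i => (w i)ᶜ)).subset ?_
      rintro h ⟨i, rfl | rfl⟩
      · exact .inl ⟨i, rfl⟩
      · exact .inr ⟨i, rfl⟩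
    -- Apart from the given walls, a halfspace that contains `y` and is not chosen separates `y`
    -- from a point of one of the finitely many given sides.
    choose! z hz using fun h (hh : S h) => hSne hh
    refine (hfin.union (hfin.biUnion fun h _ => hH.finite y (z h))).subset ?_
    rintro g ⟨hg, hy, hgσ⟩
    by_cases hgS : S g
    · exact .inl hgS
    · have h1 := (htot g hg hgS).resolve_left hgσ
      rcases h1.2.2 with ⟨h, hh, hhg⟩ | ⟨hy', -⟩
      · exact .inr (Set.mem_biUnion (x := h) hh ⟨hg, hy, hhg (hz h hh)⟩)
      · exact absurd hy hy'
  · intro h hh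
    constructor
    · rintro ⟨h1, h2⟩
      by_contra hS3
      exact (htot h hh hS3).elim h1 h2
    · exact fun hhS => ⟨fun h1 => h1.2.1 hhS, fun h1 => h1.2.1 (hS hhS)⟩

theorem exists_isCubeMap [Nonempty V] (hH : IsWallSystem H) (hw : IsCrossingFamily H w) :
    ∃ φ, IsCubeMap H φ w := by
  obtain ⟨σ, hσ, hiff⟩ := hw.exists_isCell hH
  obtain ⟨φ, hφ, -⟩ := hσ.exists_isCubeMap hH hw.mem (fun _ _ => hw.ne) hw.ne_compl hiff
  exact ⟨φ, hφ⟩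

end IsCrossingFamily

/-- Any two walls that separate points of `F` are equal or transverse. -/
def IsCubical {V : Type u} (H : Set (Set V)) (F : Set V) : Prop :=
  ∀ h ∈ H, ∀ g ∈ H, (F ∩ h).Nonempty → (F ∩ hᶜ).Nonempty → (F ∩ g).Nonempty →
    (F ∩ gᶜ).Nonempty → g = h ∨ g = hᶜ ∨ (h ∩ g).Nonempty

/-- Only coordinate walls separate corners, and any two of their sides meet unless they are
complementary. -/
theorem IsCubeMap.isCubical {V : Type u} {H : Set (Set V)} {m : ℕ} {φ : (Fin m → ℤˣ) → V}
    {w : Fin m → Set V} (h : IsCubeMap H φ w) {F : Set V} (hF : F ⊆ Set.range φ) :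
    IsCubical H F := by
  have key : ∀ g ∈ H, (F ∩ g).Nonempty → (F ∩ gᶜ).Nonempty → ∃ i, g = w i ∨ g = (w i)ᶜ := by
    rintro g hg ⟨x, hx, hxg⟩ ⟨y, hy, hyg⟩
    obtain ⟨ε, rfl⟩ := hF hx
    obtain ⟨ε', rfl⟩ := hF hy
    by_contra hcon
    push Not at hcon
    exact hyg (h.const g hg hcon _ _ hxg)
  intro g hg g' hg' h1 h2 h3 h4
  by_cases hne : g' = gᶜ
  · exact .inr (.inl hne)
  · exact .inr (.inr (h.isCrossingFamily.side_inter (key g hg h1 h2) (key g' hg' h3 h4) hne))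

/-- Pairwise transverse families of halfspaces have at most `n` members. -/
def HasRankLE {V : Type u} (H : Set (Set V)) (n : ℕ) : Prop :=
  ∀ (m : ℕ) (w : Fin m → Set V), IsCrossingFamily H w → m ≤ n

/-! ### Product with an edge, which raises the rank by one. -/

/-- The halfspaces of the product with an edge. -/
def prodBool {V : Type u} (H : Set (Set V)) : Set (Set (V × Bool)) :=
  {k | (∃ h ∈ H, k = Prod.fst ⁻¹' h) ∨ ∃ b : Bool, k = Prod.snd ⁻¹' {b}}

section ProdBool

variable {V : Type u} {H : Set (Set V)}

theorem compl_snd_preimage (b : Bool) :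
    (Prod.snd ⁻¹' {b} : Set (V × Bool))ᶜ = Prod.snd ⁻¹' {!b} := by
  ext ⟨x, c⟩
  cases b <;> cases c <;> simp

theorem fst_preimage_injective :
    Function.Injective (fun h : Set V => (Prod.fst ⁻¹' h : Set (V × Bool))) :=
  Prod.fst_surjective.preimage_injective

theorem nonempty_of_fst_preimage {h : Set V} (hh : (Prod.fst ⁻¹' h : Set (V × Bool)).Nonempty) :
    h.Nonempty :=
  let ⟨x, hx⟩ := hh
  ⟨x.1, hx⟩

theorem IsWallSystem.prodBool (hH : IsWallSystem H) : IsWallSystem (prodBool H) where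
  compl_mem := by
    rintro _ (⟨h, hh, rfl⟩ | ⟨b, rfl⟩)
    · exact .inl ⟨hᶜ, hH.compl_mem hh, rfl⟩
    · exact .inr ⟨!b, compl_snd_preimage b⟩
  finite x y := by
    refine (((hH.finite x.1 y.1).image (Prod.fst ⁻¹' ·)).union
      (Set.finite_range fun b : Bool => (Prod.snd ⁻¹' {b} : Set (V × Bool)))).subset ?_
    rintro _ ⟨⟨h, hh, rfl⟩ | ⟨b, rfl⟩, h1, h2⟩
    · exact .inl ⟨h, ⟨hh, h1, h2⟩, rfl⟩
    · exact .inr ⟨b, rfl⟩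
  separates := by
    rintro ⟨x, a⟩ ⟨y, b⟩ hxy
    by_cases h : x = y
    · subst h
      exact ⟨_, .inr ⟨a, rfl⟩, rfl, fun h => hxy (by rw [show b = a from h])⟩
    · obtain ⟨h, hh, h1, h2⟩ := hH.separates h
      exact ⟨_, .inl ⟨h, hh, rfl⟩, h1, h2⟩
  complete := by
    intro τ hτ htot hpair y hfin
    obtain ⟨x, hx⟩ := hH.complete {h | h ∈ H ∧ Prod.fst ⁻¹' h ∈ τ} (fun h hh => hh.1)
      (fun h hh => (htot _ (.inl ⟨h, hh, rfl⟩)).imp (fun h1 => ⟨hh, h1⟩)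
        fun h1 => ⟨hH.compl_mem hh, h1⟩)
      (fun h hh g hg => nonempty_of_fst_preimage (hpair _ hh.2 _ hg.2)) y.1
      ((hfin.preimage (fst_preimage_injective.injOn)).subset fun h hh => ⟨hh.1.2, hh.2⟩)
    obtain ⟨b, hb⟩ : ∃ b : Bool, (Prod.snd ⁻¹' {b} : Set (V × Bool)) ∈ τ := by
      rcases htot _ (.inr ⟨true, rfl⟩) with h | h
      · exact ⟨_, h⟩
      · rw [compl_snd_preimage] at h
        exact ⟨_, h⟩
    refine ⟨(x, b), ?_⟩
    rintro _ (⟨h, hh, rfl⟩ | ⟨c, rfl⟩)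
    · exact ⟨fun h1 => (hx h hh).1 ⟨hh, h1⟩, fun h1 => ((hx h hh).2 h1).2⟩
    · constructor
      · intro hc
        obtain ⟨z, h1, h2⟩ := hpair _ hb _ hc
        exact (show b = c from (show z.2 = b from h1).symm.trans h2)
      · intro h
        rwa [← show b = c from h]

theorem crosses_of_fst_preimage {h g : Set V}
    (hc : Crosses (Prod.fst ⁻¹' h : Set (V × Bool)) (Prod.fst ⁻¹' g)) : Crosses h g :=
  ⟨nonempty_of_fst_preimage hc.1, nonempty_of_fst_preimage hc.2.1,
    nonempty_of_fst_preimage hc.2.2.1, nonempty_of_fst_preimage hc.2.2.2⟩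

theorem IsCrossingFamily.of_fst_preimage {m : ℕ} {w : Fin m → Set (V × Bool)}
    (hw : IsCrossingFamily (prodBool H) w) {v : Fin m → Set V} (hv : ∀ i, v i ∈ H)
    (hwv : ∀ i, w i = Prod.fst ⁻¹' (v i)) : IsCrossingFamily H v where
  mem := hv
  nonempty i := by
    have := hw.nonempty i
    rw [hwv] at this
    exact ⟨nonempty_of_fst_preimage this.1, nonempty_of_fst_preimage this.2⟩
  crosses i j hij := by
    have := hw.crosses i j hij
    rw [hwv, hwv] at this
    exact crosses_of_fst_preimage this

theorem IsCrossingFamily.comp_injective {m k : ℕ} {w : Fin m → Set V}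
    (hw : IsCrossingFamily H w) {f : Fin k → Fin m} (hf : Function.Injective f) :
    IsCrossingFamily H (w ∘ f) :=
  ⟨fun _ => hw.mem _, fun _ => hw.nonempty _, fun _ _ hij => hw.crosses _ _ (hf.ne hij)⟩

/-- The second factor contributes a single wall, so at most one member of a crossing family fails to
come from `V`. -/
theorem HasRankLE.prodBool {n : ℕ} (hn : HasRankLE H n) : HasRankLE (prodBool H) (n + 1) := by
  intro m w hw
  by_cases hall : ∀ i, ∃ h ∈ H, w i = Prod.fst ⁻¹' h
  · choose v hv hwv using hall
    exact (hn m v (hw.of_fst_preimage hv hwv)).trans n.le_succ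
  · push Not at hall
    obtain ⟨i, hi⟩ := hall
    obtain ⟨b, hb⟩ := (hw.mem i).resolve_left fun ⟨h, hh, h1⟩ => hi h hh h1
    obtain _ | m := m
    · exact i.elim0
    have hall : ∀ j, ∃ h ∈ H, w (i.succAbove j) = Prod.fst ⁻¹' h := by
      intro j
      refine (hw.mem (i.succAbove j)).resolve_right ?_
      rintro ⟨c, hc⟩
      by_cases hbc : c = b
      · subst hbc
        exact hw.ne (Fin.succAbove_ne i j) (hc.trans hb.symm)
      · obtain rfl : c = !b := by cases b <;> cases c <;> simp_all
        exact hw.ne_compl (i.succAbove j) i (by rw [hc, hb, compl_snd_preimage])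
    choose v hv hwv using hall
    exact Nat.succ_le_succ
      (hn m v ((hw.comp_injective Fin.succAbove_right_injective).of_fst_preimage hv hwv))

theorem crosses_snd_fst {h : Set V} (h1 : h.Nonempty) (h2 : hᶜ.Nonempty) (b : Bool) :
    Crosses (Prod.snd ⁻¹' {b} : Set (V × Bool)) (Prod.fst ⁻¹' h) := by
  obtain ⟨x, hx⟩ := h1
  obtain ⟨y, hy⟩ := h2
  exact ⟨⟨(x, b), rfl, hx⟩, ⟨(y, b), rfl, hy⟩, ⟨(x, !b), by cases b <;> simp, hx⟩,
    ⟨(y, !b), by cases b <;> simp, hy⟩⟩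

theorem IsCrossingFamily.prodBool [Nonempty V] {m : ℕ} {w : Fin m → Set V}
    (hw : IsCrossingFamily H w) : IsCrossingFamily (prodBool H)
      (Fin.cons (Prod.snd ⁻¹' {true}) fun i => Prod.fst ⁻¹' (w i) :
        Fin (m + 1) → Set (V × Bool)) where
  mem i := by
    refine Fin.cases ?_ (fun i => ?_) i
    · exact .inr ⟨true, rfl⟩
    · exact .inl ⟨w i, hw.mem i, rfl⟩
  nonempty i := by
    obtain ⟨x⟩ := ‹Nonempty V›
    refine Fin.cases ?_ (fun i => ?_) i
    · exact ⟨⟨(x, true), rfl⟩, ⟨(x, false), by simp⟩⟩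
    · obtain ⟨⟨y, hy⟩, ⟨z, hz⟩⟩ := hw.nonempty i
      exact ⟨⟨(y, true), hy⟩, ⟨(z, true), hz⟩⟩
  crosses i j := by
    refine Fin.cases ?_ (fun i => ?_) i <;> refine Fin.cases ?_ (fun j => ?_) j
    · exact fun h => absurd rfl h
    · exact fun _ => crosses_snd_fst (hw.nonempty j).1 (hw.nonempty j).2 _
    · exact fun _ => (crosses_snd_fst (hw.nonempty i).1 (hw.nonempty i).2 _).symm
    · intro hij
      obtain ⟨⟨a, ha⟩, ⟨b, hb⟩, ⟨c, hc⟩, ⟨d, hd⟩⟩ :=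
        hw.crosses i j fun h => hij (congrArg Fin.succ h)
      exact ⟨⟨(a, true), ha⟩, ⟨(b, true), hb⟩, ⟨(c, true), hc⟩, ⟨(d, true), hd⟩⟩

theorem IsCubical.image_fst {F : Set (V × Bool)} (hF : IsCubical (prodBool H) F) :
    IsCubical H (Prod.fst '' F) := by
  have key : ∀ {h : Set V}, (Prod.fst '' F ∩ h).Nonempty → (F ∩ Prod.fst ⁻¹' h).Nonempty := by
    rintro h ⟨_, ⟨x, hx, rfl⟩, hxh⟩
    exact ⟨x, hx, hxh⟩
  intro h hh g hg h1 h2 h3 h4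
  rcases hF _ (.inl ⟨h, hh, rfl⟩) _ (.inl ⟨g, hg, rfl⟩) (key h1) (key h2) (key h3) (key h4) with
    h | h | h
  · exact .inl (fst_preimage_injective h)
  · exact .inr (.inl (fst_preimage_injective h))
  · exact .inr (.inr (nonempty_of_fst_preimage h))

end ProdBool

/-! ### Null-homotopy by removal of peaks. -/

namespace CubeComplex

variable {X : CubeComplex.{u}}

theorem isEdgePath_append {v w : X.cube 0} {l l' : List (X.cube 1)} :
    X.IsEdgePath v w (l ++ l') ↔ ∃ z, X.IsEdgePath v z l ∧ X.IsEdgePath z w l' := by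
  refine ⟨fun h => ?_, fun ⟨z, h, h'⟩ => h.append h'⟩
  induction l generalizing v with
  | nil => exact ⟨v, rfl, h⟩
  | cons e l ih =>
    obtain ⟨z, h1, h2⟩ := ih h.2
    exact ⟨z, ⟨h.1, h1⟩, h2⟩

/-- A path whose first edge ascends and whose end is lowest has a peak. -/
theorem IsEdgePath.exists_peak {ht : X.cube 0 → ℕ} (hne : ∀ e, ht (X.src e) ≠ ht (X.tgt e))
    {w : X.cube 0} (hw : ∀ v, ht w ≤ ht v) (l : List (X.cube 1)) :
    ∀ {v : X.cube 0} {e : X.cube 1}, X.IsEdgePath v w (e :: l) →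
      ht (X.src e) < ht (X.tgt e) → ∃ l₁ e' f l₂, e :: l = l₁ ++ [e', f] ++ l₂ ∧
        ht (X.src e') < ht (X.tgt e') ∧ ht (X.tgt f) < ht (X.src f) := by
  induction l with
  | nil =>
    intro v e h hlt
    have h1 : X.tgt e = w := h.2
    rw [h1] at hlt
    exact absurd (hw _) (not_le.2 hlt)
  | cons f l ih =>
    intro v e h hlt
    rcases lt_or_gt_of_ne (hne f) with hf | hf
    · obtain ⟨l₁, e', f', l₂, h1, h2⟩ := ih h.2 hf
      exact ⟨e :: l₁, e', f', l₂, by rw [h1]; rfl, h2⟩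
    · exact ⟨[], e, f, l, rfl, hlt, hf⟩

/-- A closed edge path at a lowest vertex is null-homotopic if the peaks can be removed. -/
theorem homotopic_nil_of_height {ht : X.cube 0 → ℕ} (hne : ∀ e, ht (X.src e) ≠ ht (X.tgt e))
    (hpeak : ∀ e f, X.tgt e = X.src f → ht (X.src e) < ht (X.tgt e) →
      ht (X.tgt f) < ht (X.src f) → f = X.rev e ∨ ∃ s : X.cube 2, X.edgeAt s 0 = X.rev e ∧
        X.edgeAt s 1 = f ∧ ht (X.tgt (X.topAt s 0)) < ht (X.src f))
    {o : X.cube 0} (ho : ∀ v, ht o ≤ ht v) {l : List (X.cube 1)} (hl : X.IsEdgePath o o l) :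
    X.Homotopic o o l [] := by
  -- Both moves at a peak lower this sum: a backtrack deletes two positive terms, and a square
  -- replaces the height of the peak by a smaller one.
  obtain ⟨k, hk⟩ : ∃ k, (l.map fun e => ht (X.tgt e) + 1).sum = k := ⟨_, rfl⟩
  induction k using Nat.strong_induction_on generalizing l with
  | _ k ih =>
    cases l with
    | nil => exact .refl _
    | cons e₀ l₀ =>
      obtain ⟨l₁, e, f, l₂, heq, he, hf⟩ := IsEdgePath.exists_peak hne ho l₀ hl
        (lt_of_le_of_ne (by rw [hl.1]; exact ho _) (hne _))
      rw [heq] at hl hk ⊢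
      obtain ⟨z, h12, h3⟩ := isEdgePath_append.1 hl
      obtain ⟨y, h1, h2⟩ := isEdgePath_append.1 h12
      obtain ⟨hy, hef, hz⟩ := h2
      have hz : X.tgt f = z := hz
      rcases hpeak e f hef.symm he hf with rfl | ⟨s, hs1, rfl, hs2⟩
      · have hnew : X.IsEdgePath o o (l₁ ++ l₂) := by
          rw [tgt_rev, hy] at hz
          exact h1.append (hz ▸ h3)
        refine .trans _ _ _ (.rel _ _ ⟨hl, hnew, .backtrack l₁ e l₂⟩) (ih _ ?_ hnew rfl)
        rw [← hk]
        simp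
        omega
      · have hsq := ElementaryHomotopy.square l₁ (X.reflect s) l₂
        have a1 : X.map (FaceMap.baseEdge 0) (X.reflect s) = e :=
          (edgeAt_reflect_zero s).trans (by rw [hs1, rev_rev])
        have a2 : X.map (FaceMap.topEdge 1) (X.reflect s) = X.edgeAt s 1 := topAt_reflect_one s
        have a3 : X.map (FaceMap.baseEdge 1) (X.reflect s) = X.topAt s 1 := edgeAt_reflect_one s
        have a4 : X.map (FaceMap.topEdge 0) (X.reflect s) = X.rev (X.topAt s 0) :=
          topAt_reflect_zero s
        rw [a1, a2, a3, a4] at hsq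
        have hnew : X.IsEdgePath o o
            (l₁ ++ [X.topAt s 1, X.rev (X.topAt s 0)] ++ l₂) := by
          refine (h1.append (z := z) (l' := [_, _]) ⟨?_, ?_, ?_⟩).append h3
          · rw [← tgt_edgeAt_zero, hs1, tgt_rev, hy]
          · rw [src_rev, tgt_topAt_zero]
          · rw [tgt_rev, ← tgt_edgeAt_one]
            exact hz
        refine .trans _ _ _ (.rel _ _ ⟨hl, hnew, hsq⟩) (ih _ ?_ hnew rfl)
        rw [← hk]
        simp only [List.map_append, List.sum_append, List.map_cons, List.map_nil, List.sum_cons,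
          List.sum_nil, tgt_rev, ← tgt_edgeAt_one, ← tgt_topAt_zero]
        rw [hef] at hs2
        omega

end CubeComplex

/-! ### The dual complex of a wall system is CAT(0). -/

section DualComplex

variable {V : Type u} {H : Set (Set V)}

/-- The cube complex dual to a wall system. -/
noncomputable def dualComplex (hH : IsWallSystem H) : CubeComplex.{u} where
  cube m := {φ : (Fin m → ℤˣ) → V // ∃ w, IsCubeMap H φ w}
  map f c := ⟨fun ε => c.1 (f.act ε), let ⟨_, hw⟩ := c.2; ⟨_, hw.comp hH f⟩⟩
  map_id c := by
    ext ε
    simp [FaceMap.act_id]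
  map_comp g f c := by
    ext ε
    simp [FaceMap.act_comp]
  free f c h := by
    obtain ⟨w, hw⟩ := c.2
    refine FaceMap.eq_id_of_act fun ε => hw.injective ?_
    exact congrFun (congrArg Subtype.val h) ε

namespace dualComplex

variable (hH : IsWallSystem H)

theorem corner_val {n : ℕ} (ε : Fin n → ℤˣ) (c : (dualComplex hH).cube n) (δ : Fin 0 → ℤˣ) :
    ((dualComplex hH).map (FaceMap.corner ε) c).1 δ = c.1 ε := by
  refine congrArg c.1 ?_
  funext j
  rw [FaceMap.act_of_notMem _ _ _ fun i => i.elim0]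
  rfl

theorem edgeThrough_val {n : ℕ} (ε : Fin n → ℤˣ) (i : Fin n) (c : (dualComplex hH).cube n)
    (δ : Fin 1 → ℤˣ) :
    ((dualComplex hH).map (FaceMap.edgeThrough ε i) c).1 δ = c.1 (Function.update ε i (δ 0)) := by
  refine congrArg c.1 ?_
  apply FaceMap.corner_injective
  rw [← FaceMap.comp_corner, FaceMap.edgeThrough_comp_corner]

/-- The point of `V` that is a vertex of the dual complex. -/
def point (v : (dualComplex hH).cube 0) : V := v.1 1

/-- The vertex of the dual complex given by a point of `V`. -/
def vertex (x : V) : (dualComplex hH).cube 0 :=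
  ⟨fun _ => x, Fin.elim0, fun i => i.elim0, fun _ i => i.elim0, fun _ _ _ _ _ h => h⟩

variable {hH}

theorem val_eq_point (v : (dualComplex hH).cube 0) (δ : Fin 0 → ℤˣ) : v.1 δ = point hH v :=
  congrArg v.1 (Subsingleton.elim _ _)

theorem point_injective : Function.Injective (point hH) := fun v v' h =>
  Subtype.ext (funext fun δ => by rw [val_eq_point, val_eq_point, h])

theorem point_src (e : (dualComplex hH).cube 1) :
    point hH ((dualComplex hH).src e) = e.1 (-1) := corner_val hH _ _ _

theorem point_tgt (e : (dualComplex hH).cube 1) :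
    point hH ((dualComplex hH).tgt e) = e.1 1 := corner_val hH _ _ _

theorem point_base {n : ℕ} (c : (dualComplex hH).cube n) :
    point hH ((dualComplex hH).base c) = c.1 (-1) := corner_val hH _ _ _

theorem edgeAt_val {n : ℕ} (c : (dualComplex hH).cube n) (i : Fin n) (δ : Fin 1 → ℤˣ) :
    ((dualComplex hH).edgeAt c i).1 δ = c.1 (Function.update (-1) i (δ 0)) :=
  edgeThrough_val hH _ _ _ _

theorem edge_ext {e f : (dualComplex hH).cube 1} (h1 : e.1 (-1) = f.1 (-1)) (h2 : e.1 1 = f.1 1) :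
    e = f := by
  refine Subtype.ext (funext fun δ => ?_)
  rcases Int.units_eq_one_or (δ 0) with h | h
  · have : δ = 1 := funext fun i => by rw [Subsingleton.elim i 0, h]; rfl
    rw [this, h2]
  · have : δ = -1 := funext fun i => by rw [Subsingleton.elim i 0, h]; rfl
    rw [this, h1]

theorem update_neg_one {n : ℕ} (i : Fin n) :
    Function.update (-1 : Fin n → ℤˣ) i (-1) = -1 := by
  simp

theorem update_fin_one (ε δ : Fin 1 → ℤˣ) (i : Fin 1) :
    Function.update ε i (δ i) = δ := by
  funext j
  rw [Subsingleton.elim j i, Function.update_self]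

theorem edge_eq_wall {e : (dualComplex hH).cube 1} {w : Fin 1 → Set V} (hw : IsCubeMap H e.1 w)
    {g : Set V} (hg : g ∈ H) (h1 : e.1 (-1) ∉ g) (h2 : e.1 1 ∈ g) : g = w 0 :=
  hw.eq_wall hg (ε := 1) (by rwa [show Function.update (1 : Fin 1 → ℤˣ) 0 (-1) = -1 from
    update_fin_one _ (-1) 0]) (by rwa [show Function.update (1 : Fin 1 → ℤˣ) 0 1 = 1 from
    update_fin_one _ 1 0])

/-- Cubes with the same edges at the base cross the same walls in the same order, and lie on the
side of the base for all other walls. -/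
theorem linkIsSimplicial (v : (dualComplex hH).cube 0) :
    (dualComplex hH).LinkIsSimplicial v := by
  constructor
  · intro n c _ i j hij
    obtain ⟨w, hw⟩ := c.2
    by_contra hne
    have h1 := congrFun (congrArg Subtype.val hij) 1
    rw [edgeAt_val, edgeAt_val] at h1
    have h2 := congrFun (hw.injective h1) i
    simp [hne] at h2
  · intro n c c' hc hc' he
    obtain ⟨w, hw⟩ := c.2
    obtain ⟨w', hw'⟩ := c'.2
    have hb : c.1 (-1) = c'.1 (-1) := by
      rw [← point_base, ← point_base, hc, hc']
    have hi : ∀ i, c.1 (Function.update (-1) i 1) = c'.1 (Function.update (-1) i 1) := by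
      intro i
      have h1 := congrFun (congrArg Subtype.val (congrFun he i)) 1
      rwa [edgeAt_val, edgeAt_val] at h1
    have hww : ∀ i, w' i = w i := by
      intro i
      refine hw.eq_wall (hw'.mem i) (i := i) (ε := -1) ?_ ?_
      · rw [update_neg_one, hb, hw'.mem_iff]
        simp
      · rw [hi, hw'.mem_iff]
        simp
    refine Subtype.ext (funext fun ε => ?_)
    refine hw.eq_of_mem hH (fun i => ?_) fun g hg hgw hε => ?_
    · rw [← hww, hw'.mem_iff]
    · have h1 := hw.const g hg hgw _ (-1) hε
      rw [hb] at h1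
      exact hw'.const g hg (by simpa only [hww] using hgw) _ _ h1

/-- Edges at a vertex that cross pairwise distinct walls span a cube if the sides of these walls
away from the vertex intersect pairwise. -/
theorem exists_corner {n : ℕ} {v : (dualComplex hH).cube 0} {e : Fin n → (dualComplex hH).cube 1}
    (hsrc : ∀ i, (dualComplex hH).src (e i) = v) {w : Fin n → Set V}
    (hw : ∀ i, IsCubeMap H (e i).1 (fun _ => w i)) (hne : ∀ i j, i ≠ j → w i ≠ w j)
    (hint : ∀ i j, i ≠ j → (w i ∩ w j).Nonempty) :
    ∃ c : (dualComplex hH).cube n, (dualComplex hH).base c = v ∧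
      (dualComplex hH).edgeAt c = e := by
  have hV : Nonempty V := ⟨point hH v⟩
  have hp : ∀ i, (e i).1 (-1) = point hH v := fun i => by rw [← point_src, hsrc]
  set p := point hH v with hpdef
  have hpw : ∀ i, p ∉ w i := fun i => by
    rw [← hp i, (hw i).mem_iff _ 0]
    simp
  have hqw : ∀ i, (e i).1 1 ∈ w i := fun i => ((hw i).mem_iff _ 0).2 rfl
  have hmem : ∀ i, w i ∈ H := fun i => (hw i).mem 0
  have hnc : ∀ i j, w i ≠ (w j)ᶜ := fun i j h => hpw i (h ▸ hpw j)
  have hother : ∀ i, ∀ g ∈ H, p ∈ g → g ≠ (w i)ᶜ → (e i).1 1 ∈ g := fun i g hg hpg hgw =>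
    (hw i).const g hg (fun _ => ⟨fun h => hpw i (h ▸ hpg), hgw⟩) (-1) 1 ((hp i).symm ▸ hpg)
  -- The cell at `p` that leaves open exactly the walls of the given edges. A disjoint pair
  -- violating the axiom would consist of halfspaces at `p` or far sides `w i`; common points are
  -- `p`, ends of the edges, or provided by `hint`.
  have hcell : IsCell H {h | h ∈ H ∧ p ∈ h ∧ ∀ i, h ≠ (w i)ᶜ} := by
    refine ⟨fun h hh => hh.1, fun h hh hh' => hh'.2.1 hh.2.1, ?_, fun y =>
      IsCell.finite_of hH (y := p) ?_ y⟩
    · intro g1 hg1 g2 hg2 hne' hdis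
      have hsub : g1 ⊆ g2ᶜ := fun x h1 h2 => hdis ⟨x, h1, h2⟩
      by_contra hcon
      push Not at hcon
      have key : ∀ g ∈ H, gᶜ ∉ {h | h ∈ H ∧ p ∈ h ∧ ∀ i, h ≠ (w i)ᶜ} → p ∈ g ∨ ∃ i, g = w i := by
        intro g hg hgσ
        by_contra hc
        push Not at hc
        exact hgσ ⟨hH.compl_mem hg, hc.1, fun i h => hc.2 i (compl_injective h)⟩
      rcases key g1 hg1 hcon.1 with h1 | ⟨i, rfl⟩ <;> rcases key g2 hg2 hcon.2 with h2 | ⟨j, rfl⟩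
      · exact hdis ⟨p, h1, h2⟩
      · exact hdis ⟨_, hother j g1 hg1 h1 (fun h => hne' (by rw [h, compl_compl])), hqw j⟩
      · exact hdis ⟨_, hqw i, hother i g2 hg2 h2 hne'⟩
      · by_cases hij : i = j
        · subst hij
          exact hdis ⟨_, hqw i, hqw i⟩
        · exact hdis (hint i j hij)
    · refine (Set.finite_range fun i => (w i)ᶜ).subset ?_
      rintro h ⟨h1, h2, h3⟩
      by_contra hc
      exact h3 ⟨h1, h2, fun i hi => hc ⟨i, hi.symm⟩⟩
  obtain ⟨φ, hφ, hφσ⟩ := hcell.exists_isCubeMap hH hmem hne hnc (by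
    intro h hh
    constructor
    · rintro ⟨h1, h2⟩
      by_contra hc
      push Not at hc
      by_cases hph : p ∈ h
      · exact h1 ⟨hh, hph, fun i => (hc i).2⟩
      · exact h2 ⟨hH.compl_mem hh, hph, fun i hi => (hc i).1 (compl_injective hi)⟩
    · rintro ⟨i, rfl | rfl⟩
      · exact ⟨fun h1 => hpw i h1.2.1, fun h1 => h1.2.2 i rfl⟩
      · exact ⟨fun h1 => h1.2.2 i rfl, fun h1 => by
          rw [compl_compl] at h1
          exact hpw i h1.2.1⟩)
  have hside : ∀ g ∈ H, ∀ ε, (∀ i, g ≠ w i ∧ g ≠ (w i)ᶜ) → φ ε ∈ g → p ∈ g := by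
    intro g hg ε hgw hε
    by_contra hpg
    exact hφσ gᶜ ⟨hH.compl_mem hg, hpg, fun i hi => (hgw i).1 (compl_injective hi)⟩ ε hε
  have hbase : φ (-1) = p := by
    refine hφ.eq_of_mem hH (fun i => ?_) fun g hg hgw hε => hside g hg _ hgw hε
    simpa using hpw i
  have htop : ∀ i, φ (Function.update (-1) i 1) = (e i).1 1 := by
    intro i
    refine hφ.eq_of_mem hH (fun j => ?_) fun g hg hgw hε =>
      hother i g hg (hside g hg _ hgw hε) (hgw i).2
    by_cases hij : j = i
    · subst hij
      simpa using hqw j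
    · rw [Function.update_of_ne hij]
      refine iff_of_false (fun h => ?_) (by simp)
      exact hpw j ((hp i) ▸ (hw i).const (w j) (hmem j) (fun _ => ⟨hne j i hij, hnc j i⟩) 1 (-1) h)
  refine ⟨⟨φ, w, hφ⟩, point_injective ?_, ?_⟩
  · exact (point_base _).trans hbase
  · funext i
    refine edge_ext ?_ ?_
    · exact (edgeAt_val _ _ _).trans
        ((congrArg φ (update_neg_one i)).trans (hbase.trans (hp i).symm))
    · exact (edgeAt_val _ _ _).trans (htop i)

theorem exists_wall (e : (dualComplex hH).cube 1) :
    ∃ w : Set V, IsCubeMap H e.1 (fun _ => w) := by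
  obtain ⟨w, hw⟩ := e.2
  refine ⟨w 0, ?_⟩
  have : (fun _ : Fin 1 => w 0) = w := funext fun i => by rw [Subsingleton.elim i 0]
  rwa [this]

/-- The two walls of a square are distinct and transverse, which is all that `exists_corner`
requires of the pairs of edges. -/
theorem linkIsFlag (v : (dualComplex hH).cube 0) : (dualComplex hH).LinkIsFlag v := by
  intro n e hsrc hadj
  choose w hw using fun i => exists_wall (e i)
  have key : ∀ i j, i ≠ j → w i ≠ w j ∧ (w i ∩ w j).Nonempty := by
    intro i j hij
    obtain ⟨s, h0, h1⟩ := hadj i j hij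
    obtain ⟨u, hu⟩ := s.2
    have hu0 : ∀ (k : Fin 2) (i : Fin n), (dualComplex hH).edgeAt s k = e i → u k = w i := by
      intro k i hk
      refine edge_eq_wall (hw i) (hu.mem k) ?_ ?_
      · rw [← hk, edgeAt_val, hu.mem_iff]
        simp
      · rw [← hk, edgeAt_val, hu.mem_iff]
        simp
    rw [← hu0 0 i h0, ← hu0 1 j h1]
    exact ⟨hu.isCrossingFamily.ne (by decide), (hu.isCrossingFamily.crosses 0 1 (by decide)).1⟩
  exact exists_corner hsrc hw (fun i j hij => (key i j hij).1) fun i j hij => (key i j hij).2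

/-- The number of walls that separate a vertex from the point `o`. -/
noncomputable def height (o : V) (v : (dualComplex hH).cube 0) : ℕ :=
  {h ∈ H | point hH v ∈ h ∧ o ∉ h}.ncard

/-- An edge crosses a single wall: moving to the side of `o` loses one separating halfspace and
gains none. -/
theorem height_tgt_lt {o : V} {e : (dualComplex hH).cube 1} {g : Set V} (hg : g ∈ H)
    (h1 : e.1 (-1) ∉ g) (h2 : e.1 1 ∈ g) (ho : o ∈ g) :
    height o ((dualComplex hH).tgt e) < height o ((dualComplex hH).src e) := by
  obtain ⟨w, hw⟩ := exists_wall e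
  obtain rfl := edge_eq_wall hw hg h1 h2
  refine Set.ncard_lt_ncard ?_ (hH.finite _ _)
  rw [point_src, point_tgt]
  refine ⟨?_, fun hsub => ?_⟩
  · rintro h ⟨hh, ht, hoh⟩
    by_cases hc : h = gᶜ
    · subst hc
      exact absurd h2 ht
    · exact ⟨hh, hw.const h hh (fun _ => ⟨fun h' => hoh (h' ▸ ho), hc⟩) _ _ ht, hoh⟩
  · exact (hsub (show gᶜ ∈ _ from ⟨hH.compl_mem hg, h1, not_not.2 ho⟩)).2.1 h2

theorem height_src_lt {o : V} {e : (dualComplex hH).cube 1} {g : Set V} (hg : g ∈ H)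
    (h1 : e.1 (-1) ∉ g) (h2 : e.1 1 ∈ g) (ho : o ∉ g) :
    height o ((dualComplex hH).src e) < height o ((dualComplex hH).tgt e) := by
  have h3 : ((dualComplex hH).rev e).1 (-1) = e.1 1 := by
    rw [← point_src, CubeComplex.src_rev, point_tgt]
  have h4 : ((dualComplex hH).rev e).1 1 = e.1 (-1) := by
    rw [← point_tgt, CubeComplex.tgt_rev, point_src]
  have := height_tgt_lt (o := o) (e := (dualComplex hH).rev e) (hH.compl_mem hg)
    (by rw [h3]; exact not_not.2 h2) (by rw [h4]; exact h1) ho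
  rwa [CubeComplex.src_rev, CubeComplex.tgt_rev] at this

theorem isCubeMap_rev {e : (dualComplex hH).cube 1} {w : Set V}
    (hw : IsCubeMap H e.1 (fun _ => w)) :
    IsCubeMap H ((dualComplex hH).rev e).1 (fun _ => wᶜ) := by
  have := hw.comp hH FaceMap.flip
  have h1 : (fun i : Fin 1 => if FaceMap.flip.sign (FaceMap.flip.emb i) = 1 then w else wᶜ) =
      fun _ => wᶜ := funext fun i => if_neg (by simp [FaceMap.flip])
  rwa [h1] at this

/-- Any vertex `v` other than `o` has an edge in the direction of `o`. -/
theorem exists_descending {o : V} {v : (dualComplex hH).cube 0} (hv : point hH v ≠ o) :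
    ∃ e, (dualComplex hH).src e = v ∧
      height o ((dualComplex hH).tgt e) < height o ((dualComplex hH).src e) := by
  have hV : Nonempty V := ⟨o⟩
  set x := point hH v with hx
  -- Minimality of `h` is what makes the other halfspaces at `x` a cell, namely an edge across the
  -- wall of `h`.
  obtain ⟨h, ⟨hh, hxh, hoh⟩, hmin⟩ := (hH.finite x o).exists_minimal (hH.separates hv)
  have hxσ : ∀ g ∈ H, (g ∉ {g | g ∈ H ∧ x ∈ g ∧ g ≠ h} ∧ gᶜ ∉ {g | g ∈ H ∧ x ∈ g ∧ g ≠ h}) ↔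
      ∃ _ : Fin 1, g = hᶜ ∨ g = hᶜᶜ := by
    intro g hg
    constructor
    · rintro ⟨h1, h2⟩
      refine ⟨0, ?_⟩
      by_cases hxg : x ∈ g
      · right
        rw [compl_compl]
        by_contra hne
        exact h1 ⟨hg, hxg, hne⟩
      · left
        by_contra hne
        exact h2 ⟨hH.compl_mem hg, hxg, fun he => hne (by rw [← he, compl_compl])⟩
    · rintro ⟨-, rfl | rfl⟩
      · exact ⟨fun h1 => h1.2.1 hxh, fun h1 => h1.2.2 (compl_compl h)⟩
      · exact ⟨fun h1 => h1.2.2 (compl_compl h), fun h1 => h1.2.1 (not_not.2 hxh)⟩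
  have hcell : IsCell H {g | g ∈ H ∧ x ∈ g ∧ g ≠ h} := by
    refine ⟨fun g hg => hg.1, fun g hg hg' => hg'.2.1 hg.2.1, ?_, fun y =>
      IsCell.finite_of hH (y := x) ?_ y⟩
    · intro g1 hg1 g2 hg2 hne hdis
      by_contra hcon
      push Not at hcon
      have key : ∀ g ∈ H, gᶜ ∉ {g | g ∈ H ∧ x ∈ g ∧ g ≠ h} → x ∈ g ∨ g = hᶜ := by
        intro g hg hgσ
        by_contra hc
        push Not at hc
        exact hgσ ⟨hH.compl_mem hg, hc.1, fun he => hc.2 (by rw [← he, compl_compl])⟩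
      have key2 : ∀ g ∈ H, x ∈ g → g ≠ h → ¬ g ⊆ h := fun g hg hxg hne hsub =>
        hne (hsub.antisymm (hmin ⟨hg, hxg, fun ho => hoh (hsub ho)⟩ hsub))
      rcases key g1 hg1 hcon.1 with h1 | rfl <;> rcases key g2 hg2 hcon.2 with h2 | rfl
      · exact hdis ⟨x, h1, h2⟩
      · exact key2 g1 hg1 h1 (fun he => hne (by rw [he]))
          fun z hz => by_contra fun hzh => hdis ⟨z, hz, hzh⟩
      · exact key2 g2 hg2 h2 (fun he => hne (by rw [he, compl_compl]))
          fun z hz => by_contra fun hzh => hdis ⟨z, hzh, hz⟩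
      · exact hdis ⟨o, hoh, hoh⟩
    · refine (Set.finite_singleton h).subset ?_
      rintro g ⟨h1, h2, h3⟩
      by_contra hne
      exact h3 ⟨h1, h2, hne⟩
  obtain ⟨φ, hφ, hφσ⟩ := hcell.exists_isCubeMap (m := 1) (w := fun _ => hᶜ) hH
    (fun _ => hH.compl_mem hh) (fun i j hij => absurd (Subsingleton.elim i j) hij)
    (fun _ _ he => by
      rw [compl_compl] at he
      have hxc : x ∈ hᶜ := by rwa [he]
      exact hxc hxh) hxσ
  have hbase : φ (-1) = x := by
    refine hφ.eq_of_mem hH (fun i => ?_) fun g hg hgw hε => ?_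
    · exact iff_of_false (fun hc : x ∈ hᶜ => hc hxh) (by simp)
    · by_contra hxg
      refine hφσ gᶜ ⟨hH.compl_mem hg, hxg, fun he => (hgw 0).1 (by rw [← he, compl_compl])⟩ (-1) hε
  refine ⟨⟨φ, _, hφ⟩, point_injective ?_, ?_⟩
  · exact (point_src _).trans hbase
  · refine height_tgt_lt (g := hᶜ) (hH.compl_mem hh) ?_ ?_ hoh
    · exact not_not.2 (show φ (-1) ∈ h from hbase ▸ hxh)
    · exact (hφ.mem_iff 1 0).2 rfl

/-- Descending edges lead from any vertex to `o`. At a peak, `rev e` and `f` both descend, so the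
far sides of their walls both contain `o`. Equal far sides give a backtrack; distinct ones
intersect, so the edges span a square by `exists_corner`, and its far corner is lower. -/
theorem isSimplyConnected [Nonempty V] : (dualComplex hH).IsSimplyConnected := by
  have hpath : ∀ v o : (dualComplex hH).cube 0, ∃ l, (dualComplex hH).IsEdgePath v o l := by
    intro v o
    obtain ⟨k, hk⟩ : ∃ k, height (point hH o) v = k := ⟨_, rfl⟩
    induction k using Nat.strong_induction_on generalizing v with
    | _ k ih =>
      by_cases hvo : point hH v = point hH o
      · exact ⟨[], point_injective hvo⟩
      · obtain ⟨e, rfl, he⟩ := exists_descending hvo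
        obtain ⟨l, hl⟩ := ih _ (hk ▸ he) _ rfl
        exact ⟨e :: l, rfl, hl⟩
  refine ⟨⟨vertex hH (Classical.arbitrary V)⟩, hpath, fun o l hl => ?_⟩
  have hdich : ∀ e : (dualComplex hH).cube 1, ∀ w : Set V, IsCubeMap H e.1 (fun _ => w) →
      (point hH o ∈ w → height (point hH o) ((dualComplex hH).tgt e) <
        height (point hH o) ((dualComplex hH).src e)) ∧
      (point hH o ∉ w → height (point hH o) ((dualComplex hH).src e) <
        height (point hH o) ((dualComplex hH).tgt e)) := by
    intro e w hw
    have h1 : e.1 (-1) ∉ w := by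
      rw [hw.mem_iff _ 0]
      simp
    have h2 : e.1 1 ∈ w := (hw.mem_iff _ 0).2 rfl
    exact ⟨height_tgt_lt (hw.mem 0) h1 h2, height_src_lt (hw.mem 0) h1 h2⟩
  refine CubeComplex.homotopic_nil_of_height (ht := height (point hH o)) (fun e => ?_) ?_ ?_ hl
  · obtain ⟨w, hw⟩ := exists_wall e
    by_cases ho : point hH o ∈ w
    · exact ((hdich e w hw).1 ho).ne'
    · exact ((hdich e w hw).2 ho).ne
  · intro e f hef he hf
    obtain ⟨w, hw⟩ := exists_wall e
    obtain ⟨u, hu⟩ := exists_wall f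
    have how : point hH o ∉ w := fun ho => lt_asymm he ((hdich e w hw).1 ho)
    have hou : point hH o ∈ u := by
      by_contra ho
      exact lt_asymm hf ((hdich f u hu).2 ho)
    have hw' := isCubeMap_rev hw
    have hx : ((dualComplex hH).rev e).1 (-1) = f.1 (-1) := by
      rw [← point_src, ← point_src, CubeComplex.src_rev, hef]
    by_cases huw : wᶜ = u
    · left
      refine edge_ext hx.symm ?_
      refine hu.eq_of_mem hH (fun i => ?_) fun g hg hgu hε => ?_
      · rw [← huw, hw'.mem_iff]
      · have h1 := hu.const g hg hgu _ (-1) hε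
        rw [← hx] at h1
        exact hw'.const g hg (by rwa [huw]) _ _ h1
    · right
      obtain ⟨s, -, hs⟩ := exists_corner (n := 2) (v := (dualComplex hH).src f)
        (e := ![(dualComplex hH).rev e, f]) (w := ![wᶜ, u]) (by
          intro i
          fin_cases i
          · exact (CubeComplex.src_rev e).trans hef
          · rfl) (by
          intro i
          fin_cases i
          · exact hw'
          · exact hu) (by
          intro i j hij
          fin_cases i <;> fin_cases j
          · exact absurd rfl hij
          · exact huw
          · exact fun h => huw h.symm
          · exact absurd rfl hij) (by
          intro i j hij
          fin_cases i <;> fin_cases j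
          · exact absurd rfl hij
          · exact ⟨_, how, hou⟩
          · exact ⟨_, hou, how⟩
          · exact absurd rfl hij)
      have hs0 : (dualComplex hH).edgeAt s 0 = (dualComplex hH).rev e := congrFun hs 0
      have hs1 : (dualComplex hH).edgeAt s 1 = f := congrFun hs 1
      refine ⟨s, hs0, hs1, lt_trans ?_ hf⟩
      rw [← hs1, CubeComplex.tgt_edgeAt_one]
      obtain ⟨z, hz⟩ := s.2
      have hzw : z 0 = wᶜ := by
        refine edge_eq_wall hw' (hz.mem 0) ?_ ?_
        · rw [← hs0, edgeAt_val, hz.mem_iff]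
          simp
        · rw [← hs0, edgeAt_val, hz.mem_iff]
          simp
      refine height_tgt_lt (hz.mem 0) ?_ ?_ (hzw ▸ how)
      · rw [CubeComplex.topAt_eq, edgeThrough_val, hz.mem_iff]
        simp
      · rw [CubeComplex.topAt_eq, edgeThrough_val, hz.mem_iff]
        simp
  · intro v
    have : {h ∈ H | point hH o ∈ h ∧ point hH o ∉ h} = ∅ := by
      ext h
      simp
    rw [height, this, Set.ncard_empty]
    exact Nat.zero_le _

theorem isCAT0 [Nonempty V] : (dualComplex hH).IsCAT0 :=
  ⟨isSimplyConnected, fun v => ⟨linkIsSimplicial v, linkIsFlag v⟩⟩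

theorem hasDimension [Nonempty V] {n : ℕ} {w : Fin n → Set V} (hw : IsCrossingFamily H w)
    (hn : HasRankLE H n) : (dualComplex hH).HasDimension n := by
  obtain ⟨φ, hφ⟩ := hw.exists_isCubeMap hH
  exact ⟨⟨⟨φ, w, hφ⟩⟩, fun m ⟨c⟩ => let ⟨u, hu⟩ := c.2; hn m u hu.isCrossingFamily⟩

end dualComplex

end DualComplex

open scoped Pointwise

/-! ### The carrier of a point of the geometric realization. -/

namespace CubeComplex

variable {X : CubeComplex.{u}}

/-- The corner `ε` belongs to the face of the cube whose relative interior contains `x`. -/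
def CornerOf {n : ℕ} (ε : Fin n → ℤˣ) (x : Fin n → ℝ) : Prop :=
  ∀ i, (x i = 1 → ε i = 1) ∧ (x i = -1 → ε i = -1)

theorem exists_cornerOf {n : ℕ} (x : Fin n → ℝ) : ∃ ε, CornerOf ε x := by
  classical
  refine ⟨fun i => if x i = 1 then 1 else -1, fun i => ⟨fun h => if_pos h, fun h => if_neg ?_⟩⟩
  rw [h]
  norm_num

/-- Off the range of `emb` the coordinates are `±1` and pin down the corner; on the range only a
sign intervenes. Thus the carrier does not depend on the cube that represents the point. -/
theorem cornerOf_toFun_iff {m n : ℕ} (f : FaceMap m n) (x : Fin m → ℝ) (ε : Fin n → ℤˣ) :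
    CornerOf ε (f.toFun x) ↔ ∃ δ, CornerOf δ x ∧ f.act δ = ε := by
  have hemb : ∀ i, f.toFun x (f.emb i) = ((f.sign (f.emb i) : ℤ) : ℝ) * x i := fun i => by
    simp [FaceMap.toFun, f.emb.injective.extend_apply]
  have hnot : ∀ j, (∀ i, f.emb i ≠ j) → f.toFun x j = ((f.sign j : ℤ) : ℝ) := fun j hj => by
    have : ¬ ∃ i, f.emb i = j := fun ⟨i, hi⟩ => hj i hi
    simp [FaceMap.toFun, Function.extend_apply' _ _ _ this]
  have hone : ∀ s t : ℤˣ, (((s : ℤ) : ℝ) = 1 → t = 1) ∧ (((s : ℤ) : ℝ) = -1 → t = -1) →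
      t = s := by
    intro s t h
    rcases Int.units_eq_one_or s with rfl | rfl
    · exact h.1 (by simp)
    · exact h.2 (by simp)
  constructor
  · intro h
    refine ⟨fun i => f.sign (f.emb i) * ε (f.emb i), fun i => ?_, ?_⟩
    · have h1 := h (f.emb i)
      rw [hemb] at h1
      beta_reduce
      rcases Int.units_eq_one_or (f.sign (f.emb i)) with hs | hs <;> rw [hs] at h1 ⊢
      · simpa using h1
      · simp only [Units.val_neg, Units.val_one, Int.cast_neg, Int.cast_one, neg_mul, one_mul,
          neg_inj] at h1 ⊢
        exact ⟨fun hx => by rw [h1.2 hx, neg_neg], fun hx => by rw [h1.1 (by rw [hx, neg_neg])]⟩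
    · funext j
      by_cases hj : ∃ i, f.emb i = j
      · obtain ⟨i, rfl⟩ := hj
        rw [f.act_emb, ← mul_assoc, Int.units_mul_self, one_mul]
      · have hj' : ∀ i, f.emb i ≠ j := fun i hi => hj ⟨i, hi⟩
        have h1 := h j
        rw [hnot j hj'] at h1
        rw [f.act_of_notMem _ _ hj', hone _ _ h1]
  · rintro ⟨δ, hδ, rfl⟩ j
    by_cases hj : ∃ i, f.emb i = j
    · obtain ⟨i, rfl⟩ := hj
      rw [hemb, f.act_emb]
      have h1 := hδ i
      rcases Int.units_eq_one_or (f.sign (f.emb i)) with hs | hs <;> rw [hs]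
      · simpa using h1
      · simp only [Units.val_neg, Units.val_one, Int.cast_neg, Int.cast_one, neg_mul, one_mul,
          neg_inj]
        exact ⟨fun hx => by rw [h1.2 (by linarith), neg_neg], fun hx => h1.1 hx⟩
    · have hj' : ∀ i, f.emb i ≠ j := fun i hi => hj ⟨i, hi⟩
      rw [hnot j hj', f.act_of_notMem _ _ hj']
      rcases Int.units_eq_one_or (f.sign j) with hs | hs <;> rw [hs] <;> norm_num

/-- The vertices of the smallest cube that contains a point of the geometric realization. -/
def carrier (X : CubeComplex.{u}) : X.Realization → Set (X.cube 0) :=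
  Quot.lift (fun p => {v | ∃ ε, CornerOf ε p.2.2.1 ∧ X.map (FaceMap.corner ε) p.2.1 = v}) (by
    rintro _ _ ⟨f, c, x⟩
    ext v
    constructor
    · rintro ⟨δ, hδ, rfl⟩
      refine ⟨f.act δ, (cornerOf_toFun_iff f x.1 _).2 ⟨δ, hδ, rfl⟩, ?_⟩
      rw [← X.map_comp, FaceMap.comp_corner]
    · rintro ⟨ε, hε, rfl⟩
      obtain ⟨δ, hδ, rfl⟩ := (cornerOf_toFun_iff f x.1 _).1 hε
      refine ⟨δ, hδ, ?_⟩
      rw [← X.map_comp, FaceMap.comp_corner])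

theorem carrier_nonempty (p : X.Realization) : (X.carrier p).Nonempty := by
  induction p using Quot.ind with
  | mk p =>
    obtain ⟨ε, hε⟩ := exists_cornerOf p.2.2.1
    exact ⟨_, ε, hε, rfl⟩

theorem exists_cube_carrier_subset (p : X.Realization) :
    ∃ (n : ℕ) (c : X.cube n), X.carrier p ⊆ Set.range fun ε => X.map (FaceMap.corner ε) c := by
  induction p using Quot.ind with
  | mk p =>
    refine ⟨p.1, p.2.1, ?_⟩
    rintro v ⟨ε, -, rfl⟩
    exact ⟨ε, rfl⟩

theorem smul_mem_carrier {G : Type u} [Group G] (ρ : CubicalAction G X) (g : G)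
    (p : X.Realization) {v : X.cube 0} (hv : v ∈ X.carrier p) :
    ρ.smul g v ∈ X.carrier (ρ.onPoints g p) := by
  induction p using Quot.ind with
  | mk p =>
    obtain ⟨ε, hε, rfl⟩ := hv
    exact ⟨ε, hε, ρ.map_smul _ _ _⟩

end CubeComplex

/-! ### Invariant cubical sets from property `FW_n`. -/

section Action

variable {N : Type u} [Group N] {V : Type u} [MulAction N V] {H : Set (Set V)}

/-- The action on the dual complex. -/
noncomputable def dualAction (hH : IsWallSystem H) (hN : ∀ (g : N), ∀ h ∈ H, g • h ∈ H) :
    CubicalAction N (dualComplex hH) where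
  smul g c := ⟨fun ε => g • c.1 ε, by
    obtain ⟨w, hw⟩ := c.2
    refine ⟨fun i => g • w i, fun i => hN g _ (hw.mem i), fun ε i => ?_, fun h hh hc ε ε' hε => ?_⟩
    · rw [Set.smul_mem_smul_set_iff, hw.mem_iff]
    · rw [← Set.mem_inv_smul_set_iff] at hε ⊢
      refine hw.const _ (hN g⁻¹ h hh) (fun i => ⟨fun he => (hc i).1 ?_, fun he => (hc i).2 ?_⟩)
        _ _ hε
      · rw [← he, smul_inv_smul]
      · rw [← Set.smul_set_compl, ← he, smul_inv_smul]⟩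
  one_smul c := Subtype.ext (funext fun ε => one_smul N (c.1 ε))
  mul_smul g h c := Subtype.ext (funext fun ε => mul_smul g h (c.1 ε))
  map_smul f g c := rfl

/-- The fixed point of the dual action need not be a vertex; its carrier is the invariant set. -/
theorem exists_invariant_isCubical_of_crossingFamily {n : ℕ} (hFW : HasFW n N) [Nonempty V]
    (hH : IsWallSystem H) (hN : ∀ (g : N), ∀ h ∈ H, g • h ∈ H) (hn : HasRankLE H n)
    {w : Fin n → Set V} (hw : IsCrossingFamily H w) :
    ∃ F : Set V, F.Nonempty ∧ (∀ g : N, ∀ x ∈ F, g • x ∈ F) ∧ IsCubical H F := by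
  obtain ⟨p, hp⟩ := hFW _ dualComplex.isCAT0 (dualComplex.hasDimension hw hn) (dualAction hH hN)
  refine ⟨dualComplex.point hH '' (dualComplex hH).carrier p,
    (CubeComplex.carrier_nonempty p).image _, ?_, ?_⟩
  · rintro g _ ⟨v, hv, rfl⟩
    have := CubeComplex.smul_mem_carrier (dualAction hH hN) g p hv
    rw [hp g] at this
    exact ⟨_, this, rfl⟩
  · obtain ⟨m, c, hc⟩ := CubeComplex.exists_cube_carrier_subset p
    obtain ⟨u, hu⟩ := c.2
    refine hu.isCubical ?_
    rintro _ ⟨v, hv, rfl⟩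
    obtain ⟨ε, rfl⟩ := hc hv
    exact ⟨ε, (dualComplex.corner_val hH ε c 1).symm⟩

end Action

/-- `HasFW` concerns dimension exactly `n`. For a smaller rank, multiply by an edge on which `N`
acts trivially and project the invariant set back; `k` bounds the number of missing dimensions. -/
theorem exists_invariant_isCubical_aux {N : Type u} [Group N] {n : ℕ} (hFW : HasFW n N) (k : ℕ) :
    ∀ {V : Type u} [Nonempty V] [MulAction N V] {H : Set (Set V)}, IsWallSystem H →
      (∀ (g : N), ∀ h ∈ H, g • h ∈ H) → HasRankLE H n →
      (∃ m, n ≤ m + k ∧ ∃ w : Fin m → Set V, IsCrossingFamily H w) →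
      ∃ F : Set V, F.Nonempty ∧ (∀ g : N, ∀ x ∈ F, g • x ∈ F) ∧ IsCubical H F := by
  induction k with
  | zero =>
    rintro V _ _ H hH hN hn ⟨m, hm, w, hw⟩
    obtain rfl : m = n := le_antisymm (hn m w hw) hm
    exact exists_invariant_isCubical_of_crossingFamily hFW hH hN hn hw
  | succ k ih =>
    rintro V _ _ H hH hN hn ⟨m, hm, w, hw⟩
    by_cases hex : ∃ m, n ≤ m + k ∧ ∃ w : Fin m → Set V, IsCrossingFamily H w
    · exact ih hH hN hn hex
    have hmn : m + 1 ≤ n := by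
      by_contra hlt
      exact hex ⟨m, by omega, w, hw⟩
    have hrank : HasRankLE H m := by
      intro m' w' hw'
      by_contra hlt
      exact hex ⟨m', by omega, w', hw'⟩
    let : MulAction N (V × Bool) :=
      { smul := fun g x => (g • x.1, x.2)
        one_smul := fun x => Prod.ext (one_smul N x.1) rfl
        mul_smul := fun g h x => Prod.ext (mul_smul g h x.1) rfl }
    have hsmul : ∀ (g : N) (x : V × Bool), g • x = (g • x.1, x.2) := fun _ _ => rfl
    obtain ⟨F, hF, hFN, hFH⟩ := ih hH.prodBool (by
        rintro g _ (⟨h, hh, rfl⟩ | ⟨b, rfl⟩)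
        · refine .inl ⟨g • h, hN g h hh, ?_⟩
          ext x
          rw [Set.mem_smul_set_iff_inv_smul_mem, hsmul, Set.mem_preimage, Set.mem_preimage,
            Set.mem_smul_set_iff_inv_smul_mem]
        · refine .inr ⟨b, ?_⟩
          ext x
          rw [Set.mem_smul_set_iff_inv_smul_mem, hsmul, Set.mem_preimage, Set.mem_preimage])
      (fun m' w' hw' => (hrank.prodBool m' w' hw').trans hmn)
      ⟨m + 1, by omega, _, hw.prodBool⟩
    refine ⟨Prod.fst '' F, hF.image _, ?_, hFH.image_fst⟩
    rintro g _ ⟨x, hx, rfl⟩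
    exact ⟨g • x, hFN g x hx, rfl⟩

/-- A group with property `FW_n` that acts on a wall system of rank at most `n` leaves a cube
invariant. -/
theorem exists_invariant_isCubical {N : Type u} [Group N] {n : ℕ} (hFW : HasFW n N)
    {V : Type u} [Nonempty V] [MulAction N V] {H : Set (Set V)} (hH : IsWallSystem H)
    (hN : ∀ (g : N), ∀ h ∈ H, g • h ∈ H) (hn : HasRankLE H n) :
    ∃ F : Set V, F.Nonempty ∧ (∀ g : N, ∀ x ∈ F, g • x ∈ F) ∧ IsCubical H F :=
  -- The empty family starts the argument, with all `n` dimensions possibly missing.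
  exists_invariant_isCubical_aux hFW n hH hN hn ⟨0, by omega, Fin.elim0, fun i => i.elim0,
    fun i => i.elim0, fun i => i.elim0⟩

/-! ### Faces, differences and translates of cells. -/

namespace IsCell

variable {V : Type u} {H σ : Set (Set V)}

theorem mono (hσ : IsCell H σ) {τ : Set (Set V)} (hστ : σ ⊆ τ) (hτ : τ ⊆ H)
    (hcons : ∀ h ∈ τ, hᶜ ∉ τ) : IsCell H τ where
  subset := hτ
  consistent := hcons
  disjoint h hh g hg hne hd := (hσ.disjoint h hh g hg hne hd).imp (@hστ _) (@hστ _)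
  finite y := (hσ.finite y).subset fun _ hh => ⟨hh.1, hh.2.1, fun h => hh.2.2 (hστ h)⟩

/-- With finitely many exceptions, either cell consists of the halfspaces that contain a given
point. -/
theorem finite_diff [Nonempty V] (hH : IsWallSystem H) (hσ : IsCell H σ) {τ : Set (Set V)}
    (hτ : IsCell H τ) : (σ \ τ).Finite := by
  obtain ⟨y⟩ := ‹Nonempty V›
  refine ((hτ.finite y).union ((hσ.finite y).image compl)).subset ?_
  rintro h ⟨h1, h2⟩
  by_cases hy : y ∈ h
  · exact .inl ⟨hσ.subset h1, hy, h2⟩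
  · exact .inr ⟨hᶜ, ⟨hH.compl_mem (hσ.subset h1), hy, hσ.consistent h h1⟩, compl_compl h⟩

theorem smul {G : Type u} [Group G] [MulAction G V] (hG : ∀ (g : G), ∀ h ∈ H, g • h ∈ H)
    (hσ : IsCell H σ) (a : G) : IsCell H (a • σ) where
  subset h hh := by
    have := hG a _ (hσ.subset (Set.mem_smul_set_iff_inv_smul_mem.1 hh))
    rwa [smul_inv_smul] at this
  consistent h hh hh' := by
    rw [Set.mem_smul_set_iff_inv_smul_mem] at hh hh'
    rw [Set.smul_set_compl] at hh'
    exact hσ.consistent _ hh hh'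
  disjoint h hh g hg hne hd := by
    simp only [Set.mem_smul_set_iff_inv_smul_mem, Set.smul_set_compl]
    refine hσ.disjoint _ (hG _ h hh) _ (hG _ g hg) (fun he => hne ?_) fun hd' => hd ?_
    · rw [← Set.smul_set_compl] at he
      exact smul_left_cancel _ he
    · rwa [← Set.smul_set_inter, Set.smul_set_nonempty] at hd'
  finite y := by
    refine ((hσ.finite (a⁻¹ • y)).image (a • ·)).subset ?_
    rintro h ⟨h1, h2, h3⟩
    refine ⟨a⁻¹ • h, ⟨hG _ h h1, Set.smul_mem_smul_set_iff.2 h2, fun h4 => h3 ?_⟩,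
      smul_inv_smul _ _⟩
    exact Set.mem_smul_set_iff_inv_smul_mem.2 h4

end IsCell

/-! ### The wall system of the cells that a subgroup leaves invariant. -/

section FixedCells

variable {G : Type u} [Group G] {V : Type u} [MulAction G V]

/-- The cells that a subgroup leaves invariant. -/
abbrev FixedCell (H : Set (Set V)) (K : Subgroup G) : Type u :=
  {σ : Set (Set V) // IsCell H σ ∧ ∀ k ∈ K, k • σ = σ}

/-- The invariant cells that lie in a halfspace. -/
def cellsIn (H : Set (Set V)) (K : Subgroup G) (h : Set V) : Set (FixedCell H K) :=
  {A | h ∈ A.1}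

/-- The halfspaces of the set of invariant cells. -/
def fixedHalfspaces (H : Set (Set V)) (K : Subgroup G) : Set (Set (FixedCell H K)) :=
  {k | ∃ h ∈ H, k = cellsIn H K h ∨ k = (cellsIn H K h)ᶜ}

variable {H : Set (Set V)} {K : Subgroup G}

theorem FixedCell.smul_mem_iff (A : FixedCell H K) {k : G} (hk : k ∈ K) {h : Set V} :
    k • h ∈ A.1 ↔ h ∈ A.1 := by
  conv_lhs => rw [← A.2.2 k hk]
  exact Set.smul_mem_smul_set_iff

/-- Invariant cells do not distinguish the halfspaces in a `K`-orbit, so an induced wall may come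
from several walls. -/
theorem cellsIn_smul {k : G} (hk : k ∈ K) (h : Set V) : cellsIn H K (k • h) = cellsIn H K h :=
  Set.ext fun A => A.smul_mem_iff hk

theorem cellsIn_inter {h g : Set V} (hh : h ∈ H) (hg : g ∈ H) (hne : g ≠ hᶜ)
    (hd : (cellsIn H K h ∩ cellsIn H K g).Nonempty) : (h ∩ g).Nonempty := by
  obtain ⟨A, h1, h2⟩ := hd
  by_contra hd
  rcases A.2.1.disjoint h hh g hg hne hd with h3 | h3
  · exact A.2.1.consistent h h1 h3
  · exact A.2.1.consistent g h2 h3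

/-- The complement of `cellsIn H K hᶜ` also contains the cells that cross the wall of `h`, so it can
exceed `cellsIn H K h`. The axiom `disjoint` still forbids a cell to have neither `hᶜ` nor `gᶜ` when
`h` and `g` are disjoint. -/
theorem cellsIn_compl_inter {h g : Set V} (hh : h ∈ H) (hg : g ∈ H) (hne : g ≠ hᶜ)
    (hd : ((cellsIn H K hᶜ)ᶜ ∩ (cellsIn H K gᶜ)ᶜ).Nonempty) : (h ∩ g).Nonempty := by
  obtain ⟨A, h1, h2⟩ := hd
  by_contra hd
  exact (A.2.1.disjoint h hh g hg hne hd).elim h1 h2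

theorem cellsIn_inter_compl {h g : Set V} (hh : h ∈ H) (hg : g ∈ H)
    (hd : (cellsIn H K h ∩ (cellsIn H K gᶜ)ᶜ).Nonempty) : (h ∩ g).Nonempty := by
  obtain ⟨A, h1, h2⟩ := hd
  by_contra hd
  have hne : g ≠ hᶜ := by
    rintro rfl
    rw [compl_compl] at h2
    exact h2 h1
  rcases A.2.1.disjoint h hh g hg hne hd with h3 | h3
  · exact A.2.1.consistent h h1 h3
  · exact h2 h3

/-- An invariant cell in a quadrant of the induced walls forces the corresponding quadrant in `V` to
be non-empty. The bound on the rank comes from here. -/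
theorem crosses_of_cellsIn (hH : IsWallSystem H) {h g : Set V} (hh : h ∈ H) (hg : g ∈ H)
    (hc : Crosses (cellsIn H K h) (cellsIn H K g)) : Crosses h g := by
  have hdisj : ∀ {f : Set V}, ¬ (cellsIn H K f ∩ cellsIn H K fᶜ).Nonempty := by
    rintro f ⟨A, h1, h2⟩
    exact A.2.1.consistent f h1 h2
  obtain ⟨h1, h2, h3, h4⟩ := hc
  refine ⟨cellsIn_inter hh hg ?_ h1, cellsIn_inter_compl hh (hH.compl_mem hg) (by rwa [compl_compl]),
    ?_, cellsIn_compl_inter (hH.compl_mem hh) (hH.compl_mem hg) ?_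
      (by rwa [compl_compl, compl_compl])⟩
  · rintro rfl
    exact hdisj h1
  · rw [Set.inter_comm] at h3 ⊢
    exact cellsIn_inter_compl hg (hH.compl_mem hh) (by rwa [compl_compl])
  · intro he
    rw [compl_compl] at he
    obtain rfl : g = hᶜ := by rw [← he, compl_compl]
    exact hdisj h1

theorem HasRankLE.fixedHalfspaces [Nonempty V] (hH : IsWallSystem H) {n : ℕ} (hn : HasRankLE H n) :
    HasRankLE (fixedHalfspaces H K) n := by
  intro m w hw
  choose v hv hwv using hw.mem
  refine hn m v ⟨hv, fun i => ?_, fun i j hij => crosses_of_cellsIn (K := K) hH (hv i) (hv j) ?_⟩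
  -- A wall system may contain the empty set; it and its complement induce only trivial halfspaces,
  -- so they do not occur in `v`.
  · have key : ∀ A : FixedCell H K, ∅ ∈ H → ∅ ∉ A.1 ∧ Set.univ ∈ A.1 := by
      intro A h0
      have hne' : (∅ : Set V) ≠ ∅ᶜ := by
        rw [Set.compl_empty]
        exact Set.empty_ne_univ
      have h1 : (∅ : Set V)ᶜ ∈ A.1 := (A.2.1.disjoint ∅ h0 ∅ h0 hne' (by simp)).elim id id
      exact ⟨fun h2 => A.2.1.consistent _ h2 h1, by rwa [Set.compl_empty] at h1⟩
    obtain ⟨A, hA⟩ : ∃ A : FixedCell H K, v i ∈ A.1 := by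
      rcases hwv i with h | h
      · obtain ⟨A, hA⟩ := (hw.nonempty i).1
        rw [h] at hA
        exact ⟨A, hA⟩
      · obtain ⟨A, hA⟩ := (hw.nonempty i).2
        rw [h, compl_compl] at hA
        exact ⟨A, hA⟩
    obtain ⟨B, hB⟩ : ∃ B : FixedCell H K, v i ∉ B.1 := by
      rcases hwv i with h | h
      · obtain ⟨A, hA⟩ := (hw.nonempty i).2
        rw [h] at hA
        exact ⟨A, hA⟩
      · obtain ⟨A, hA⟩ := (hw.nonempty i).1
        rw [h] at hA
        exact ⟨A, hA⟩
    constructor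
    · rw [Set.nonempty_iff_ne_empty]
      intro he
      rw [he] at hA
      exact (key A (he ▸ hv i)).1 hA
    · rw [Set.nonempty_compl]
      intro he
      rw [he] at hB
      refine hB (key B ?_).2
      have := hH.compl_mem (hv i)
      rwa [he, Set.compl_univ] at this
  · have hc := hw.crosses i j hij
    rcases hwv i with h | h <;> rcases hwv j with h' | h' <;> rw [h, h'] at hc
    · exact hc
    · simpa using hc.compl_right
    · simpa using hc.compl_left
    · simpa using hc.compl_left.compl_right

/-- For completeness, a choice `τ` of induced halfspaces is realised by the cell of all `h` whose
induced halfspace belongs to `τ`. It is `K`-invariant because `cellsIn` is constant on `K`-orbits.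
-/
theorem IsWallSystem.fixedHalfspaces [Nonempty V] (hH : IsWallSystem H)
    (hG : ∀ (g : G), ∀ h ∈ H, g • h ∈ H) : IsWallSystem (fixedHalfspaces H K) where
  compl_mem := by
    rintro _ ⟨h, hh, rfl | rfl⟩
    · exact ⟨h, hh, .inr rfl⟩
    · exact ⟨h, hh, .inl (compl_compl _)⟩
  finite A B := by
    refine (((A.2.1.finite_diff hH B.2.1).image (cellsIn H K)).union
      ((B.2.1.finite_diff hH A.2.1).image fun h => (cellsIn H K h)ᶜ)).subset ?_
    rintro _ ⟨⟨h, hh, rfl | rfl⟩, h1, h2⟩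
    · exact .inl ⟨h, ⟨h1, h2⟩, rfl⟩
    · exact .inr ⟨h, ⟨not_not.1 h2, h1⟩, rfl⟩
  separates := by
    intro A B hAB
    by_cases h1 : A.1 ⊆ B.1
    · have h2 : ¬ B.1 ⊆ A.1 := fun h2 => hAB (Subtype.ext (h1.antisymm h2))
      obtain ⟨h, hB, hA⟩ := Set.not_subset.1 h2
      exact ⟨_, ⟨h, B.2.1.subset hB, .inr rfl⟩, hA, not_not.2 hB⟩
    · obtain ⟨h, hA, hB⟩ := Set.not_subset.1 h1
      exact ⟨_, ⟨h, A.2.1.subset hA, .inl rfl⟩, hA, hB⟩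
  complete := by
    intro τ hτ htot hpair A hfin
    obtain ⟨y⟩ := ‹Nonempty V›
    have hτc : ∀ h ∈ H, cellsIn H K h ∉ τ → (cellsIn H K h)ᶜ ∈ τ := fun h hh h1 =>
      (htot _ ⟨h, hh, .inl rfl⟩).resolve_left h1
    have hτc' : ∀ h, cellsIn H K h ∈ τ → (cellsIn H K h)ᶜ ∉ τ := by
      intro h h1 h2
      obtain ⟨B, h3, h4⟩ := hpair _ h1 _ h2
      exact h4 h3
    let σ : Set (Set V) := {h | h ∈ H ∧ cellsIn H K h ∈ τ}
    have hdiff : (A.1 \ σ).Finite := by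
      -- Each `u` in `τ` contains some cell `B`, so the `h ∈ A` that induce its complement all lie
      -- in the finite set `A \ B`.
      refine (hfin.biUnion (t := fun u => {h | h ∈ A.1 ∧ (cellsIn H K h)ᶜ = u}) ?_).subset ?_
      · rintro u ⟨hu, -⟩
        obtain ⟨B, hB, -⟩ := hpair u hu u hu
        refine (A.2.1.finite_diff hH B.2.1).subset ?_
        rintro h ⟨h1, rfl⟩
        exact ⟨h1, hB⟩
      · rintro h ⟨h1, h2⟩
        have h3 := hτc h (A.2.1.subset h1) fun h3 => h2 ⟨A.2.1.subset h1, h3⟩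
        exact Set.mem_biUnion (x := (cellsIn H K h)ᶜ) ⟨h3, not_not.2 h1⟩ ⟨h1, rfl⟩
    have hσ : IsCell H σ := by
      refine ⟨fun h hh => hh.1, ?_, ?_, fun x => IsCell.finite_of hH (y := y) ?_ x⟩
      · rintro h ⟨-, h1⟩ ⟨-, h2⟩
        obtain ⟨B, h3, h4⟩ := hpair _ h1 _ h2
        exact B.2.1.consistent h h3 h4
      · intro h hh g hg hne hd
        by_contra hcon
        push Not at hcon
        have h1 := hτc _ (hH.compl_mem hh) fun h1 => hcon.1 ⟨hH.compl_mem hh, h1⟩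
        have h2 := hτc _ (hH.compl_mem hg) fun h2 => hcon.2 ⟨hH.compl_mem hg, h2⟩
        exact hd (cellsIn_compl_inter hh hg hne (hpair _ h1 _ h2))
      · refine ((A.2.1.finite y).union hdiff).subset ?_
        rintro h ⟨h1, h2, h3⟩
        by_cases hA : h ∈ A.1
        · exact .inr ⟨hA, h3⟩
        · exact .inl ⟨h1, h2, hA⟩
    refine ⟨⟨σ, hσ, fun k hk => ?_⟩, ?_⟩
    · ext h
      rw [Set.mem_smul_set_iff_inv_smul_mem]
      refine ⟨fun ⟨h1, h2⟩ => ⟨?_, ?_⟩, fun ⟨h1, h2⟩ => ⟨hG _ _ h1, ?_⟩⟩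
      · have := hG k _ h1
        rwa [smul_inv_smul] at this
      · rwa [cellsIn_smul (K.inv_mem hk)] at h2
      · rwa [cellsIn_smul (K.inv_mem hk)]
    · rintro _ ⟨h, hh, rfl | rfl⟩
      · exact ⟨fun h1 => ⟨hh, h1⟩, fun h1 => h1.2⟩
      · exact ⟨fun h1 h2 => hτc' h h2.2 h1, fun h1 => hτc h hh fun h2 => h1 ⟨hh, h2⟩⟩

/-- If a halfspace and its complement both contain invariant cells, then some invariant cell
crosses the wall. -/
theorem FixedCell.exists_crossing [Nonempty V] (hH : IsWallSystem H)
    {A B : FixedCell H K} {h : Set V} (hA : h ∈ A.1)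
    (hB : hᶜ ∈ B.1) : ∃ C : FixedCell H K, h ∉ C.1 ∧ hᶜ ∉ C.1 := by
  -- Move `A` towards `B` until it crosses the wall of `h`; the number of separating halfspaces
  -- drops each time.
  obtain ⟨n, hn⟩ : ∃ n, {g | g ∈ A.1 ∧ gᶜ ∈ B.1}.ncard = n := ⟨_, rfl⟩
  induction n using Nat.strong_induction_on generalizing A with
  | _ n ih =>
    set D := {g | g ∈ A.1 ∧ gᶜ ∈ B.1} with hD
    have hDfin : D.Finite := (A.2.1.finite_diff hH B.2.1).subset fun g hg =>
      ⟨hg.1, fun h => B.2.1.consistent g h hg.2⟩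
    have hDK : ∀ k ∈ K, ∀ g ∈ D, k • g ∈ D := fun k hk g hg =>
      ⟨(A.smul_mem_iff hk).2 hg.1, by rw [← Set.smul_set_compl]; exact (B.smul_mem_iff hk).2 hg.2⟩
    obtain ⟨h₀, hh₀, hmin⟩ := hDfin.exists_minimal ⟨h, hA, hB⟩
    let S : Set (Set V) := {s | ∃ k ∈ K, k • h₀ = s}
    have hSD : S ⊆ D := by
      rintro _ ⟨k, hk, rfl⟩
      exact hDK k hk _ hh₀
    have hSmin : ∀ s ∈ S, ∀ g ∈ D, g ⊆ s → g = s := by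
      rintro _ ⟨k, hk, rfl⟩ g hg hsub
      refine hsub.antisymm ?_
      have h1 : k⁻¹ • g ⊆ h₀ := by
        rw [Set.smul_set_subset_iff_subset_inv_smul_set, inv_inv]
        exact hsub
      have h2 := hmin (hDK _ (K.inv_mem hk) g hg) h1
      rwa [← Set.smul_set_subset_iff_subset_inv_smul_set] at h2
    have hSK : ∀ k ∈ K, ∀ s, k • s ∈ S ↔ s ∈ S := by
      intro k hk s
      constructor
      · rintro ⟨l, hl, he⟩
        exact ⟨k⁻¹ * l, K.mul_mem (K.inv_mem hk) hl, by rw [mul_smul, he, inv_smul_smul]⟩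
      · rintro ⟨l, hl, rfl⟩
        exact ⟨k * l, K.mul_mem hk hl, mul_smul _ _ _⟩
    -- The face of `A` facing `B`: walls crossed by `A` but not by `B` take the side of `B`.
    -- Deleting the orbit `S` of a minimal separating halfspace then extends this face across the
    -- walls of `S`.
    let A' : Set (Set V) := A.1 ∪ {g | g ∈ B.1 ∧ gᶜ ∉ A.1}
    have hA'c : ∀ g ∈ A', gᶜ ∉ A' := by
      rintro g (h1 | h1) (h2 | h2)
      · exact A.2.1.consistent g h1 h2
      · exact h2.2 (by rwa [compl_compl])
      · exact h1.2 h2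
      · exact B.2.1.consistent g h1.1 h2.1
    have hA' : IsCell H A' := by
      refine A.2.1.mono Set.subset_union_left ?_ hA'c
      rintro g (h1 | h1)
      · exact A.2.1.subset h1
      · exact B.2.1.subset h1.1
    have hA'D : ∀ g ∈ A', gᶜ ∈ B.1 → g ∈ D := by
      rintro g (h1 | h1) h2
      · exact ⟨h1, h2⟩
      · exact absurd h2 (B.2.1.consistent g h1.1)
    -- Minimality enters here: were `h2ᶜ` not in `A'`, then `h2` would be a separating halfspace
    -- strictly inside `h1ᶜ`.
    have hkey : ∀ h1 ∈ H, ∀ h2 ∈ H, h2 ≠ h1ᶜ → ¬ (h1 ∩ h2).Nonempty → h1ᶜ ∈ S →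
        h2ᶜ ∈ A' \ S := by
      intro h1 hh1 h2 hh2 hne hd hS
      have hB1 : h1 ∈ B.1 := by simpa using (hSD hS).2
      have hB2 : h2ᶜ ∈ B.1 := (B.2.1.disjoint h1 hh1 h2 hh2 hne hd).resolve_left
        (B.2.1.consistent h1 hB1)
      have hsub : h2 ⊆ h1ᶜ := fun x hx2 hx1 => hd ⟨x, hx1, hx2⟩
      refine ⟨?_, fun hS2 => B.2.1.consistent _ (by simpa using (hSD hS2).2) hB2⟩
      by_contra hA2
      refine hne (hSmin _ hS h2 ⟨?_, hB2⟩ hsub)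
      by_contra hA3
      exact hA2 (.inr ⟨hB2, by rwa [compl_compl]⟩)
    have hC : IsCell H (A' \ S) := by
      obtain ⟨y⟩ := ‹Nonempty V›
      refine ⟨fun g hg => hA'.subset hg.1, fun g hg hg' => hA'c g hg.1 hg'.1, ?_, fun x =>
        IsCell.finite_of hH (y := y) ?_ x⟩
      · intro h1 hh1 h2 hh2 hne hd
        by_cases hS1 : h1ᶜ ∈ S
        · exact .inr (hkey h1 hh1 h2 hh2 hne hd hS1)
        by_cases hS2 : h2ᶜ ∈ S
        · refine .inl (hkey h2 hh2 h1 hh1 ?_ (by rwa [Set.inter_comm]) hS2)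
          rintro rfl
          exact hne (compl_compl _).symm
        · exact (hA'.disjoint h1 hh1 h2 hh2 hne hd).imp (fun h => ⟨h, hS1⟩) fun h => ⟨h, hS2⟩
      · refine ((hA'.finite y).union (hDfin.subset hSD)).subset ?_
        rintro g ⟨h1, h2, h3⟩
        by_cases hg : g ∈ S
        · exact .inr hg
        · exact .inl ⟨h1, h2, fun h4 => h3 ⟨h4, hg⟩⟩
    have hCK : ∀ k ∈ K, k • (A' \ S) = A' \ S := by
      intro k hk
      ext g
      rw [Set.mem_smul_set_iff_inv_smul_mem]
      have hk' := K.inv_mem hk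
      simp only [A', Set.mem_sdiff, Set.mem_union, Set.mem_ofPred_eq, hSK _ hk',
        A.smul_mem_iff hk', B.smul_mem_iff hk', ← Set.smul_set_compl]
    by_cases hhC : h ∈ A' \ S
    · refine ih _ ?_ (A := ⟨A' \ S, hC, hCK⟩) hhC rfl
      rw [← hn]
      refine Set.ncard_lt_ncard ⟨?_, fun hsub => ?_⟩ hDfin
      · rintro g ⟨h1, h2⟩
        exact hA'D g h1.1 h2
      · exact (hsub hh₀).1.2 ⟨1, K.one_mem, one_smul _ _⟩
    · exact ⟨⟨A' \ S, hC, hCK⟩, hhC, fun h1 => hA'c h (.inl hA) h1.1⟩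

/-- The action on the cells that a normal subgroup leaves invariant. -/
@[reducible] def fixedCellAction [K.Normal] (hG : ∀ (g : G), ∀ h ∈ H, g • h ∈ H) :
    MulAction G (FixedCell H K) where
  smul g A := ⟨g • A.1, A.2.1.smul hG g, fun k hk => by
    have h1 := A.2.2 _ (‹K.Normal›.conj_mem k hk g⁻¹)
    rw [inv_inv] at h1
    calc k • g • A.1 = g • (g⁻¹ * k * g) • A.1 := by
          rw [← mul_smul, ← mul_smul]
          congr 1
          group
      _ = g • A.1 := by rw [h1]⟩
  one_smul A := Subtype.ext (one_smul G A.1)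
  mul_smul g g' A := Subtype.ext (mul_smul g g' A.1)

/-- The cells in an invariant cubical set of cells have a common face. -/
theorem isCell_iUnion [Nonempty V] (hH : IsWallSystem H)
    {F : Set (FixedCell H K)} (hF : F.Nonempty) (hcub : IsCubical (fixedHalfspaces H K) F) :
    IsCell H {h | ∃ A ∈ F, h ∈ A.1} := by
  obtain ⟨A₀, hA₀⟩ := hF
  refine A₀.2.1.mono (fun h hh => ⟨A₀, hA₀, hh⟩) ?_ ?_
  · rintro h ⟨A, -, hA⟩
    exact A.2.1.subset hA
  · rintro h ⟨A, hAF, hA⟩ ⟨B, hBF, hB⟩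
    have hh := A.2.1.subset hA
    -- The halfspaces induced by `h` and `hᶜ` both separate `A` from `B`. They are disjoint and
    -- distinct, so cubicality makes them complementary; but an invariant cell crossing the wall of
    -- `h` lies in neither.
    rcases hcub _ ⟨h, hh, .inl rfl⟩ _ ⟨hᶜ, hH.compl_mem hh, .inl rfl⟩ ⟨A, hAF, hA⟩
      ⟨B, hBF, fun h1 => B.2.1.consistent h h1 hB⟩ ⟨B, hBF, hB⟩
      ⟨A, hAF, A.2.1.consistent h hA⟩ with h1 | h1 | ⟨C, h1, h2⟩
    · exact A.2.1.consistent h hA (h1.symm ▸ hA : A ∈ cellsIn H K hᶜ)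
    · obtain ⟨C, h2, h3⟩ := FixedCell.exists_crossing hH hA hB
      exact h3 (h1.symm ▸ h2 : C ∈ cellsIn H K hᶜ)
    · exact C.2.1.consistent h h1 h2

/-- An extension of groups with property `FW_n` that acts on a wall system of rank at most `n`
leaves a cell invariant if the kernel does. -/
theorem exists_invariant_isCell {N : Type u} [Group N] {n : ℕ} (hFW : HasFW n N) [Nonempty V]
    (π : G →* N) (hπ : Function.Surjective π) (hH : IsWallSystem H)
    (hG : ∀ (g : G), ∀ h ∈ H, g • h ∈ H) (hn : HasRankLE H n) {σ : Set (Set V)}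
    (hσ : IsCell H σ) (hσK : ∀ k ∈ π.ker, k • σ = σ) :
    ∃ τ, IsCell H τ ∧ ∀ g : G, g • τ = τ := by
  let := fixedCellAction (K := π.ker) hG
  have hval : ∀ (g : G) (A : FixedCell H π.ker), (g • A).1 = g • A.1 := fun _ _ => rfl
  -- The kernel acts trivially on its own invariant cells, so the action of `G` descends to `N`.
  have hker : π.ker ≤ (MulAction.toPermHom G (FixedCell H π.ker)).ker := fun k hk =>
    Equiv.ext fun A => Subtype.ext (A.2.2 k hk)
  let ψ : N →* Equiv.Perm (FixedCell H π.ker) :=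
    MonoidHom.liftOfSurjective π hπ ⟨MulAction.toPermHom G (FixedCell H π.ker), hker⟩
  have hψ : ∀ g, ψ (π g) = MulAction.toPermHom G (FixedCell H π.ker) g := fun g =>
    MonoidHom.liftOfRightInverse_comp_apply _ _ _ _ _
  let : MulAction N (FixedCell H π.ker) := MulAction.compHom _ ψ
  have hsmul : ∀ (g : G) (A : FixedCell H π.ker), π g • A = g • A := fun g A =>
    congrArg (fun e : Equiv.Perm (FixedCell H π.ker) => e A) (hψ g)
  have : Nonempty (FixedCell H π.ker) := ⟨⟨σ, hσ, hσK⟩⟩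
  obtain ⟨F, hF, hFN, hFH⟩ := exists_invariant_isCubical hFW
    (hH.fixedHalfspaces (K := π.ker) hG) (by
      intro x k hk
      obtain ⟨g, rfl⟩ := hπ x
      have hc : ∀ h, π g • cellsIn H π.ker h = cellsIn H π.ker (g • h) := by
        intro h
        ext A
        rw [Set.mem_smul_set_iff_inv_smul_mem, ← map_inv, hsmul]
        change h ∈ g⁻¹ • A.1 ↔ g • h ∈ A.1
        rw [Set.mem_inv_smul_set_iff]
      obtain ⟨h, hh, rfl | rfl⟩ := hk
      · exact ⟨_, hG g h hh, .inl (hc h)⟩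
      · refine ⟨_, hG g h hh, .inr ?_⟩
        rw [Set.smul_set_compl, hc]) (hn.fixedHalfspaces hH)
  refine ⟨_, isCell_iUnion hH hF hFH, ?_⟩
  have hle : ∀ g : G, ∀ h, (∃ A ∈ F, h ∈ A.1) → ∃ A ∈ F, g • h ∈ A.1 := by
    rintro g h ⟨A, hA, hh⟩
    refine ⟨π g • A, hFN _ _ hA, ?_⟩
    rw [hsmul, hval]
    exact Set.smul_mem_smul_set_iff.2 hh
  intro g
  ext h
  rw [Set.mem_smul_set_iff_inv_smul_mem]
  constructor
  · intro hh
    have := hle g _ hh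
    rwa [smul_inv_smul] at this
  · exact hle g⁻¹ h

end FixedCells

/-- If two disjoint halfspaces both meet `F`, each of them separates points of `F`; cubicality
allows this for complementary halfspaces only. -/
theorem IsCubical.isCell {V : Type u} {H : Set (Set V)} (hH : IsWallSystem H) {F : Set V}
    (hF : F.Nonempty) (hfin : F.Finite) (hcub : IsCubical H F) :
    IsCell H {h | h ∈ H ∧ F ⊆ h} := by
  obtain ⟨y, hy⟩ := hF
  have hsplit : ∀ h ∈ H, hᶜ ∉ {h | h ∈ H ∧ F ⊆ h} → (F ∩ h).Nonempty := by
    intro h hh hn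
    by_contra hne
    exact hn ⟨hH.compl_mem hh, fun x hx hxh => hne ⟨x, hx, hxh⟩⟩
  refine ⟨fun h hh => hh.1, fun h hh hh' => hh'.2 hy (hh.2 hy), ?_, fun x =>
    IsCell.finite_of hH (y := y) ?_ x⟩
  · intro h hh g hg hne hd
    by_contra hcon
    push Not at hcon
    have h1 := hsplit h hh hcon.1
    have h2 := hsplit g hg hcon.2
    have h3 : (F ∩ hᶜ).Nonempty := h2.imp fun x hx => ⟨hx.1, fun hxh => hd ⟨x, hxh, hx.2⟩⟩
    have h4 : (F ∩ gᶜ).Nonempty := h1.imp fun x hx => ⟨hx.1, fun hxg => hd ⟨x, hx.2, hxg⟩⟩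
    rcases hcub h hh g hg h1 h3 h2 h4 with rfl | h5 | h5
    · obtain ⟨x, hx⟩ := h1
      exact hd ⟨x, hx.2, hx.2⟩
    · exact hne h5
    · exact hd h5
  · refine (hfin.biUnion fun x _ => hH.finite y x).subset ?_
    rintro h ⟨h1, h2, h3⟩
    have h4 : ¬ F ⊆ h := fun h4 => h3 ⟨h1, h4⟩
    obtain ⟨x, hx, hxh⟩ := Set.not_subset.1 h4
    exact Set.mem_biUnion hx ⟨h1, h2, hxh⟩

theorem forall_of_update {n : ℕ} {R : (Fin n → ℤˣ) → Prop}
    (h : ∀ ε i s, R ε → R (Function.update ε i s)) (ε ε' : Fin n → ℤˣ) (hε : R ε) : R ε' := by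
  have key : ∀ S : Finset (Fin n), R (S.piecewise ε' ε) := by
    intro S
    induction S using Finset.induction_on with
    | empty => simpa using hε
    | insert i S _ ih =>
      rw [Finset.piecewise_insert]
      exact h _ _ _ ih
  simpa using key Finset.univ

/-! ### Cubes of a CAT(0) cube complex and cells of its halfspaces. -/

namespace CubeComplex

variable {X : CubeComplex.{u}}

namespace IsCAT0

variable (hX : X.IsCAT0)
include hX

/-- Parallel edges of a cube are joined by a chain of squares in which successive ones are opposite.
-/
theorem side_edgeThrough {n : ℕ} (c : X.cube n) (ε : Fin n → ℤˣ) (i : Fin n) :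
    X.side (X.map (FaceMap.edgeThrough ε i) c) = X.side (X.edgeAt c i) := by
  refine forall_of_update (R := fun ε => X.side (X.map (FaceMap.edgeThrough ε i) c) =
    X.side (X.edgeAt c i)) (fun ε j s hε => ?_) (-1) ε rfl
  by_cases hij : i = j
  · subst hij
    rwa [FaceMap.edgeThrough_update]
  · have h1 := hX.side_topAt_zero (X.map (FaceMap.squareThrough ε i j hij) c)
    rw [topAt_eq, edgeAt_eq, ← X.map_comp, ← X.map_comp, FaceMap.squareThrough_edge_zero,
      FaceMap.squareThrough_edge_zero] at h1
    simp only [Pi.neg_apply, Pi.one_apply] at h1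
    have h2 : ∀ s t, X.side (X.map (FaceMap.edgeThrough (Function.update ε j s) i) c) =
        X.side (X.map (FaceMap.edgeThrough (Function.update ε j t) i) c) := by
      intro s t
      rcases Int.units_eq_one_or s with rfl | rfl <;>
        rcases Int.units_eq_one_or t with rfl | rfl
      · rfl
      · exact h1
      · exact h1.symm
      · rfl
    have h3 := h2 s (ε j)
    rw [Function.update_eq_self] at h3
    exact h3.trans hε

/-- The complement appears because the sign `1` marks the terminal end of an edge. Any halfspace
that is not a side of these walls is split by no edge of the cube. -/
theorem isCubeMap_corner {n : ℕ} (c : X.cube n) :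
    IsCubeMap X.halfspaces (fun ε => X.map (FaceMap.corner ε) c)
      (fun i => (X.side (X.edgeAt c i))ᶜ) where
  mem i := hX.compl_mem_halfspaces ⟨_, rfl⟩
  mem_iff ε i := by
    rw [← hX.side_edgeThrough c ε i]
    constructor
    · intro h
      by_contra h1
      have h2 := hX.src_mem_side (X.map (FaceMap.edgeThrough ε i) c)
      rw [src_edgeThrough, ← units_ne_one_iff.1 h1, Function.update_eq_self] at h2
      exact h h2
    · intro h1
      have h2 := hX.tgt_notMem_side (X.map (FaceMap.edgeThrough ε i) c)
      rwa [tgt_edgeThrough, ← h1, Function.update_eq_self] at h2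
  const h hh hw := by
    refine fun ε ε' => forall_of_update (R := fun ε => X.map (FaceMap.corner ε) c ∈ h)
      (fun ε i s hε => ?_) ε ε'
    have hiff : X.src (X.map (FaceMap.edgeThrough ε i) c) ∈ h ↔
        X.tgt (X.map (FaceMap.edgeThrough ε i) c) ∈ h := by
      constructor
      · intro h1
        by_contra h2
        have h3 := hX.side_eq_of_split' hh h1 h2
        rw [hX.side_edgeThrough] at h3
        exact (hw i).2 (by rw [compl_compl, h3])
      · intro h1
        by_contra h2
        have h3 := hX.side_eq_of_split' (hX.compl_mem_halfspaces hh) h2 (not_not.2 h1)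
        rw [hX.side_edgeThrough] at h3
        exact (hw i).1 (by rw [← h3, compl_compl])
    rw [src_edgeThrough, tgt_edgeThrough] at hiff
    have h1 : X.map (FaceMap.corner (Function.update ε i (ε i))) c ∈ h := by
      rwa [Function.update_eq_self]
    rcases Int.units_eq_one_or s with hs | hs <;>
      rcases Int.units_eq_one_or (ε i) with hi | hi <;> rw [hi] at h1 <;> rw [hs]
    · exact h1
    · exact hiff.1 h1
    · exact hiff.2 h1
    · exact h1

/-- The vertex `tgt e` is at distance one from the common initial vertex and closer to `tgt f`,
hence equal to `tgt f`. -/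
theorem edge_eq_of_side {e f : X.cube 1} (hs : X.src e = X.src f) (h : X.side e = X.side f) :
    e = f := by
  refine hX.edge_ext hs (hX.eq_of_dist_eq_zero ?_)
  have h1 := hX.tgt_notMem_side e
  rw [h] at h1
  simp only [side, Set.mem_ofPred_eq] at h1
  have h2 := hX.dist_edge f (X.tgt e)
  have h3 := hX.dist_edge e (X.tgt e)
  have h4 := dist_self (X.tgt e)
  rw [hs] at h3
  rw [hX.dist_comm]
  omega

/-- Every cell of the system of halfspaces is given by a cube. -/
theorem exists_cube_of_isCell {σ : Set (Set (X.cube 0))} (hσ : IsCell X.halfspaces σ) :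
    ∃ (m : ℕ) (c : X.cube m), (∀ h ∈ σ, X.base c ∈ h) ∧
      ∀ h ∈ X.halfspaces, (h ∉ σ ∧ hᶜ ∉ σ) ↔
        ∃ i, h = X.side (X.edgeAt c i) ∨ h = (X.side (X.edgeAt c i))ᶜ := by
  have hH := hX.isWallSystem
  have : Nonempty (X.cube 0) := hX.1.1
  obtain ⟨o⟩ := hX.1.1
  -- A corner of the cell: undecided walls take the side of `o`.
  obtain ⟨y, hy⟩ := hσ.exists_point hH
    (τ := {h | h ∈ X.halfspaces ∧ (h ∈ σ ∨ (hᶜ ∉ σ ∧ o ∈ h))})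
    (fun h hh => ⟨hσ.subset hh, .inl hh⟩) (fun h hh => hh.1) (by
      intro h hh
      by_cases h1 : h ∈ σ
      · exact .inl ⟨hh, .inl h1⟩
      by_cases h2 : hᶜ ∈ σ
      · exact .inr ⟨hH.compl_mem hh, .inl h2⟩
      by_cases h3 : o ∈ h
      · exact .inl ⟨hh, .inr ⟨h2, h3⟩⟩
      · exact .inr ⟨hH.compl_mem hh, .inr ⟨by rwa [compl_compl], h3⟩⟩) (by
      rintro h ⟨hh, h1 | ⟨h1, h2⟩⟩ ⟨-, h3 | ⟨h3, h4⟩⟩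
      · exact hσ.consistent h h1 h3
      · rw [compl_compl] at h3
        exact h3 h1
      · exact h1 h3
      · exact h4 h2)
  have hyσ : ∀ h ∈ σ, y ∈ h := fun h hh => (hy h (hσ.subset hh)).1 ⟨hσ.subset hh, .inl hh⟩
  have hyc : ∀ h ∈ X.halfspaces, y ∈ h → hᶜ ∉ σ := fun h _ hyh h1 => hyσ _ h1 hyh
  have hfin : Finite {h | h ∈ X.halfspaces ∧ y ∈ h ∧ h ∉ σ} := hσ.finite y
  -- The undecided halfspaces at `y` become the coordinates. The axiom `disjoint` makes each of them
  -- minimal at `y`, so its wall crosses an edge there.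
  obtain ⟨m, ⟨E⟩⟩ := Finite.exists_equiv_fin {h | h ∈ X.halfspaces ∧ y ∈ h ∧ h ∉ σ}
  have hT : ∀ i : Fin m, ∃ e, X.src e = y ∧ X.side e = (E.symm i).1 := by
    intro i
    obtain ⟨h1, h2, h3⟩ := (E.symm i).2
    refine hX.exists_edge_of_minimal h1 h2 fun g hg hyg hsub => ?_
    by_contra hne
    refine (hσ.disjoint g hg _ (hH.compl_mem h1) (fun he => hne (compl_injective he.symm))
      ?_).elim (hyc g hg hyg) (by rwa [compl_compl])
    rintro ⟨x, hx1, hx2⟩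
    exact hx2 (hsub hx1)
  choose e hes heT using hT
  -- The far sides of two undecided walls meet in some `z`; both edges approach `z` and thus span a
  -- square, so flagness applies.
  obtain ⟨c, hc, hce⟩ := (hX.2 y).2 m e hes (by
    intro i j hij
    have hne : (E.symm i).1 ≠ (E.symm j).1 := fun h => hij (E.symm.injective (Subtype.ext h))
    obtain ⟨h1, h2, h3⟩ := (E.symm i).2
    obtain ⟨h4, h5, h6⟩ := (E.symm j).2
    have hint : ((E.symm i).1ᶜ ∩ (E.symm j).1ᶜ).Nonempty := by
      by_contra hd
      have := hσ.disjoint _ (hH.compl_mem h1) _ (hH.compl_mem h4)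
        (fun he => by
          rw [compl_compl] at he
          exact (he ▸ h2 : y ∈ (E.symm j).1ᶜ) h5) hd
      rw [compl_compl, compl_compl] at this
      exact this.elim h3 h6
    obtain ⟨z, hz1, hz2⟩ := hint
    rw [← heT] at hz1 hz2
    simp only [side, Set.mem_compl_iff, Set.mem_ofPred_eq] at hz1 hz2
    have h7 := hX.dist_edge (e i) z
    have h8 := hX.dist_edge (e j) z
    obtain ⟨s, hs0, hs1, -⟩ := hX.exists_square (e := e i) (f := e j) (z := z)
      (fun h => hne (by rw [← heT, ← heT, h])) ((hes i).trans (hes j).symm) (by omega) (by omega)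
    exact ⟨s, hs0, hs1⟩)
  have hside : ∀ i, X.side (X.edgeAt c i) = (E.symm i).1 := fun i => by rw [hce, heT]
  refine ⟨m, c, fun h hh => hc ▸ hyσ h hh, fun h hh => ?_⟩
  simp only [hside]
  have hsurj : ∀ g ∈ X.halfspaces, y ∈ g → g ∉ σ → ∃ i, g = (E.symm i).1 := fun g h1 h2 h3 =>
    ⟨E ⟨g, h1, h2, h3⟩, by rw [Equiv.symm_apply_apply]⟩
  constructor
  · rintro ⟨h1, h2⟩
    by_cases hyh : y ∈ h
    · obtain ⟨i, hi⟩ := hsurj h hh hyh h1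
      exact ⟨i, .inl hi⟩
    · obtain ⟨i, hi⟩ := hsurj hᶜ (hH.compl_mem hh) hyh h2
      exact ⟨i, .inr (by rw [← hi, compl_compl])⟩
  · rintro ⟨i, rfl | rfl⟩
    · obtain ⟨h1, h2, h3⟩ := (E.symm i).2
      exact ⟨h3, hyc _ h1 h2⟩
    · obtain ⟨h1, h2, h3⟩ := (E.symm i).2
      exact ⟨hyc _ h1 h2, by rwa [compl_compl]⟩

/-- The members of a crossing family give distinct coordinate walls of the cube of their common
cell. -/
theorem hasRankLE {n : ℕ} (hn : X.HasDimension n) : HasRankLE X.halfspaces n := by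
  intro m w hw
  have : Nonempty (X.cube 0) := hX.1.1
  obtain ⟨σ, hσ, hiff⟩ := hw.exists_isCell hX.isWallSystem
  obtain ⟨k, c, -, hc⟩ := hX.exists_cube_of_isCell hσ
  refine le_trans ?_ (hn.2 k ⟨c⟩)
  have hex : ∀ i, ∃ j, w i = X.side (X.edgeAt c j) ∨ w i = (X.side (X.edgeAt c j))ᶜ := fun i =>
    (hc _ (hw.mem i)).1 ((hiff _ (hw.mem i)).2 ⟨i, .inl rfl⟩)
  choose f hf using hex
  have hinj : Function.Injective f := by
    intro i j hij
    by_contra hne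
    have h1 := hf i
    have h2 := hf j
    rw [← hij] at h2
    rcases h1 with h1 | h1 <;> rcases h2 with h2 | h2
    · exact hw.ne hne (h1.trans h2.symm)
    · exact hw.ne_compl i j (by rw [h1, h2, compl_compl])
    · exact hw.ne_compl i j (by rw [h1, h2])
    · exact hw.ne hne (h1.trans h2.symm)
  simpa using Fintype.card_le_of_injective f hinj

end IsCAT0

end CubeComplex

/-! ### Invariant cells versus fixed points, and the conclusion. -/

namespace CubicalAction

variable {G : Type u} [Group G] {X : CubeComplex.{u}} (ρ : CubicalAction G X)

/-- The action on the vertices. -/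
abbrev vertexAction : MulAction G (X.cube 0) where
  smul g v := ρ.smul g v
  one_smul := ρ.one_smul
  mul_smul := ρ.mul_smul

theorem isEdgePath_smul (g : G) {x z : X.cube 0} {l : List (X.cube 1)}
    (h : X.IsEdgePath x z l) : X.IsEdgePath (ρ.smul g x) (ρ.smul g z) (l.map (ρ.smul g)) := by
  induction l generalizing x with
  | nil => exact congrArg (ρ.smul g) h
  | cons e l ih =>
    refine ⟨?_, ?_⟩
    · rw [← h.1]
      exact ρ.map_smul _ _ _
    · have := ih h.2
      rwa [CubeComplex.tgt, ← ρ.map_smul] at this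

theorem dist_smul (hX : X.IsCAT0) (g : G) (x z : X.cube 0) :
    X.dist (ρ.smul g x) (ρ.smul g z) = X.dist x z := by
  have key : ∀ g x z, X.dist (ρ.smul g x) (ρ.smul g z) ≤ X.dist x z := by
    intro g x z
    obtain ⟨l, hl, hlen⟩ := hX.exists_geodesic x z
    rw [← hlen, ← List.length_map (ρ.smul g)]
    exact (ρ.isEdgePath_smul g hl).dist_le
  refine (key g x z).antisymm ?_
  have := key g⁻¹ (ρ.smul g x) (ρ.smul g z)
  rwa [← ρ.mul_smul, ← ρ.mul_smul, inv_mul_cancel, ρ.one_smul, ρ.one_smul] at this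

theorem smul_side (hX : X.IsCAT0) (g : G) (e : X.cube 1) :
    letI := ρ.vertexAction
    g • X.side e = X.side (ρ.smul g e) := by
  let := ρ.vertexAction
  ext z
  rw [Set.mem_smul_set_iff_inv_smul_mem]
  change X.dist (X.src e) (ρ.smul g⁻¹ z) < X.dist (X.tgt e) (ρ.smul g⁻¹ z) ↔
    X.dist (X.src (ρ.smul g e)) z < X.dist (X.tgt (ρ.smul g e)) z
  rw [← ρ.dist_smul hX g, ← ρ.dist_smul hX g (X.tgt e), ← ρ.mul_smul, mul_inv_cancel, ρ.one_smul,
    CubeComplex.src, CubeComplex.tgt, ← ρ.map_smul, ← ρ.map_smul]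
  rfl

theorem smul_mem_halfspaces (hX : X.IsCAT0) :
    letI := ρ.vertexAction
    ∀ (g : G), ∀ h ∈ X.halfspaces, g • h ∈ X.halfspaces := by
  let := ρ.vertexAction
  rintro g _ ⟨e, rfl⟩
  exact ⟨_, (ρ.smul_side hX g e).symm⟩

/-- Translates of the cube of an invariant cell are the same cube up to reparametrization. -/
theorem exists_map_eq_smul (hX : X.IsCAT0) {σ : Set (Set (X.cube 0))}
    (hinv : letI := ρ.vertexAction; ∀ g : G, g • σ = σ) {m : ℕ} {c : X.cube m}
    (hbase : ∀ h ∈ σ, X.base c ∈ h)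
    (hc : ∀ h ∈ X.halfspaces, (h ∉ σ ∧ hᶜ ∉ σ) ↔
      ∃ i, h = X.side (X.edgeAt c i) ∨ h = (X.side (X.edgeAt c i))ᶜ) (g : G) :
    ∃ f : FaceMap m m, X.map f c = ρ.smul g c := by
  classical
  let := ρ.vertexAction
  have hH := hX.isWallSystem
  set T : Fin m → Set (X.cube 0) := fun i => X.side (X.edgeAt c i) with hTdef
  have hTH : ∀ i, T i ∈ X.halfspaces := fun i => ⟨_, rfl⟩
  have hyT : ∀ i, X.base c ∈ T i := fun i => by
    rw [← CubeComplex.src_edgeAt c i]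
    exact hX.src_mem_side _
  have hcube := hX.isCubeMap_corner c
  have hTne : ∀ {i j}, T i = T j → i = j := fun {i j} h => by
    by_contra hij
    exact hcube.isCrossingFamily.ne hij (congrArg compl h)
  have hsmul_mem : ∀ h : Set (X.cube 0), g • h ∈ σ ↔ h ∈ σ := fun h => by
    conv_lhs => rw [← hinv g]
    exact Set.smul_mem_smul_set_iff
  -- Since `g` preserves `σ`, it permutes the undecided walls, which are those of `c`.
  have hex : ∀ i, ∃ j, g • T i = T j ∨ g • T i = (T j)ᶜ := by
    intro i
    refine (hc _ (ρ.smul_mem_halfspaces hX g _ (hTH i))).1 ?_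
    rw [← Set.smul_set_compl, hsmul_mem, hsmul_mem]
    exact (hc _ (hTH i)).2 ⟨i, .inl rfl⟩
  choose p hp using hex
  have hinj : Function.Injective p := by
    intro i j hij
    have h1 := hp i
    have h2 := hp j
    rw [← hij] at h2
    have hcontra : ∀ a b, g • T a ≠ (g • T b)ᶜ := fun a b h => by
      rw [← Set.smul_set_compl] at h
      have := smul_left_cancel g h
      exact (this ▸ hyT a : X.base c ∈ (T b)ᶜ) (hyT b)
    rcases h1 with h1 | h1 <;> rcases h2 with h2 | h2
    · exact hTne (smul_left_cancel g (h1.trans h2.symm))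
    · exact absurd (by rw [h1, h2, compl_compl]) (hcontra i j)
    · exact absurd (by rw [h1, h2]) (hcontra i j)
    · exact hTne (smul_left_cancel g (h1.trans h2.symm))
  have hsurj : Function.Surjective p := Finite.surjective_of_injective hinj
  -- The signs send the corner `(-1, …, -1)` to `g • base c`: membership in `T j` means coordinate
  -- `-1`, so it requires the sign `1`.
  let f : FaceMap m m := ⟨⟨p, hinj⟩, fun j => if g • X.base c ∈ T j then 1 else -1⟩
  have hact : ∀ ε i, f.act ε (p i) = f.sign (p i) * ε i := fun ε i => f.act_emb ε i
  have hfbase : X.base (X.map f c) = g • X.base c := by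
    rw [CubeComplex.base, ← X.map_comp, FaceMap.comp_corner]
    refine hcube.eq_of_mem hH (fun j => ?_) fun h hh hw hε => ?_
    · obtain ⟨i, rfl⟩ := hsurj j
      rw [hact]
      by_cases hi : g • X.base c ∈ T (p i)
      · have : f.sign (p i) = 1 := if_pos hi
        rw [this]
        exact iff_of_false (not_not.2 hi) (by simp)
      · have : f.sign (p i) = -1 := if_neg hi
        rw [this]
        exact iff_of_true hi (by simp)
    · have hσh : h ∈ σ := by
        by_contra h1
        have h2 : hᶜ ∈ σ := by
          by_contra h2
          obtain ⟨i, hi | hi⟩ := (hc h hh).1 ⟨h1, h2⟩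
          · exact (hw i).2 (by rw [compl_compl, hi])
          · exact (hw i).1 hi
        exact hbase _ h2 (hcube.const h hh hw _ (-1) hε)
      rw [← Set.mem_inv_smul_set_iff]
      refine hbase _ ?_
      rw [← hsmul_mem, smul_inv_smul]
      exact hσh
  have hgbase : X.base (ρ.smul g c) = g • X.base c := ρ.map_smul _ _ _
  have hgedge : ∀ i, X.edgeAt (ρ.smul g c) i = ρ.smul g (X.edgeAt c i) := fun i =>
    ρ.map_smul _ _ _
  -- Both cubes have the same base, so it suffices to compare their edges there, and these are
  -- determined by their sides.
  refine ⟨f, (hX.2 (g • X.base c)).1.2 m _ _ hfbase hgbase (funext fun i => ?_)⟩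
  refine hX.edge_eq_of_side ?_ ?_
  · rw [CubeComplex.src_edgeAt, CubeComplex.src_edgeAt, hfbase, hgbase]
  · rw [hgedge, ← ρ.smul_side hX]
    have hsrc : X.src (X.edgeAt (X.map f c) i) ∈ g • T i := by
      rw [CubeComplex.src_edgeAt, hfbase, Set.smul_mem_smul_set_iff]
      exact hyT i
    refine (hX.side_eq_of_split' (ρ.smul_mem_halfspaces hX g _ (hTH i)) hsrc ?_).symm
    have hiff : X.tgt (X.edgeAt (X.map f c) i) ∈ T (p i) ↔
        X.src (X.edgeAt (X.map f c) i) ∉ T (p i) := by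
      have h1 : X.tgt (X.edgeAt (X.map f c) i) =
          X.map (FaceMap.corner (f.act (Function.update (-1) i 1))) c := by
        rw [CubeComplex.edgeAt_eq, CubeComplex.tgt_edgeThrough, ← X.map_comp, FaceMap.comp_corner]
      have h2 : X.src (X.edgeAt (X.map f c) i) =
          X.map (FaceMap.corner (f.act (-1))) c := by
        rw [CubeComplex.src_edgeAt, CubeComplex.base, ← X.map_comp, FaceMap.comp_corner]
      have h3 := hcube.mem_compl_iff (f.act (Function.update (-1) i 1)) (p i)
      have h4 := hcube.mem_iff (f.act (-1)) (p i)
      rw [compl_compl] at h3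
      rw [h1, h2]
      refine h3.trans (Iff.trans ?_ h4.symm)
      rw [hact, hact]
      rcases Int.units_eq_one_or (f.sign (p i)) with hs | hs <;> rw [hs] <;> simp
    rcases hp i with h | h <;> rw [h] at hsrc ⊢
    · exact fun ht => (hiff.1 ht) hsrc
    · exact not_not.2 (hiff.2 hsrc)

/-- Every `g` maps the cube of `σ` to itself up to an automorphism of `[-1,1]^m`, and all these
automorphisms fix the centre `0`. -/
theorem fixedPoints_nonempty (hX : X.IsCAT0) {σ : Set (Set (X.cube 0))}
    (hσ : IsCell X.halfspaces σ) (hinv : letI := ρ.vertexAction; ∀ g : G, g • σ = σ) :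
    ρ.fixedPoints.Nonempty := by
  obtain ⟨m, c, hbase, hc⟩ := hX.exists_cube_of_isCell hσ
  have h0 : (0 : Fin m → ℝ) ∈ Set.Icc (-1 : Fin m → ℝ) 1 :=
    ⟨fun i => by simp, fun i => by simp⟩
  refine ⟨Quot.mk _ ⟨m, c, ⟨0, h0⟩⟩, fun g => ?_⟩
  obtain ⟨f, hf⟩ := ρ.exists_map_eq_smul hX hinv hbase hc g
  have hglue := Quot.sound (CubeComplex.Glue.glue f c ⟨0, h0⟩)
  have hf0 : f.onCube ⟨0, h0⟩ = ⟨0, h0⟩ := by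
    refine Subtype.ext (funext fun j => ?_)
    obtain ⟨i, rfl⟩ := Finite.surjective_of_injective f.emb.injective j
    simp [FaceMap.onCube, FaceMap.toFun, f.emb.injective.extend_apply]
  rw [hf0, hf] at hglue
  exact hglue

/-- The restriction of an action along a homomorphism. -/
def comap {K : Type u} [Group K] (ι : K →* G) : CubicalAction K X where
  smul k c := ρ.smul (ι k) c
  one_smul c := by rw [map_one, ρ.one_smul]
  mul_smul k l c := by rw [map_mul, ρ.mul_smul]
  map_smul f k c := ρ.map_smul f (ι k) c

/-- A fixed point of a subgroup lies in a cell that the subgroup leaves invariant. -/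
theorem exists_invariant_isCell_of_fixedPoint (hX : X.IsCAT0) {K : Type u} [Group K] (ι : K →* G)
    (hp : (ρ.comap ι).fixedPoints.Nonempty) :
    letI := ρ.vertexAction
    ∃ σ, IsCell X.halfspaces σ ∧ ∀ k ∈ ι.range, k • σ = σ := by
  let := ρ.vertexAction
  obtain ⟨p, hp⟩ := hp
  obtain ⟨m, c, hc⟩ := CubeComplex.exists_cube_carrier_subset p
  refine ⟨_, IsCubical.isCell hX.isWallSystem (CubeComplex.carrier_nonempty p)
    ((Set.finite_range _).subset hc) ((hX.isCubeMap_corner c).isCubical hc), ?_⟩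
  have hF : ∀ (k : K), ∀ v ∈ X.carrier p, ι k • v ∈ X.carrier p := by
    intro k v hv
    have := CubeComplex.smul_mem_carrier (ρ.comap ι) k p hv
    rwa [hp k] at this
  have key : ∀ (k : K) h, (h ∈ X.halfspaces ∧ X.carrier p ⊆ h) →
      ι k • h ∈ X.halfspaces ∧ X.carrier p ⊆ ι k • h := by
    rintro k h ⟨h1, h2⟩
    refine ⟨ρ.smul_mem_halfspaces hX _ _ h1, fun v hv => ?_⟩
    rw [Set.mem_smul_set_iff_inv_smul_mem, ← map_inv]
    exact h2 (hF _ _ hv)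
  rintro _ ⟨k, rfl⟩
  ext h
  rw [Set.mem_smul_set_iff_inv_smul_mem]
  constructor
  · intro hh
    have := key k _ hh
    rwa [smul_inv_smul] at this
  · intro hh
    rw [← map_inv]
    exact key k⁻¹ h hh

end CubicalAction

theorem lemma1p6 (n : ℕ) {K G N : Type u} [Group K] [Group G] [Group N]
    (ι : K →* G) (π : G →* N) (hι : Function.Injective ι) (hexact : ι.range = π.ker)
    (hπ : Function.Surjective π) (hK : HasFW n K) (hN : HasFW n N) :
    HasFW n G := by
  intro X hX hn ρ
  let := ρ.vertexAction
  have : Nonempty (X.cube 0) := hX.1.1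
  obtain ⟨σ, hσ, hσK⟩ := ρ.exists_invariant_isCell_of_fixedPoint hX ι (hK X hX hn _)
  rw [hexact] at hσK
  obtain ⟨τ, hτ, hinv⟩ := exists_invariant_isCell hN π hπ hX.isWallSystem
    (ρ.smul_mem_halfspaces hX) (hX.hasRankLE hn) hσ hσK
  exact ρ.fixedPoints_nonempty hX hτ hinv
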